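/- For integers $n\ge 1$, $t\ge 1$ and real $B\ge 0$, let $\mathbb{R}^n_{t,B}[X]$ be the class of functions $f(x)=\sum_{S\subseteq[n]}c_S\prod_{i\in S}x_i$ on $\{0,1\}^n$ with real coefficients such that at most $t$ of the $c_S$ are non-zero and $|c_S|\le B$ for all $S$. For $\alpha\ge 1$, a probability distribution $D$ on $\{0,1\}^n$ is called locally $\alpha$-smooth if $D(x)\le\alpha D(x')$ for all $x,x'$ at Hamming distance $1$. A learner for a target $f$ can draw independent examples $(x,f(x))$ with $x\sim D$, and can make membership queries, which return $f(x')$ at a point $x'$ of its choice. A query $x'$ is $r$-local if it has Hamming distance at most $r$ from some example already drawn. The computation model is a real RAM with infinite precision: operations on real numbers and on addresses have unit cost, there is no rounding of reals to integers, and an oracle call costs $n+1$ steps. There are one program $\mathcal L$ and one absolute constant $C\ge 1$ such that the following holds for all integers $n\ge 2$, $t\ge1$ and all reals $B\ge0$, $\alpha\ge1$, $\epsilon,\delta\in(0,1)$. Put $B'=\max(B,1)$. For every locally $\alpha$-smooth distribution $D$ on $\{0,1\}^n$ and every $f\in\mathbb{R}^n_{t,B}[X]$, on input $(n,t,B,\alpha,\epsilon,\delta)$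 and with access to random examples and membership queries for $f$: (a) whatever examples are drawn, all membership queries of $\mathcal L$ are $r$-local with $r=C\alpha\,\bigl(\log(n/\epsilon)+\log(t/\epsilon)+\log B'\bigr)$; (b) whatever examples are drawn, $\mathcal L$ halts, and the number of its steps, together with the size of its output, is at most $\Bigl(C\,\bigl((ntB'/\epsilon)^{\alpha}\bigr)^{\log_2(1+\alpha)}\,\bigl(1+\log(n/\delta)\bigr)\Bigr)^{C}$; (c) the output is a multilinear polynomial $h$, given as an explicit list of terms, and with probability at least $1-\delta$ over the examples, $\mathbb{E}_{x\sim D}[(h(x)-f(x))^2]\le\epsilon$. In particular, for every fixed $\alpha$, the class $\mathbb{R}^n_{t,B}[X]$ with $B\ge 1$ is learnable in squared loss under locally $\alpha$-smooth distributions in time polynomial in $(ntB/\epsilon)^\alpha$ and $\log(n/\delta)$, with $O(\log(n/\epsilon)+\log(t/\epsilon)+\log B)$-local membership queries. -/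

import Mathlib

namespace LocalMQ

/-! ### The cube, distributions, sparse polynomials, squared loss -/

/-- The Boolean cube `{0,1}^n` (`true` is the bit `1`); Hamming distance is Mathlib's `hammingDist`. -/
abbrev Cube (n : ℕ) : Type := Fin n → Bool

/-- The monomial `ξ_S(x) = ∏_{i ∈ S} x_i`. -/
def monomial {n : ℕ} (S : Finset (Fin n)) (x : Cube n) : ℝ :=
  ∏ i ∈ S, if x i then (1 : ℝ) else 0

/-- The function on the cube given by the multilinear polynomial `∑_S c_S ξ_S`. -/
def multilinear {n : ℕ} (c : Finset (Fin n) → ℝ) (x : Cube n) : ℝ :=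
  ∑ S : Finset (Fin n), c S * monomial S x

/-- Multilinear polynomials in `n` variables with at most `t` non-zero coefficients, all of
absolute value at most `B`, as functions on the cube. -/
def sparsePolynomials (n t : ℕ) (B : ℝ) : Set (Cube n → ℝ) :=
  {f | ∃ c : Finset (Fin n) → ℝ,
    {S | c S ≠ 0}.ncard ≤ t ∧ (∀ S, |c S| ≤ B) ∧ f = multilinear c}

/-- Locally `α`-smooth distributions: `D(x) / D(x') ≤ α` whenever `x`, `x'` are at Hamming
distance `1`. -/
def locallySmooth (n : ℕ) (α : ℝ) : Set (PMF (Cube n)) :=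
  {D | ∀ x x' : Cube n, hammingDist x x' = 1 → (D x).toReal ≤ α * (D x').toReal}

/-- The squared loss `𝔼_{x ∼ D} [(h(x) - f(x))²]`. -/
noncomputable def sqLoss {n : ℕ} (D : PMF (Cube n)) (h f : Cube n → ℝ) : ℝ :=
  ∑ x : Cube n, (D x).toReal * (h x - f x) ^ 2

/-! ### The machine model

A real RAM with infinite precision: one memory of natural numbers (used for addresses, counters
and bits) and one memory of real numbers, both with indirect addressing. Natural numbers can be
added, subtracted and compared; reals can be added, subtracted, multiplied, divided and compared;
there is no rounding from reals to naturals. Programs are finite and mention no real constants. -/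

/-- Machine states: the two memories and the number of random examples received so far. -/
structure State where
  nat : ℕ → ℕ
  real : ℕ → ℝ
  seen : ℕ

/-- Natural-number expressions; subtraction is truncated, `load a` reads the natural memory. -/
inductive NatExpr where
  | const (k : ℕ)
  | load (a : NatExpr)
  | add (a b : NatExpr)
  | sub (a b : NatExpr)

namespace NatExpr

def eval (s : State) : NatExpr → ℕ
  | const k => k
  | load a => s.nat (a.eval s)
  | add a b => a.eval s + b.eval s
  | sub a b => a.eval s - b.eval s

/-- The number of operations in an expression. -/
def cost : NatExpr → ℕ
  | const _ => 1
  | load a => a.cost + 1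
  | add a b => a.cost + b.cost + 1
  | sub a b => a.cost + b.cost + 1

end NatExpr

/-- Real expressions; `load a` reads the real memory; division by zero gives zero. -/
inductive RealExpr where
  | ofNat (a : NatExpr)
  | load (a : NatExpr)
  | add (u v : RealExpr)
  | sub (u v : RealExpr)
  | mul (u v : RealExpr)
  | div (u v : RealExpr)

namespace RealExpr

noncomputable def eval (s : State) : RealExpr → ℝ
  | ofNat a => (a.eval s : ℝ)
  | load a => s.real (a.eval s)
  | add u v => u.eval s + v.eval s
  | sub u v => u.eval s - v.eval s
  | mul u v => u.eval s * v.eval s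
  | div u v => u.eval s / v.eval s

/-- The number of operations in an expression. -/
def cost : RealExpr → ℕ
  | ofNat a => a.cost + 1
  | load a => a.cost + 1
  | add u v => u.cost + v.cost + 1
  | sub u v => u.cost + v.cost + 1
  | mul u v => u.cost + v.cost + 1
  | div u v => u.cost + v.cost + 1

end RealExpr

/-- Tests for branching. -/
inductive Test where
  | natLE (a b : NatExpr)
  | realLE (u v : RealExpr)
  | not (b : Test)
  | and (b c : Test)

namespace Test

def holds (s : State) : Test → Prop
  | natLE a b => a.eval s ≤ b.eval s
  | realLE u v => u.eval s ≤ v.eval s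
  | not b => ¬ b.holds s
  | and b c => b.holds s ∧ c.holds s

/-- The number of operations in a test. -/
def cost : Test → ℕ
  | natLE a b => a.cost + b.cost + 1
  | realLE u v => u.cost + v.cost + 1
  | not b => b.cost + 1
  | and b c => b.cost + c.cost + 1

end Test

/-- Programs with access to an example oracle and to a membership query oracle. -/
inductive Program where
  | skip
  /-- Natural memory cell `a` receives the value of `v`. -/
  | setNat (a v : NatExpr)
  /-- Real memory cell `a` receives the value of `v`. -/
  | setReal (a : NatExpr) (v : RealExpr)
  /-- Call the example oracle: the bits of the example go to the natural memory cells
  `a, a + 1, …, a + n - 1`, its label goes to the real memory cell `b`. -/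
  | example_ (a b : NatExpr)
  /-- Call the membership oracle at the point whose bits are in the natural memory cells
  `a, a + 1, …, a + n - 1` (non-zero means `1`); the answer goes to the real memory cell `b`. -/
  | query (a b : NatExpr)
  | seq (p q : Program)
  | ite (b : Test) (p q : Program)
  | while (b : Test) (p : Program)

/-- The point of the cube stored in the natural memory from address `a` on. -/
def State.readPoint (n : ℕ) (s : State) (a : ℕ) : Cube n :=
  fun i => decide (s.nat (a + i) ≠ 0)

/-- Store a random example (`x`, label `y`), which becomes one more received example. -/
def State.receive {n : ℕ} (s : State) (a b : ℕ) (x : Cube n) (y : ℝ) : State where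
  nat := fun k => if h : a ≤ k ∧ k < a + n then (x ⟨k - a, by omega⟩).toNat else s.nat k
  real := Function.update s.real b y
  seen := s.seen + 1

/-- `Exec f ω r p s k s'`: started in state `s`, the program `p` halts in state `s'` after `k`
steps, where the target function is `f`, the successive calls of the example oracle return
`(ω 0, f (ω 0))`, `(ω 1, f (ω 1))`, …, and membership queries are `r`-local. The membership oracle
answers a query only if it is within Hamming distance `r` of an example that has been received
before; on any other query the program gets stuck, so that no terminating run contains one. Each
arithmetic operation, memory access and comparison is one step; an oracle call takes `n + 1` steps
on top of the computation of its addresses. -/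
inductive Exec {n : ℕ} (f : Cube n → ℝ) (ω : ℕ → Cube n) (r : ℝ) :
    Program → State → ℕ → State → Prop
  | skip (s : State) : Exec f ω r .skip s 1 s
  | setNat (s : State) (a v : NatExpr) :
      Exec f ω r (.setNat a v) s (a.cost + v.cost + 1)
        { s with nat := Function.update s.nat (a.eval s) (v.eval s) }
  | setReal (s : State) (a : NatExpr) (v : RealExpr) :
      Exec f ω r (.setReal a v) s (a.cost + v.cost + 1)
        { s with real := Function.update s.real (a.eval s) (v.eval s) }
  | example_ (s : State) (a b : NatExpr) :
      Exec f ω r (.example_ a b) s (a.cost + b.cost + (n + 1))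
        (s.receive (a.eval s) (b.eval s) (ω s.seen) (f (ω s.seen)))
  | query (s : State) (a b : NatExpr)
      (hloc : ∃ j < s.seen, (hammingDist (ω j) (s.readPoint n (a.eval s)) : ℝ) ≤ r) :
      Exec f ω r (.query a b) s (a.cost + b.cost + (n + 1))
        { s with real := Function.update s.real (b.eval s) (f (s.readPoint n (a.eval s))) }
  | seq {p q : Program} {s s₁ s₂ : State} {k₁ k₂ : ℕ} :
      Exec f ω r p s k₁ s₁ → Exec f ω r q s₁ k₂ s₂ → Exec f ω r (.seq p q) s (k₁ + k₂) s₂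
  | iteTrue {b : Test} {p q : Program} {s s' : State} {k : ℕ} :
      b.holds s → Exec f ω r p s k s' → Exec f ω r (.ite b p q) s (b.cost + k) s'
  | iteFalse {b : Test} {p q : Program} {s s' : State} {k : ℕ} :
      ¬ b.holds s → Exec f ω r q s k s' → Exec f ω r (.ite b p q) s (b.cost + k) s'
  | whileTrue {b : Test} {p : Program} {s s₁ s₂ : State} {k₁ k₂ : ℕ} :
      b.holds s → Exec f ω r p s k₁ s₁ → Exec f ω r (.while b p) s₁ k₂ s₂ →
      Exec f ω r (.while b p) s (b.cost + k₁ + k₂) s₂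
  | whileFalse {b : Test} {p : Program} {s : State} :
      ¬ b.holds s → Exec f ω r (.while b p) s b.cost s

/-- The machine is deterministic. -/
theorem Exec.unique {n : ℕ} {f : Cube n → ℝ} {ω : ℕ → Cube n} {r : ℝ} {p : Program}
    {s s₁ s₂ : State} {k₁ k₂ : ℕ} (h₁ : Exec f ω r p s k₁ s₁) (h₂ : Exec f ω r p s k₂ s₂) :
    k₁ = k₂ ∧ s₁ = s₂ := by
  induction h₁ generalizing k₂ s₂ with
  | skip s => cases h₂; exact ⟨rfl, rfl⟩
  | setNat s a v => cases h₂; exact ⟨rfl, rfl⟩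
  | setReal s a v => cases h₂; exact ⟨rfl, rfl⟩
  | example_ s a b => cases h₂; exact ⟨rfl, rfl⟩
  | query s a b _ => cases h₂; exact ⟨rfl, rfl⟩
  | seq _ _ ih₁ ih₂ =>
    cases h₂ with
    | seq a b =>
      obtain ⟨rfl, rfl⟩ := ih₁ a
      obtain ⟨rfl, rfl⟩ := ih₂ b
      exact ⟨rfl, rfl⟩
  | iteTrue hb _ ih =>
    cases h₂ with
    | iteTrue _ a => obtain ⟨rfl, rfl⟩ := ih a; exact ⟨rfl, rfl⟩
    | iteFalse hb' _ => exact absurd hb hb'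
  | iteFalse hb _ ih =>
    cases h₂ with
    | iteTrue hb' _ => exact absurd hb' hb
    | iteFalse _ a => obtain ⟨rfl, rfl⟩ := ih a; exact ⟨rfl, rfl⟩
  | whileTrue hb _ _ ih₁ ih₂ =>
    cases h₂ with
    | whileTrue _ a b =>
      obtain ⟨rfl, rfl⟩ := ih₁ a
      obtain ⟨rfl, rfl⟩ := ih₂ b
      exact ⟨rfl, rfl⟩
    | whileFalse hb' => exact absurd hb hb'
  | whileFalse hb =>
    cases h₂ with
    | whileTrue hb' _ _ => exact absurd hb' hb
    | whileFalse _ => exact ⟨rfl, rfl⟩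

/-! ### Input, output, learning -/

/-- The initial state: natural cells `0, 1` hold `n, t`, real cells `0, 1, 2, 3` hold
`B, α, ε, δ`, all other cells are zero, and no example has been received. -/
def inputState (n t : ℕ) (B α ε δ : ℝ) : State where
  nat := fun k => if k = 0 then n else if k = 1 then t else 0
  real := fun k => if k = 0 then B else if k = 1 then α else if k = 2 then ε
    else if k = 3 then δ else 0
  seen := 0

/-- The number of terms of the polynomial in the output, found in the natural cell `0`. -/
def State.numTerms (s : State) : ℕ := s.nat 0

/-- The variables of the `j`-th term of the output: its bit vector of length `n` starts at the
address `nat 1 + j * n` of the natural memory. -/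
def State.termVars (n : ℕ) (s : State) (j : ℕ) : Finset (Fin n) :=
  Finset.univ.filter fun i => s.readPoint n (s.nat 1 + j * n) i = true

/-- The coefficient of `ξ_S` in the output, an explicit list of terms; the coefficient of the
`j`-th term is in the real cell `nat 2 + j`. -/
def State.output (n : ℕ) (s : State) (S : Finset (Fin n)) : ℝ :=
  ∑ j ∈ Finset.range s.numTerms, if s.termVars n j = S then s.real (s.nat 2 + j) else 0

/-- The number of memory cells that the output occupies. -/
def State.outputSize (n : ℕ) (s : State) : ℕ := s.numTerms * (n + 1)

/-- The program `p`, started in `s`, learns the class `𝒞` with respect to the class `𝒟` of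
distributions in squared loss, with `r`-local membership queries, accuracy `ε` and confidence
`1 - δ`, in time `T`. For every target in `𝒞`, every distribution `D` in `𝒟` and every outcome `ω`
of the random examples, the program halts, making only `r`-local queries, within time `T` (which
includes writing the output). With probability at least `1 - δ` over independent examples from `D`,
the multilinear polynomial in the output has squared loss at most `ε`. -/
def LearnsInTime {n : ℕ} (p : Program) (s : State) (𝒟 : Set (PMF (Cube n)))
    (𝒞 : Set (Cube n → ℝ)) (r T ε δ : ℝ) : Prop :=
  ∀ D ∈ 𝒟, ∀ f ∈ 𝒞,
    (∀ ω : ℕ → Cube n, ∃ k s', Exec f ω r p s k s' ∧ ((k + s'.outputSize n : ℕ) : ℝ) ≤ T) ∧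
    ENNReal.ofReal (1 - δ) ≤
      MeasureTheory.Measure.infinitePi (fun _ : ℕ => D.toMeasure)
        {ω | ∃ k s', Exec f ω r p s k s' ∧ sqLoss D (multilinear (s'.output n)) f ≤ ε}

end LocalMQ

namespace LocalMQ

/-! Let `f = ∑ c_T ξ_T` have at most `t ≤ 2 ^ k` non-zero coefficients, and put `q = α / (1 + α)`.
Under a locally smooth distribution a bit is `1` with probability at most `q` given the other bits,
so `ξ_T` is non-zero with probability at most `q ^ |T|` (`mass_monomial_le`). For a degree `d` of
order `α log (ntB'/ε)` the terms of degree above `d` are negligible, and it remains to find those of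
degree at most `d` and to fit their coefficients.

Terms are found through the derivatives `∂_S f = ∑_{T ⊇ S} c_T ξ_{T \ S}`. The value of `∂_S f` at
an example is a signed sum of `2 ^ |S|` values of `f` at distance at most `|S|`, so local queries
compute it (`sum_subcube_finRange`). Put `v = (1 + α) ^ (d + k)`. If `S` is contained in a term of
degree at most `d`, then `∂_S f ≠ 0` with probability at least `1 / v`: a polynomial with at most `2
^ k` terms and a constant term is non-zero with probability at least `(1 + α) ^ (-k)`
(`mass_sparse_ne_zero`), and each direction removed from the derivative costs at most a factor `1 +
α` (`sum_le_mass_derivPoly`). Conversely, at most `4 t v ^ 2` sets of size at most `d` have `∂_S f ≠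
0` with probability at least `1 / (4 v)` (`card_mul_le_of_mass_derivPoly`). Hence a search that
extends sets variable by variable and keeps those with a frequently non-zero derivative reaches
every term of low degree and keeps a short list (`mem_candidates`). A cap on the length of the list
bounds the running time even on atypical samples; on typical ones it is never reached.

The coefficients are fitted to the sample by gradient descent from zero. It decreases the empirical
loss and also stays close to the true coefficients (`gdIter_spec`). Closeness gives generalization:
a product of monomials is a monomial, so if all monomial frequencies are correct up to `γ`, the loss
of a polynomial exceeds its empirical loss by at most `γ` times the squared `ℓ¹` norm of its
coefficients (`Representative.sq_le`). Hoeffding's inequality and a union bound over the `2 ^ n`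
sets make a sample representative with high probability (`measure_representative_ge`);
`Representative.loss_le` combines all this.

The rest verifies an explicit program. `wp_learnProg` holds for every outcome of the examples and
identifies the output with the result of the abstract algorithm; chance enters only through
representativeness. The natural memory holds scratch cells and loop counters below `50`, parameters
in `50, …, 58`, the working point from `100`, then the examples, then the list of candidates. The
real memory holds parameters in `50, …, 56` and, from `100` on, the labels, the residuals and the
coefficients. The time bound rests on `(1 + α) ^ O(α log M) ≤ ((M ^ α) ^ log₂(1 + α)) ^ O(1)` with
`M = ntB'/ε` (`one_add_pow_le`). -/

/-! ### Masses of events under locally smooth weights -/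

open Classical in
/-- The total weight of the points of the cube that satisfy `A`. -/
noncomputable def mass {n : ℕ} (w : Cube n → ℝ) (A : Cube n → Prop) : ℝ :=
  ∑ x, if A x then w x else 0

/-- The point `x` with its `i`-th bit flipped. -/
def flip {n : ℕ} (i : Fin n) (x : Cube n) : Cube n := Function.update x i (!x i)

/-- Smoothness of weights in the direction of one coordinate. -/
def SmoothAt {n : ℕ} (w : Cube n → ℝ) (α : ℝ) (i : Fin n) : Prop :=
  ∀ x, w x ≤ α * w (flip i x)

section Mass

variable {n : ℕ} {w : Cube n → ℝ} {α : ℝ}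

theorem flip_flip (i : Fin n) (x : Cube n) : flip i (flip i x) = x := by
  unfold flip; simp

theorem flip_apply_self (i : Fin n) (x : Cube n) : flip i x i = !x i := by
  unfold flip; simp

theorem flip_apply_of_ne {i j : Fin n} (h : j ≠ i) (x : Cube n) : flip i x j = x j := by
  unfold flip; simp [h]

/-- Flipping a bit permutes the cube. -/
def flipEquiv (i : Fin n) : Cube n ≃ Cube n where
  toFun := flip i
  invFun := flip i
  left_inv := flip_flip i
  right_inv := flip_flip i

theorem mass_nonneg (hw : ∀ x, 0 ≤ w x) (A : Cube n → Prop) : 0 ≤ mass w A := by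
  unfold mass
  refine Finset.sum_nonneg fun x _ => ?_
  split_ifs
  · exact hw x
  · exact le_rfl

theorem mass_le_sum_mass (hw : ∀ x, 0 ≤ w x) {ι : Type*} (J : Finset ι) {A : Cube n → Prop}
    {B : ι → Cube n → Prop} (h : ∀ x, A x → ∃ j ∈ J, B j x) :
    mass w A ≤ ∑ j ∈ J, mass w (B j) := by
  classical
  unfold mass
  rw [Finset.sum_comm]
  refine Finset.sum_le_sum fun x _ => ?_
  have hnn : ∀ j ∈ J, 0 ≤ if B j x then w x else 0 := by
    intro j _; split_ifs; exacts [hw x, le_rfl]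
  by_cases hA : A x
  · obtain ⟨j, hj, hB⟩ := h x hA
    have := Finset.single_le_sum hnn hj
    simpa [hA, hB] using this
  · simpa [hA] using Finset.sum_nonneg hnn

/-- Flipping is a bijection that changes weights by a factor at most `α`, so the points with a flip
in `B` weigh at most `α` times as much as `B`. Every factor `1 + α` lost in the lower bounds on
probabilities comes from here. -/
theorem mass_le_of_flip (hw : ∀ x, 0 ≤ w x) {i : Fin n} (hs : SmoothAt w α i)
    {A B : Cube n → Prop} (h : ∀ x, A x → B x ∨ B (flip i x)) :
    mass w A ≤ (1 + α) * mass w B := by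
  classical
  have h1 : mass w A ≤ (∑ x, if B x then w x else 0) + ∑ x, if B (flip i x) then w x else 0 := by
    unfold mass
    rw [← Finset.sum_add_distrib]
    refine Finset.sum_le_sum fun x _ => ?_
    have := h x
    have := hw x
    split_ifs <;> first | linarith | tauto
  have h2 : (∑ x, if B (flip i x) then w x else 0) ≤ α * mass w B := by
    rw [← (flipEquiv i).sum_comp]
    unfold mass
    rw [Finset.mul_sum]
    refine Finset.sum_le_sum fun x _ => ?_
    simp only [flipEquiv, Equiv.coe_fn_mk, flip_flip]
    have := hs (flip i x)
    rw [flip_flip] at this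
    split_ifs
    · exact this
    · simp
  have h3 : mass w B = ∑ x, if B x then w x else 0 := by
    unfold mass; exact Finset.sum_congr rfl fun x _ => by congr
  linarith

/-- The flip matches the points of `E` with bit `1` to those with bit `0`, and each of the latter
has at least `1 / α` of the weight of its partner. -/
theorem mass_and_bit_le {i : Fin n} (hs : SmoothAt w α i) {E : Cube n → Prop}
    (hE : ∀ x, E (flip i x) ↔ E x) :
    (1 + α) * mass w (fun x => E x ∧ x i = true) ≤ α * mass w E := by
  classical
  have h1 : mass w (fun x => E x ∧ x i = true) ≤ α * mass w (fun x => E x ∧ x i = false) := by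
    unfold mass
    rw [← (flipEquiv i).sum_comp, Finset.mul_sum]
    refine Finset.sum_le_sum fun x _ => ?_
    simp only [flipEquiv, Equiv.coe_fn_mk, hE, flip_apply_self]
    have := hs (flip i x)
    rw [flip_flip] at this
    by_cases h : E x <;> by_cases hx : x i <;> simp [h, hx, this]
  have h2 : mass w E = mass w (fun x => E x ∧ x i = true) + mass w (fun x => E x ∧ x i = false) := by
    unfold mass
    rw [← Finset.sum_add_distrib]
    refine Finset.sum_congr rfl fun x _ => ?_
    by_cases h : E x <;> by_cases hx : x i <;> simp [h, hx]
  rw [h2]; linarith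

/-- The event for `T` does not depend on a further bit, so each new bit contributes one more factor
`α / (1 + α)`. -/
theorem mass_monomial_le (hα : 0 ≤ α) (hs : ∀ i, SmoothAt w α i)
    (T : Finset (Fin n)) :
    mass w (fun x => ∀ i ∈ T, x i = true) ≤ (α / (1 + α)) ^ T.card * ∑ x, w x := by
  classical
  induction T using Finset.induction_on with
  | empty => simp [mass]
  | insert i T hi ih =>
    have h := mass_and_bit_le (hs i) (E := fun x => ∀ j ∈ T, x j = true) (by
      intro x
      refine forall₂_congr fun j hj => ?_
      rw [flip_apply_of_ne (by rintro rfl; exact hi hj)])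
    have e : (fun x : Cube n => ∀ j ∈ insert i T, x j = true)
        = fun x => (∀ j ∈ T, x j = true) ∧ x i = true := by
      funext x; simp [and_comm]
    rw [e, Finset.card_insert_of_notMem hi, pow_succ]
    have h1 : mass w (fun x => (∀ j ∈ T, x j = true) ∧ x i = true)
        ≤ α / (1 + α) * mass w (fun x => ∀ j ∈ T, x j = true) := by
      rw [div_mul_eq_mul_div, le_div_iff₀ (by linarith)]
      linarith
    calc _ ≤ _ := h1
      _ ≤ α / (1 + α) * ((α / (1 + α)) ^ T.card * ∑ x, w x) := by gcongr
      _ = _ := by ring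

end Mass

/-! ### Sparse polynomials with a constant term are often non-zero -/

theorem monomial_eq_ite {n : ℕ} (S : Finset (Fin n)) (x : Cube n) :
    monomial S x = if ∀ i ∈ S, x i = true then 1 else 0 := by
  unfold monomial
  rw [Finset.prod_ite_zero]
  simp

theorem monomial_eq_of_mem {n : ℕ} {S : Finset (Fin n)} {i : Fin n} (hi : i ∈ S) (x : Cube n) :
    monomial S x = (if x i then 1 else 0) * monomial (S.erase i) x := by
  unfold monomial
  rw [Finset.mul_prod_erase S (fun i => if x i then (1 : ℝ) else 0) hi]

theorem monomial_congr {n : ℕ} {S : Finset (Fin n)} {x y : Cube n} (h : ∀ i ∈ S, x i = y i) :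
    monomial S x = monomial S y := by
  unfold monomial
  exact Finset.prod_congr rfl fun i hi => by rw [h i hi]

/-- Expand along a variable `x_i`: with `f = f₀ + x_i f₁`, the restrictions are `f₀` and `f₀ + f₁`.
If both have a constant term, induction applies on each face without loss. Otherwise the constant
terms of `f₀` and `f₁` cancel and are both non-zero; one of the two has at most half of the terms,
which lowers `k` by one and pays for the factor `1 + α` of a flip. Terms are indexed by `ι`, with
repetitions allowed, because erasing `i` can make distinct sets equal. -/
theorem mass_sparse_ne_zero {n : ℕ} {α : ℝ} (hα : 0 ≤ α) {ι : Type*} (V : Finset (Fin n)) :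
    ∀ (w : Cube n → ℝ), (∀ x, 0 ≤ w x) → (∀ i ∈ V, SmoothAt w α i) →
    ∀ (k : ℕ) (J : Finset ι) (a : ι → ℝ) (A : ι → Finset (Fin n)), (∀ j ∈ J, A j ⊆ V) →
      J.card ≤ 2 ^ k → (∑ j ∈ J with A j = ∅, a j) ≠ 0 →
      ∑ x, w x ≤ (1 + α) ^ k * mass w (fun x => ∑ j ∈ J, a j * monomial (A j) x ≠ 0) := by
  classical
  induction V using Finset.induction_on with
  | empty =>
    intro w hw _ k J a A hA _ hc
    have h1 : ∀ x : Cube n, ∑ j ∈ J, a j * monomial (A j) x ≠ 0 := by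
      intro x
      convert hc using 1
      rw [Finset.filter_true_of_mem (fun j hj => Finset.subset_empty.1 (hA j hj))]
      refine Finset.sum_congr rfl fun j hj => ?_
      rw [Finset.subset_empty.1 (hA j hj)]; simp [monomial]
    have h2 : mass w (fun x => ∑ j ∈ J, a j * monomial (A j) x ≠ 0) = ∑ x, w x := by
      unfold mass; exact Finset.sum_congr rfl fun x _ => if_pos (h1 x)
    rw [h2]
    have : 0 ≤ ∑ x, w x := Finset.sum_nonneg fun x _ => hw x
    have h3 : (1 : ℝ) ≤ (1 + α) ^ k := one_le_pow₀ (by linarith)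
    nlinarith
  | insert i V hi ih =>
    intro w hw hs k J a A hA hJ hc
    have hsi : SmoothAt w α i := hs i (Finset.mem_insert_self _ _)
    have hsV : ∀ j ∈ V, SmoothAt w α j := fun j hj => hs j (Finset.mem_insert_of_mem hj)
    set J0 := J.filter fun j => i ∉ A j with hJ0
    set J1 := J.filter fun j => i ∈ A j with hJ1
    have hcard : J0.card + J1.card = J.card := by
      rw [add_comm]; exact Finset.card_filter_add_card_filter_not _
    have hA0 : ∀ j ∈ J0, A j ⊆ V := by
      intro j hj
      rw [hJ0, Finset.mem_filter] at hj
      exact (Finset.subset_insert_iff_of_notMem hj.2).1 (hA j hj.1)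
    have hAe : ∀ j ∈ J, (A j).erase i ⊆ V := fun j hj => Finset.subset_insert_iff.1 (hA j hj)
    have hA1 : ∀ j ∈ J1, (A j).erase i ⊆ V := fun j hj => hAe j (Finset.mem_filter.1 hj).1
    have hc0 : ∑ j ∈ J0 with A j = ∅, a j = ∑ j ∈ J with A j = ∅, a j := by
      rw [hJ0, Finset.filter_filter]
      refine Finset.sum_congr (Finset.filter_congr fun j _ => ?_) fun _ _ => rfl
      constructor
      · exact fun h => h.2
      · intro h; simp [h]
    have hcsum : ∑ j ∈ J with (A j).erase i = ∅, a j
        = ∑ j ∈ J0 with A j = ∅, a j + ∑ j ∈ J1 with (A j).erase i = ∅, a j := by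
      rw [← Finset.sum_filter_add_sum_filter_not _ (fun j => i ∉ A j), hJ0, hJ1]
      simp only [Finset.filter_filter, not_not]
      congr 1
      · refine Finset.sum_congr (Finset.filter_congr fun j _ => ?_) fun _ _ => rfl
        constructor
        · rintro ⟨h, h'⟩; exact ⟨h', by rwa [Finset.erase_eq_of_notMem h'] at h⟩
        · rintro ⟨h', h⟩; exact ⟨by rwa [Finset.erase_eq_of_notMem h'], h'⟩
      · refine Finset.sum_congr (Finset.filter_congr fun j _ => and_comm) fun _ _ => rfl
    have hg0 : ∀ x : Cube n, x i = false →
        ∑ j ∈ J, a j * monomial (A j) x = ∑ j ∈ J0, a j * monomial (A j) x := by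
      intro x hx
      rw [hJ0, Finset.sum_filter]
      refine Finset.sum_congr rfl fun j _ => ?_
      by_cases h : i ∈ A j
      · rw [monomial_eq_of_mem h]; simp [hx, h]
      · simp [h]
    have hg1 : ∀ x : Cube n, x i = true →
        ∑ j ∈ J, a j * monomial (A j) x = ∑ j ∈ J, a j * monomial ((A j).erase i) x := by
      intro x hx
      refine Finset.sum_congr rfl fun j _ => ?_
      by_cases h : i ∈ A j
      · rw [monomial_eq_of_mem h]; simp [hx]
      · rw [Finset.erase_eq_of_notMem h]
    by_cases hne : ∑ j ∈ J with (A j).erase i = ∅, a j = 0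
    · -- both parts have a constant term, and one of them has at most half of the terms
      have hc0' : ∑ j ∈ J0 with A j = ∅, a j ≠ 0 := by rw [hc0]; exact hc
      have hc1' : ∑ j ∈ J1 with (A j).erase i = ∅, a j ≠ 0 := by
        intro h; rw [hcsum, h, add_zero] at hne; exact hc0' hne
      have pos0 : 0 < J0.card := by
        refine Finset.card_pos.2 (Finset.nonempty_iff_ne_empty.2 ?_)
        rintro h; rw [h] at hc0'; simp at hc0'
      have pos1 : 0 < J1.card := by
        refine Finset.card_pos.2 (Finset.nonempty_iff_ne_empty.2 ?_)
        rintro h; rw [h] at hc1'; simp at hc1'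
      -- Both parts are non-empty, so there are at least two terms and `k` cannot be zero.
      obtain ⟨k, rfl⟩ : ∃ k', k = k' + 1 := by
        cases k with
        | zero => simp at hJ; omega
        | succ k => exact ⟨k, rfl⟩
      rw [pow_succ] at hJ
      have hpow : (0 : ℝ) ≤ (1 + α) ^ k := by positivity
      have e0 : ∀ x : Cube n, ∑ j ∈ J0, a j * monomial (A j) (flip i x)
          = ∑ j ∈ J0, a j * monomial (A j) x := by
        intro x
        refine Finset.sum_congr rfl fun j hj => ?_
        congr 1
        refine monomial_congr fun l hl => flip_apply_of_ne ?_ x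
        rintro rfl
        exact (Finset.mem_filter.1 hj).2 hl
      -- If `f₀` is the short part: it does not depend on `x_i` and is the value of `f` at the end
      -- `x_i = 0` of the edge through `x`.
      by_cases hh : J0.card ≤ 2 ^ k
      · have h1 := ih w hw hsV k J0 a A hA0 hh hc0'
        have h2 : mass w (fun x => ∑ j ∈ J0, a j * monomial (A j) x ≠ 0)
            ≤ (1 + α) * mass w (fun x => ∑ j ∈ J, a j * monomial (A j) x ≠ 0) := by
          refine mass_le_of_flip hw hsi fun x hx => ?_
          cases hxi : x i with
          | false => left; rwa [hg0 x hxi]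
          | true =>
            right
            rw [hg0 _ (by rw [flip_apply_self, hxi]; rfl)]
            rwa [e0]
        rw [pow_succ, mul_assoc]
        exact h1.trans (mul_le_mul_of_nonneg_left h2 hpow)
      -- If `f₁` is the short part: it is the difference of `f` along the edge, so where it is
      -- non-zero, `f` is non-zero at one of the two ends.
      · have hh1 : J1.card ≤ 2 ^ k := by omega
        have h1 := ih w hw hsV k J1 a (fun j => (A j).erase i) hA1 hh1 hc1'
        have hsplit : ∀ x : Cube n, ∑ j ∈ J, a j * monomial ((A j).erase i) x
            = ∑ j ∈ J0, a j * monomial (A j) x + ∑ j ∈ J1, a j * monomial ((A j).erase i) x := by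
          intro x
          rw [← Finset.sum_filter_add_sum_filter_not J (fun j => i ∉ A j)]
          simp only [not_not]
          rw [← hJ0, ← hJ1]
          congr 1
          refine Finset.sum_congr rfl fun j hj => ?_
          rw [Finset.erase_eq_of_notMem (Finset.mem_filter.1 hj).2]
        have e1 : ∀ x : Cube n, ∑ j ∈ J1, a j * monomial ((A j).erase i) (flip i x)
            = ∑ j ∈ J1, a j * monomial ((A j).erase i) x := by
          intro x
          refine Finset.sum_congr rfl fun j hj => ?_
          congr 1
          exact monomial_congr fun l hl => flip_apply_of_ne (Finset.ne_of_mem_erase hl) x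
        have h2 : mass w (fun x => ∑ j ∈ J1, a j * monomial ((A j).erase i) x ≠ 0)
            ≤ (1 + α) * mass w (fun x => ∑ j ∈ J, a j * monomial (A j) x ≠ 0) := by
          refine mass_le_of_flip hw hsi fun x hx => ?_
          by_contra hcon
          push Not at hcon
          obtain ⟨c1, c2⟩ := hcon
          apply hx
          cases hxi : x i with
          | false =>
            have hf : flip i x i = true := by rw [flip_apply_self, hxi]; rfl
            rw [hg0 x hxi] at c1
            rw [hg1 _ hf, hsplit, e0, e1] at c2
            linarith
          | true =>
            have hf : flip i x i = false := by rw [flip_apply_self, hxi]; rfl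
            rw [hg0 _ hf, e0] at c2
            rw [hg1 _ hxi, hsplit] at c1
            linarith
        rw [pow_succ, mul_assoc]
        exact h1.trans (mul_le_mul_of_nonneg_left h2 hpow)
    · -- both restrictions have a constant term
      have key : ∀ (b : Bool) (A' : ι → Finset (Fin n)) (J' : Finset ι), J' ⊆ J →
          (∀ j ∈ J', A' j ⊆ V) → (∑ j ∈ J' with A' j = ∅, a j) ≠ 0 →
          (∀ x : Cube n, x i = b → ∑ j ∈ J, a j * monomial (A j) x
            = ∑ j ∈ J', a j * monomial (A' j) x) →
          ∑ x, (if x i = b then w x else 0) ≤ (1 + α) ^ k *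
            ∑ x, if x i = b ∧ ∑ j ∈ J, a j * monomial (A j) x ≠ 0 then w x else 0 := by
        intro b A' J' hJ' hA' hc' hx'
        -- The weights cut down to a face need not be smooth in direction `i` any more. This is why
        -- the induction is over arbitrary weights and asks for smoothness only in the directions of
        -- `V`.
        have h := ih (fun x => if x i = b then w x else 0)
          (fun x => by split_ifs; exacts [hw x, le_rfl])
          (fun l hl x => by
            have hli : i ≠ l := by rintro rfl; exact hi hl
            dsimp only
            rw [flip_apply_of_ne hli]
            split_ifs
            · exact hsV l hl x
            · simp) k J' a A' hA' ((Finset.card_le_card hJ').trans hJ) hc'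
        refine h.trans (le_of_eq ?_)
        congr 1
        unfold mass
        refine Finset.sum_congr rfl fun x _ => ?_
        by_cases hb : x i = b
        · simp [hb, hx' x hb]
        · simp [hb]
      have k0 := key false A J0 (Finset.filter_subset _ _) hA0 (by rw [hc0]; exact hc) hg0
      have k1 := key true (fun j => (A j).erase i) J subset_rfl hAe hne hg1
      have s1 : ∑ x, w x = ∑ x, (if x i = false then w x else 0)
          + ∑ x, (if x i = true then w x else 0) := by
        rw [← Finset.sum_add_distrib]
        exact Finset.sum_congr rfl fun x _ => by cases x i <;> simp
      have s2 : mass w (fun x => ∑ j ∈ J, a j * monomial (A j) x ≠ 0)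
          = ∑ x, (if x i = false ∧ ∑ j ∈ J, a j * monomial (A j) x ≠ 0 then w x else 0)
          + ∑ x, (if x i = true ∧ ∑ j ∈ J, a j * monomial (A j) x ≠ 0 then w x else 0) := by
        unfold mass
        rw [← Finset.sum_add_distrib]
        exact Finset.sum_congr rfl fun x _ => by cases x i <;> simp
      rw [s1, s2, mul_add]
      exact add_le_add k0 k1

end LocalMQ

namespace LocalMQ

/-! ### Discrete derivatives of multilinear polynomials -/

/-- The discrete derivative, in the directions of `S`, of the polynomial with coefficients `c`. -/
noncomputable def derivPoly {n : ℕ} (c : Finset (Fin n) → ℝ) (S : Finset (Fin n)) (x : Cube n) : ℝ :=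
  ∑ T, if S ⊆ T then c T * monomial (T \ S) x else 0

/-- Iterated discrete differences in the directions of a list of coordinates. -/
def derivList {n : ℕ} : List (Fin n) → (Cube n → ℝ) → Cube n → ℝ
  | [], f, x => f x
  | i :: l, f, x =>
    derivList l f (Function.update x i true) - derivList l f (Function.update x i false)

section Derivatives

variable {n : ℕ} {c : Finset (Fin n) → ℝ}

theorem derivPoly_empty (c : Finset (Fin n) → ℝ) : derivPoly c ∅ = multilinear c := by
  funext x; simp [derivPoly, multilinear]

theorem monomial_update_of_notMem {U : Finset (Fin n)} {i : Fin n} (h : i ∉ U) (x : Cube n)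
    (b : Bool) : monomial U (Function.update x i b) = monomial U x :=
  monomial_congr fun j hj => Function.update_of_ne (by rintro rfl; exact h hj) _ _

theorem derivPoly_insert {S : Finset (Fin n)} {i : Fin n} (hi : i ∉ S) (x : Cube n) :
    derivPoly c (insert i S) x
      = derivPoly c S (Function.update x i true) - derivPoly c S (Function.update x i false) := by
  classical
  unfold derivPoly
  rw [← Finset.sum_sub_distrib]
  refine Finset.sum_congr rfl fun T _ => ?_
  by_cases hS : S ⊆ T
  · by_cases hT : i ∈ T
    · have h1 : insert i S ⊆ T := Finset.insert_subset hT hS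
      have h2 : i ∈ T \ S := Finset.mem_sdiff.2 ⟨hT, hi⟩
      have h3 : (T \ S).erase i = T \ insert i S := by
        ext j; simp only [Finset.mem_erase, Finset.mem_sdiff, Finset.mem_insert]; tauto
      rw [if_pos h1, if_pos hS, if_pos hS, monomial_eq_of_mem h2, monomial_eq_of_mem h2, h3,
        monomial_update_of_notMem (by simp), monomial_update_of_notMem (by simp)]
      simp
    · have h1 : ¬ insert i S ⊆ T := fun h => hT (h (Finset.mem_insert_self _ _))
      have h2 : i ∉ T \ S := by simp [hT]
      rw [if_neg h1, if_pos hS, if_pos hS, monomial_update_of_notMem h2,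
        monomial_update_of_notMem h2, sub_self]
  · have h1 : ¬ insert i S ⊆ T := fun h => hS ((Finset.subset_insert _ _).trans h)
    simp [h1, hS]

/-- Links the differences that queries can compute to the coefficients. A repeated direction would
give zero on the left, hence the `Nodup` hypothesis. -/
theorem derivList_multilinear {l : List (Fin n)} (hl : l.Nodup) (x : Cube n) :
    derivList l (multilinear c) x = derivPoly c l.toFinset x := by
  classical
  induction l generalizing x with
  | nil => simp [derivList, derivPoly_empty]
  | cons i l ih =>
    rw [List.nodup_cons] at hl
    rw [derivList, ih hl.2, ih hl.2, List.toFinset_cons, derivPoly_insert (by simpa using hl.1)]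

variable {w : Cube n → ℝ} {α : ℝ}

/-- A difference along an edge is non-zero only if the function is non-zero at one of its ends,
which are `x` and its flip. -/
theorem mass_derivPoly_insert_le (hw : ∀ x, 0 ≤ w x) {i : Fin n} (hs : SmoothAt w α i)
    {S : Finset (Fin n)} (hi : i ∉ S) :
    mass w (fun x => derivPoly c (insert i S) x ≠ 0)
      ≤ (1 + α) * mass w (fun x => derivPoly c S x ≠ 0) := by
  refine mass_le_of_flip hw hs fun x hx => ?_
  by_contra hcon
  push Not at hcon
  apply hx
  rw [derivPoly_insert hi]
  have e : ∀ b, Function.update x i b = x ∨ Function.update x i b = flip i x := by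
    intro b
    by_cases hb : x i = b
    · left; rw [← hb]; exact Function.update_eq_self i x
    · right
      unfold flip
      congr 1
      cases h : x i <;> cases b <;> simp_all
  have e' : ∀ b, derivPoly c S (Function.update x i b) = 0 := by
    intro b
    rcases e b with h | h <;> rw [h]
    exacts [hcon.1, hcon.2]
  rw [e', e', sub_self]

theorem mass_derivPoly_subset_le (hα : 0 ≤ α) (hw : ∀ x, 0 ≤ w x) (hs : ∀ i, SmoothAt w α i)
    (S U : Finset (Fin n)) (h : Disjoint S U) :
    mass w (fun x => derivPoly c (S ∪ U) x ≠ 0)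
      ≤ (1 + α) ^ U.card * mass w (fun x => derivPoly c S x ≠ 0) := by
  classical
  induction U using Finset.induction_on with
  | empty => simp
  | insert i U hi ih =>
    rw [Finset.disjoint_insert_right] at h
    rw [Finset.union_insert, Finset.card_insert_of_notMem hi, pow_succ']
    have h1 := mass_derivPoly_insert_le (c := c) hw (hs i) (S := S ∪ U) (i := i)
      (by simp [h.1, hi])
    have h2 := ih h.2
    calc _ ≤ _ := h1
      _ ≤ (1 + α) * ((1 + α) ^ U.card * mass w (fun x => derivPoly c S x ≠ 0)) := by gcongr
      _ = _ := by ring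

/-- Derivatives in the direction of subsets of the terms are often non-zero. -/
theorem sum_le_mass_derivPoly (hα : 0 ≤ α) (hw : ∀ x, 0 ≤ w x) (hs : ∀ i, SmoothAt w α i)
    {k : ℕ} (hk : (Finset.univ.filter fun S => c S ≠ 0).card ≤ 2 ^ k) {S T : Finset (Fin n)}
    (hST : S ⊆ T) (hT : c T ≠ 0) :
    ∑ x, w x ≤ (1 + α) ^ (T.card + k) * mass w (fun x => derivPoly c S x ≠ 0) := by
  classical
  have h1 : ∑ x, w x ≤ (1 + α) ^ k * mass w (fun x => derivPoly c T x ≠ 0) := by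
    have := mass_sparse_ne_zero hα Finset.univ w hw (fun i _ => hs i) k
      (Finset.univ.filter fun U => T ⊆ U ∧ c U ≠ 0) c (fun U => U \ T)
      (fun _ _ => Finset.subset_univ _)
      ((Finset.card_le_card fun U hU => by simp at hU ⊢; exact hU.2).trans hk)
      (by
        -- The constant term of the derivative in the directions of `T` is `c T`, since only `U = T`
        -- leaves an empty difference.
        have : (Finset.univ.filter fun U => T ⊆ U ∧ c U ≠ 0).filter (fun U => U \ T = ∅) = {T} := by
          ext U
          simp only [Finset.mem_filter, Finset.mem_univ, true_and, Finset.mem_singleton,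
            Finset.sdiff_eq_empty_iff_subset]
          constructor
          · rintro ⟨⟨a, _⟩, b⟩; exact subset_antisymm b a
          · rintro rfl; exact ⟨⟨subset_rfl, hT⟩, subset_rfl⟩
        rw [this]; simpa using hT)
    have e : ∀ x, derivPoly c T x
        = ∑ U with T ⊆ U ∧ c U ≠ 0, c U * monomial (U \ T) x := by
      intro x
      unfold derivPoly
      rw [Finset.sum_filter]
      refine Finset.sum_congr rfl fun U _ => ?_
      by_cases h : T ⊆ U <;> by_cases h' : c U = 0 <;> simp [h, h']
    simpa only [e] using this
  -- Pass from `T` down to `S`, one factor `1 + α` for each direction of `T \ S`.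
  have h2 := mass_derivPoly_subset_le (c := c) hα hw hs S (T \ S) Finset.disjoint_sdiff
  rw [Finset.union_sdiff_of_subset hST] at h2
  have h3 : (1 + α) ^ (T \ S).card ≤ (1 + α) ^ T.card :=
    pow_le_pow_right₀ (by linarith) (Finset.card_le_card Finset.sdiff_subset)
  have h4 : 0 ≤ mass w (fun x => derivPoly c S x ≠ 0) := mass_nonneg hw _
  calc _ ≤ _ := h1
    _ ≤ (1 + α) ^ k * ((1 + α) ^ T.card * mass w (fun x => derivPoly c S x ≠ 0)) := by
      gcongr; exact h2.trans (by gcongr)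
    _ = _ := by rw [pow_add]; ring

/-- A non-zero value needs some non-vanishing monomial `T \ S`; apply the union bound and
`mass_monomial_le`. -/
theorem mass_derivPoly_le (hα : 0 ≤ α) (hw : ∀ x, 0 ≤ w x) (hs : ∀ i, SmoothAt w α i)
    (S : Finset (Fin n)) :
    mass w (fun x => derivPoly c S x ≠ 0)
      ≤ ∑ T with S ⊆ T ∧ c T ≠ 0, (α / (1 + α)) ^ (T.card - S.card) * ∑ x, w x := by
  classical
  calc mass w (fun x => derivPoly c S x ≠ 0)
      ≤ ∑ T with S ⊆ T ∧ c T ≠ 0, mass w (fun x => ∀ i ∈ T \ S, x i = true) := by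
        refine mass_le_sum_mass hw _ fun x h => ?_
        obtain ⟨T, -, hT⟩ := Finset.exists_ne_zero_of_sum_ne_zero h
        have hST : S ⊆ T := by by_contra h'; simp [h'] at hT
        rw [if_pos hST] at hT
        have hm := right_ne_zero_of_mul hT
        rw [monomial_eq_ite] at hm
        refine ⟨T, by simpa using ⟨hST, left_ne_zero_of_mul hT⟩, ?_⟩
        by_contra h'
        simp only [h', if_false] at hm
        exact hm rfl
    _ ≤ _ := by
        refine Finset.sum_le_sum fun T hT => ?_
        have := mass_monomial_le hα hs (T \ S)
        rwa [Finset.card_sdiff_of_subset (Finset.mem_filter.1 hT).2.1] at this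

/-- Few small sets are such that the derivative in their direction is often non-zero. -/
theorem card_mul_le_of_mass_derivPoly (hα : 0 ≤ α) (hw : ∀ x, 0 ≤ w x) (hs : ∀ i, SmoothAt w α i)
    (h1 : ∑ x, w x = 1) {d : ℕ} {θ : ℝ} (𝒮 : Finset (Finset (Fin n)))
    (h𝒮 : ∀ S ∈ 𝒮, S.card ≤ d ∧ θ ≤ mass w (fun x => derivPoly c S x ≠ 0)) :
    𝒮.card * θ ≤ (Finset.univ.filter fun S => c S ≠ 0).card * (1 + α) ^ d := by
  classical
  have h1α : 0 < 1 + α := by linarith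
  calc 𝒮.card * θ = ∑ S ∈ 𝒮, θ := by simp
    _ ≤ ∑ S ∈ 𝒮, ∑ T with c T ≠ 0, if S ⊆ T then (α / (1 + α)) ^ (T.card - S.card) else 0 := by
        refine Finset.sum_le_sum fun S hS => ?_
        refine ((h𝒮 S hS).2.trans (mass_derivPoly_le hα hw hs S)).trans (le_of_eq ?_)
        rw [h1, Finset.sum_filter, Finset.sum_filter]
        refine Finset.sum_congr rfl fun T _ => ?_
        by_cases h : S ⊆ T <;> by_cases h' : c T = 0 <;> simp [h, h']
    _ = ∑ T with c T ≠ 0, ∑ S ∈ 𝒮, if S ⊆ T then (α / (1 + α)) ^ (T.card - S.card) else 0 :=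
        Finset.sum_comm
    _ ≤ ∑ T with c T ≠ 0, (1 + α) ^ d := by
        refine Finset.sum_le_sum fun T _ => ?_
        calc ∑ S ∈ 𝒮, (if S ⊆ T then (α / (1 + α)) ^ (T.card - S.card) else 0)
            ≤ ∑ S ∈ 𝒮 with S ⊆ T, (1 + α) ^ d *
                ((1 / (1 + α)) ^ S.card * (α / (1 + α)) ^ (T.card - S.card)) := by
              rw [Finset.sum_filter]
              refine Finset.sum_le_sum fun S hS => ?_
              split_ifs
              -- This factor, at least one because `|S| ≤ d`, completes the summand to a term of the
              -- binomial expansion of `(1 / (1 + α) + α / (1 + α)) ^ |T| = 1`. Each `T` thus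
              -- contributes at most `(1 + α) ^ d`, regardless of its size.
              · have : (1 : ℝ) ≤ (1 + α) ^ d * (1 / (1 + α)) ^ S.card := by
                  rw [one_div, inv_pow, ← div_eq_mul_inv, one_le_div (by positivity)]
                  exact pow_le_pow_right₀ (by linarith) (h𝒮 S hS).1
                rw [← mul_assoc]
                exact le_mul_of_one_le_left (by positivity) this
              · exact le_rfl
          _ ≤ ∑ S ∈ T.powerset, (1 + α) ^ d *
                ((1 / (1 + α)) ^ S.card * (α / (1 + α)) ^ (T.card - S.card)) := by
              refine Finset.sum_le_sum_of_subset_of_nonneg (fun S hS => ?_) fun _ _ _ => by positivity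
              exact Finset.mem_powerset.2 (Finset.mem_filter.1 hS).2
          _ = (1 + α) ^ d := by
              rw [← Finset.mul_sum, Finset.sum_pow_mul_eq_add_pow, ← add_div, div_self h1α.ne',
                one_pow, mul_one]
    _ = _ := by simp

end Derivatives

/-! ### Locally smooth distributions as weights -/

section Weights

variable {n : ℕ} {D : PMF (Cube n)} {α : ℝ}

theorem sum_toReal_pmf (D : PMF (Cube n)) : ∑ x, (D x).toReal = 1 := by
  have h := D.tsum_coe
  rw [tsum_fintype] at h
  rw [← ENNReal.toReal_sum fun x _ => D.apply_ne_top x, h, ENNReal.toReal_one]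

theorem smoothAt_of_mem_locallySmooth (hD : D ∈ locallySmooth n α) (i : Fin n) :
    SmoothAt (fun x => (D x).toReal) α i := by
  intro x
  refine hD x (flip i x) ?_
  unfold hammingDist
  rw [Finset.card_eq_one]
  refine ⟨i, ?_⟩
  ext j
  by_cases h : j = i
  · subst h; simp [flip_apply_self]
  · simp [flip_apply_of_ne h, h]

end Weights

end LocalMQ

namespace LocalMQ

/-! ### Gradient descent for least squares -/

section GradientDescent

variable (m K : ℕ) (ξ : ℕ → ℕ → ℝ) (y : ℕ → ℝ)

/-- The residual of the `j`-th example for the linear model with weights `a`. -/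
noncomputable def resid (a : ℕ → ℝ) (j : ℕ) : ℝ := y j - ∑ q ∈ Finset.range K, a q * ξ q j

/-- One step of gradient descent. -/
noncomputable def gdStep (σ : ℝ) (a : ℕ → ℝ) (q : ℕ) : ℝ :=
  a q + σ * ∑ j ∈ Finset.range m, resid K ξ y a j * ξ q j

/-- Gradient descent from the zero vector. -/
noncomputable def gdIter (σ : ℝ) : ℕ → ℕ → ℝ
  | 0 => fun _ => 0
  | i + 1 => gdStep m K ξ y σ (gdIter σ i)

/-- The empirical square loss. -/
noncomputable def sumSq (a : ℕ → ℝ) : ℝ := ∑ j ∈ Finset.range m, resid K ξ y a j ^ 2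

variable {m K ξ y}

theorem resid_gdStep (σ : ℝ) (a : ℕ → ℝ) (j : ℕ) :
    resid K ξ y (gdStep m K ξ y σ a) j = resid K ξ y a j
      - σ * ∑ q ∈ Finset.range K, (∑ i ∈ Finset.range m, resid K ξ y a i * ξ q i) * ξ q j := by
  rw [resid, resid, Finset.mul_sum, sub_sub, ← Finset.sum_add_distrib]
  congr 1
  refine Finset.sum_congr rfl fun q _ => ?_
  rw [gdStep]; unfold resid; ring

/-- With `Γ` the squared length of the step direction, the first-order gain is `2σΓ`. By
Cauchy–Schwarz the second-order term is at most `σ²mKΓ ≤ σΓ`. -/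
theorem sumSq_gdStep_le (hξ : ∀ q j, |ξ q j| ≤ 1) {σ : ℝ} (hσ : 0 ≤ σ) (hσ' : σ * (m * K) ≤ 1)
    (a : ℕ → ℝ) : sumSq m K ξ y (gdStep m K ξ y σ a) ≤ sumSq m K ξ y a := by
  set G : ℕ → ℝ := fun q => ∑ i ∈ Finset.range m, resid K ξ y a i * ξ q i with hG
  set Γ := ∑ q ∈ Finset.range K, G q ^ 2 with hΓ
  have hΓ0 : 0 ≤ Γ := Finset.sum_nonneg fun q _ => sq_nonneg _
  have h1 : sumSq m K ξ y (gdStep m K ξ y σ a) = sumSq m K ξ y a - 2 * σ * Γ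
      + σ ^ 2 * ∑ j ∈ Finset.range m, (∑ q ∈ Finset.range K, G q * ξ q j) ^ 2 := by
    have e : Γ = ∑ j ∈ Finset.range m, resid K ξ y a j * ∑ q ∈ Finset.range K, G q * ξ q j := by
      simp_rw [Finset.mul_sum]
      rw [Finset.sum_comm, hΓ]
      refine Finset.sum_congr rfl fun q _ => ?_
      rw [sq]; nth_rewrite 2 [hG]
      rw [Finset.mul_sum]
      exact Finset.sum_congr rfl fun j _ => by ring
    rw [e, sumSq, sumSq, Finset.mul_sum, Finset.mul_sum, ← Finset.sum_sub_distrib,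
      ← Finset.sum_add_distrib]
    refine Finset.sum_congr rfl fun j _ => ?_
    rw [resid_gdStep]; ring
  have h2 : ∑ j ∈ Finset.range m, (∑ q ∈ Finset.range K, G q * ξ q j) ^ 2 ≤ m * (K * Γ) := by
    calc _ ≤ ∑ j ∈ Finset.range m, (K * Γ : ℝ) := by
          refine Finset.sum_le_sum fun j _ => ?_
          have := sq_sum_le_card_mul_sum_sq (s := Finset.range K) (f := fun q => G q * ξ q j)
          rw [Finset.card_range] at this
          refine this.trans ?_
          refine mul_le_mul_of_nonneg_left (Finset.sum_le_sum fun q _ => ?_) (Nat.cast_nonneg _)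
          rw [mul_pow]
          have : ξ q j ^ 2 ≤ 1 := (sq_le_one_iff_abs_le_one _).2 (hξ q j)
          nlinarith [sq_nonneg (G q)]
      _ = _ := by simp
  rw [h1]
  have h3 : σ ^ 2 * ∑ j ∈ Finset.range m, (∑ q ∈ Finset.range K, G q * ξ q j) ^ 2 ≤ σ * Γ := by
    calc _ ≤ σ ^ 2 * (m * (K * Γ)) := by gcongr
      _ = σ * (m * K) * (σ * Γ) := by ring
      _ ≤ 1 * (σ * Γ) := by gcongr
      _ = _ := one_mul _
  have : 0 ≤ σ * Γ := by positivity
  linarith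

/-- Expand the square. Convexity bounds the cross term by the difference of the losses, and the
smaller step size absorbs the quadratic term into half of the loss at `a`. No condition on the rank
of the features is needed. -/
theorem dist_gdStep_le (hξ : ∀ q j, |ξ q j| ≤ 1) {σ : ℝ} (hσ : 0 ≤ σ) (hσ' : σ * (m * K) ≤ 1 / 2)
    (a c : ℕ → ℝ) :
    ∑ q ∈ Finset.range K, (gdStep m K ξ y σ a q - c q) ^ 2
      ≤ ∑ q ∈ Finset.range K, (a q - c q) ^ 2
        - σ * (sumSq m K ξ y a / 2 - sumSq m K ξ y c) := by
  set G : ℕ → ℝ := fun q => ∑ i ∈ Finset.range m, resid K ξ y a i * ξ q i with hG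
  have h1 : ∑ q ∈ Finset.range K, (gdStep m K ξ y σ a q - c q) ^ 2
      = ∑ q ∈ Finset.range K, (a q - c q) ^ 2 + 2 * σ * ∑ q ∈ Finset.range K, (a q - c q) * G q
        + σ ^ 2 * ∑ q ∈ Finset.range K, G q ^ 2 := by
    rw [Finset.mul_sum, Finset.mul_sum, ← Finset.sum_add_distrib, ← Finset.sum_add_distrib]
    refine Finset.sum_congr rfl fun q _ => ?_
    rw [gdStep]; ring
  have h2 : ∑ q ∈ Finset.range K, (a q - c q) * G q
      -- For residuals `ρ` at `a` and `ρ'` at `c` this is `ρ (ρ' - ρ) ≤ (ρ'² - ρ²) / 2`, summed over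
      -- the examples.
      ≤ - (sumSq m K ξ y a / 2) + sumSq m K ξ y c / 2 := by
    have e : ∑ q ∈ Finset.range K, (a q - c q) * G q
        = ∑ j ∈ Finset.range m, resid K ξ y a j * (resid K ξ y c j - resid K ξ y a j) := by
      rw [hG]
      simp_rw [Finset.mul_sum]
      rw [Finset.sum_comm]
      refine Finset.sum_congr rfl fun j _ => ?_
      have : resid K ξ y c j - resid K ξ y a j = ∑ q ∈ Finset.range K, (a q - c q) * ξ q j := by
        simp only [resid, sub_mul, Finset.sum_sub_distrib]; ring
      rw [this, Finset.mul_sum]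
      exact Finset.sum_congr rfl fun q _ => by ring
    rw [e, sumSq, sumSq, Finset.sum_div, Finset.sum_div, ← Finset.sum_neg_distrib,
      ← Finset.sum_add_distrib]
    refine Finset.sum_le_sum fun j _ => ?_
    nlinarith [sq_nonneg (resid K ξ y a j - resid K ξ y c j)]
  have h3 : ∑ q ∈ Finset.range K, G q ^ 2 ≤ K * (m * sumSq m K ξ y a) := by
    calc _ ≤ ∑ q ∈ Finset.range K, (m * sumSq m K ξ y a : ℝ) := by
          refine Finset.sum_le_sum fun q _ => ?_
          have := sq_sum_le_card_mul_sum_sq (s := Finset.range m)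
            (f := fun j => resid K ξ y a j * ξ q j)
          rw [Finset.card_range] at this
          refine this.trans ?_
          unfold sumSq
          refine mul_le_mul_of_nonneg_left (Finset.sum_le_sum fun j _ => ?_) (Nat.cast_nonneg _)
          rw [mul_pow]
          have : ξ q j ^ 2 ≤ 1 := (sq_le_one_iff_abs_le_one _).2 (hξ q j)
          nlinarith [sq_nonneg (resid K ξ y a j)]
      _ = _ := by simp
  have hΦ : 0 ≤ sumSq m K ξ y a := Finset.sum_nonneg fun j _ => sq_nonneg _
  have hE : 0 ≤ sumSq m K ξ y c := Finset.sum_nonneg fun j _ => sq_nonneg _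
  have h4 : σ ^ 2 * ∑ q ∈ Finset.range K, G q ^ 2 ≤ σ * (sumSq m K ξ y a / 2) := by
    calc _ ≤ σ ^ 2 * (K * (m * sumSq m K ξ y a)) := by gcongr
      _ = σ * (m * K) * (σ * sumSq m K ξ y a) := by ring
      _ ≤ 1 / 2 * (σ * sumSq m K ξ y a) := by gcongr
      _ = _ := by ring
  rw [h1]
  nlinarith [mul_le_mul_of_nonneg_left h2 hσ]

/-- Convergence of gradient descent, with control of the distance to a good solution `c`. -/
theorem gdIter_spec (hξ : ∀ q j, |ξ q j| ≤ 1) {σ : ℝ} (hσ : 0 < σ) (hσ' : σ * (m * K) ≤ 1 / 2)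
    (c : ℕ → ℝ) {N : ℕ} {e Z : ℝ} (hN : 0 < N) (he : sumSq m K ξ y c ≤ e)
    (hc : ∑ q ∈ Finset.range K, c q ^ 2 ≤ Z) (hZ : Z ≤ N * (σ * e)) :
    sumSq m K ξ y (gdIter m K ξ y σ N) ≤ 4 * e ∧
    ∑ q ∈ Finset.range K, (gdIter m K ξ y σ N q - c q) ^ 2 ≤ Z + N * (σ * e) := by
  have hmono : Antitone fun i => sumSq m K ξ y (gdIter m K ξ y σ i) :=
    antitone_nat_of_succ_le fun i => sumSq_gdStep_le hξ hσ.le (by linarith) _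
  have h0 : ∑ q ∈ Finset.range K, (gdIter m K ξ y σ 0 q - c q) ^ 2 ≤ Z := by
    simpa [gdIter] using hc
  have hΦ : ∀ i, 0 ≤ sumSq m K ξ y (gdIter m K ξ y σ i) :=
    fun i => Finset.sum_nonneg fun j _ => sq_nonneg _
  constructor
  -- If the final loss `F` exceeds `4e`, then by monotonicity all earlier losses are at least `F`.
  -- So each round reduces the squared distance to `c` by more than `σe`, and after `N` rounds it
  -- would be negative.
  · by_contra hcon
    push Not at hcon
    set F := sumSq m K ξ y (gdIter m K ξ y σ N) with hF
    have h : ∀ i ≤ N, ∑ q ∈ Finset.range K, (gdIter m K ξ y σ i q - c q) ^ 2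
        ≤ Z - i * (σ * (F / 2 - e)) := by
      intro i
      induction i with
      | zero => intro _; simpa using h0
      | succ i ih =>
        intro hi
        have h1 := ih (by omega)
        have h2 := dist_gdStep_le (y := y) hξ hσ.le hσ' (gdIter m K ξ y σ i) c
        have h3 : F ≤ sumSq m K ξ y (gdIter m K ξ y σ i) := hmono (by omega : i ≤ N)
        have h4 : σ * (F / 2 - e) ≤ σ * (sumSq m K ξ y (gdIter m K ξ y σ i) / 2
          - sumSq m K ξ y c) := by gcongr
        rw [gdIter]; push_cast; linarith
    have h1 := h N le_rfl
    have h2 : 0 ≤ ∑ q ∈ Finset.range K, (gdIter m K ξ y σ N q - c q) ^ 2 :=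
      Finset.sum_nonneg fun q _ => sq_nonneg _
    have hN' : (0 : ℝ) < N := by exact_mod_cast hN
    have h3 : N * (σ * e) < N * (σ * (F / 2 - e)) := by gcongr; linarith
    linarith
  -- Whatever the current loss, the squared distance to `c` grows by at most `σe` in a round.
  · have h : ∀ i : ℕ, ∑ q ∈ Finset.range K, (gdIter m K ξ y σ i q - c q) ^ 2
        ≤ Z + i * (σ * e) := by
      intro i
      induction i with
      | zero => simpa using h0
      | succ i ih =>
        have h2 := dist_gdStep_le (y := y) hξ hσ.le hσ' (gdIter m K ξ y σ i) c
        have h4 : - (σ * e) ≤ σ * (sumSq m K ξ y (gdIter m K ξ y σ i) / 2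
          - sumSq m K ξ y c) := by
          rw [← mul_neg]
          have := hΦ i
          gcongr; linarith
        rw [gdIter]; push_cast; linarith
    exact h N

end GradientDescent

/-! ### Representative samples -/

/-- The number of sample points at which the derivative in the direction of `S` is non-zero. -/
noncomputable def hits {n : ℕ} (c : Finset (Fin n) → ℝ) (m : ℕ) (X : ℕ → Cube n)
    (S : Finset (Fin n)) : ℕ :=
  ((Finset.range m).filter fun j => derivPoly c S (X j) ≠ 0).card

/-- The sample `X 0, …, X (m - 1)` is `γ`-representative for the weights `w`: the frequencies of
all monomials and of all events that a derivative of `c` does not vanish are correct up to `γ`. -/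
structure Representative {n : ℕ} (w : Cube n → ℝ) (c : Finset (Fin n) → ℝ) (m : ℕ)
    (X : ℕ → Cube n) (γ : ℝ) : Prop where
  monomial : ∀ S, |∑ j ∈ Finset.range m, monomial S (X j) - m * ∑ x, w x * monomial S x| ≤ m * γ
  deriv : ∀ S, |(hits c m X S : ℝ) - m * mass w fun x => derivPoly c S x ≠ 0| ≤ m * γ

section Generalization

variable {n : ℕ} {w : Cube n → ℝ} {c : Finset (Fin n) → ℝ} {m : ℕ} {X : ℕ → Cube n} {γ : ℝ}

/-- Closure under products is what reduces the concentration of squared losses to that of single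
monomials. -/
theorem monomial_mul_monomial (S T : Finset (Fin n)) (x : Cube n) :
    monomial S x * monomial T x = monomial (S ∪ T) x := by
  classical
  rw [monomial_eq_ite, monomial_eq_ite, monomial_eq_ite]
  by_cases hS : ∀ i ∈ S, x i = true
  · by_cases hT : ∀ i ∈ T, x i = true
    · rw [if_pos hS, if_pos hT, if_pos, one_mul]
      intro i hi
      rcases Finset.mem_union.1 hi with h | h
      exacts [hS i h, hT i h]
    · rw [if_neg hT, mul_zero, if_neg fun h => hT fun i hi => h i (Finset.mem_union_right _ hi)]
  · rw [if_neg hS, zero_mul, if_neg fun h => hS fun i hi => h i (Finset.mem_union_left _ hi)]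

theorem abs_monomial_le_one (S : Finset (Fin n)) (x : Cube n) : |monomial S x| ≤ 1 := by
  rw [monomial_eq_ite]; split_ifs <;> simp

theorem monomial_nonneg (S : Finset (Fin n)) (x : Cube n) : 0 ≤ monomial S x := by
  rw [monomial_eq_ite]; split_ifs <;> simp

theorem monomial_sq (S : Finset (Fin n)) (x : Cube n) : monomial S x ^ 2 = monomial S x := by
  rw [monomial_eq_ite]; split_ifs <;> simp

/-- Squares of polynomials generalize from representative samples. -/
theorem Representative.sq_le (h : Representative w c m X γ) {ι : Type*} (U : Finset ι) (b : ι → ℝ)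
    (A : ι → Finset (Fin n)) :
    m * ∑ x, w x * (∑ u ∈ U, b u * LocalMQ.monomial (A u) x) ^ 2
      ≤ ∑ j ∈ Finset.range m, (∑ u ∈ U, b u * LocalMQ.monomial (A u) (X j)) ^ 2
        + m * γ * (∑ u ∈ U, |b u|) ^ 2 := by
  have sq_eq : ∀ x, (∑ u ∈ U, b u * LocalMQ.monomial (A u) x) ^ 2
      = ∑ u ∈ U, ∑ v ∈ U, b u * b v * LocalMQ.monomial (A u ∪ A v) x := by
    intro x
    rw [sq, Finset.sum_mul_sum]
    refine Finset.sum_congr rfl fun u _ => Finset.sum_congr rfl fun v _ => ?_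
    rw [← monomial_mul_monomial]; ring
  have e1 : ∑ x, w x * (∑ u ∈ U, b u * LocalMQ.monomial (A u) x) ^ 2
      = ∑ u ∈ U, ∑ v ∈ U, b u * b v * ∑ x, w x * LocalMQ.monomial (A u ∪ A v) x := by
    simp_rw [sq_eq, Finset.mul_sum]
    rw [Finset.sum_comm]
    refine Finset.sum_congr rfl fun u _ => ?_
    rw [Finset.sum_comm]
    exact Finset.sum_congr rfl fun v _ => Finset.sum_congr rfl fun x _ => by ring
  have e2 : ∑ j ∈ Finset.range m, (∑ u ∈ U, b u * LocalMQ.monomial (A u) (X j)) ^ 2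
      = ∑ u ∈ U, ∑ v ∈ U, b u * b v * ∑ j ∈ Finset.range m, LocalMQ.monomial (A u ∪ A v) (X j) := by
    simp_rw [sq_eq, Finset.mul_sum]
    rw [Finset.sum_comm]
    exact Finset.sum_congr rfl fun u _ => Finset.sum_comm
  have e3 : m * γ * (∑ u ∈ U, |b u|) ^ 2 = ∑ u ∈ U, ∑ v ∈ U, |b u * b v| * (m * γ) := by
    rw [sq, Finset.sum_mul_sum, Finset.mul_sum]
    refine Finset.sum_congr rfl fun u _ => ?_
    rw [Finset.mul_sum]
    exact Finset.sum_congr rfl fun v _ => by rw [abs_mul]; ring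
  rw [e1, e2, e3, ← Finset.sum_add_distrib, Finset.mul_sum]
  refine Finset.sum_le_sum fun u _ => ?_
  rw [← Finset.sum_add_distrib, Finset.mul_sum]
  refine Finset.sum_le_sum fun v _ => ?_
  have h1 := h.monomial (A u ∪ A v)
  have h2 : b u * b v * (m * ∑ x, w x * LocalMQ.monomial (A u ∪ A v) x
      - ∑ j ∈ Finset.range m, LocalMQ.monomial (A u ∪ A v) (X j)) ≤ |b u * b v| * (m * γ) := by
    refine (le_abs_self _).trans ?_
    rw [abs_mul, abs_sub_comm]
    gcongr
  linarith

theorem sum_mul_monomial_eq_mass (w : Cube n → ℝ) (S : Finset (Fin n)) :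
    ∑ x, w x * monomial S x = mass w fun x => ∀ i ∈ S, x i = true := by
  unfold mass
  refine Finset.sum_congr rfl fun x _ => ?_
  rw [monomial_eq_ite]
  by_cases h : ∀ i ∈ S, x i = true
  · rw [if_pos h, if_pos h, mul_one]
  · rw [if_neg h, if_neg h, mul_zero]

/-- The part of high degree is small on representative samples. -/
theorem Representative.high_degree (h : Representative w c m X γ) {α B : ℝ} (hα : 0 ≤ α)
    (hγ : 0 ≤ γ) (hs : ∀ i, SmoothAt w α i) (h1 : ∑ x, w x = 1) {t d : ℕ}
    (ht : (Finset.univ.filter fun S => c S ≠ 0).card ≤ t) (hB : ∀ S, |c S| ≤ B) :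
    ∑ j ∈ Finset.range m, (∑ T with c T ≠ 0 ∧ d < T.card, c T * LocalMQ.monomial T (X j)) ^ 2
      ≤ m * (t ^ 2 * B ^ 2 * ((α / (1 + α)) ^ d + γ)) := by
  set H := Finset.univ.filter fun T => c T ≠ 0 ∧ d < T.card with hH
  have hq0 : 0 ≤ α / (1 + α) := by positivity
  have hq1 : α / (1 + α) ≤ 1 := by rw [div_le_one (by linarith)]; linarith
  have hHt : (H.card : ℝ) ≤ t := by
    exact_mod_cast (Finset.card_le_card fun S hS => by
      simp only [hH, Finset.mem_filter] at hS ⊢; exact ⟨hS.1, hS.2.1⟩).trans ht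
  have hB0 : 0 ≤ B := (abs_nonneg _).trans (hB ∅)
  calc ∑ j ∈ Finset.range m, (∑ T ∈ H, c T * LocalMQ.monomial T (X j)) ^ 2
      ≤ ∑ j ∈ Finset.range m, t * ∑ T ∈ H, B ^ 2 * LocalMQ.monomial T (X j) := by
        refine Finset.sum_le_sum fun j _ => ?_
        -- Cauchy–Schwarz over at most `t` terms; a monomial equals its square, so only frequencies
        -- of monomials remain.
        refine sq_sum_le_card_mul_sum_sq.trans ?_
        gcongr with T _
        rw [mul_pow, monomial_sq]
        have : c T ^ 2 ≤ B ^ 2 := by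
          rw [← sq_abs]; exact pow_le_pow_left₀ (abs_nonneg _) (hB T) 2
        gcongr
        exact monomial_nonneg _ _
    _ = t * B ^ 2 * ∑ T ∈ H, ∑ j ∈ Finset.range m, LocalMQ.monomial T (X j) := by
        rw [Finset.sum_comm, Finset.mul_sum]
        refine Finset.sum_congr rfl fun j _ => ?_
        rw [Finset.mul_sum, Finset.mul_sum]
        exact Finset.sum_congr rfl fun T _ => by ring
    _ ≤ t * B ^ 2 * ∑ T ∈ H, m * ((α / (1 + α)) ^ d + γ) := by
        gcongr with T hT
        have h2 := (abs_le.1 (h.monomial T)).2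
        have h3 : ∑ x, w x * LocalMQ.monomial T x ≤ (α / (1 + α)) ^ d := by
          rw [sum_mul_monomial_eq_mass]
          refine (mass_monomial_le hα hs T).trans ?_
          rw [h1, mul_one]
          exact pow_le_pow_of_le_one hq0 hq1 (Finset.mem_filter.1 hT).2.2.le
        have : (m : ℝ) * ∑ x, w x * LocalMQ.monomial T x ≤ m * (α / (1 + α)) ^ d := by gcongr
        linarith
    _ = (t * B ^ 2 * (m * ((α / (1 + α)) ^ d + γ))) * H.card := by
        rw [Finset.sum_const, nsmul_eq_mul]; ring
    _ ≤ (t * B ^ 2 * (m * ((α / (1 + α)) ^ d + γ))) * t := by gcongr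
    _ = _ := by ring

end Generalization

end LocalMQ

namespace LocalMQ

/-! ### Concentration -/

section Concentration

open MeasureTheory ProbabilityTheory

variable {n : ℕ}

theorem integral_pmf_cube (D : PMF (Cube n)) (φ : Cube n → ℝ) :
    ∫ x, φ x ∂D.toMeasure = ∑ x, (D x).toReal * φ x := by
  rw [PMF.integral_eq_sum]; rfl

/-- The one-sided Hoeffding inequality. The interval is any one of length `1`, so that the lemma
applies both to a function into `[0, 1]` and to its negative. -/
theorem measure_sum_sub_ge_le (D : PMF (Cube n)) {φ : Cube n → ℝ} {a b : ℝ}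
    (hφ : ∀ x, φ x ∈ Set.Icc a b) (hab : b - a = 1) (m : ℕ) {γ : ℝ} (hγ : 0 ≤ γ) :
    (Measure.infinitePi fun _ : ℕ => D.toMeasure).real
        {ω | m * γ ≤ ∑ j ∈ Finset.range m, φ (ω j) - m * ∑ x, (D x).toReal * φ x}
      ≤ Real.exp (-(2 * (m * γ ^ 2))) := by
  rcases Nat.eq_zero_or_pos m with rfl | hm
  · simp
  set μ := Measure.infinitePi fun _ : ℕ => D.toMeasure
  have hmeas : Measurable φ := measurable_of_countable φ
  have hmean : ∀ j : ℕ, ∫ ω, φ (ω j) ∂μ = ∑ x, (D x).toReal * φ x := by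
    intro j
    rw [← integral_pmf_cube, ← Measure.infinitePi_map_eval (fun _ : ℕ => D.toMeasure) j,
      integral_map (measurable_pi_apply j).aemeasurable hmeas.aestronglyMeasurable]
  have hind : iIndepFun (fun (j : ℕ) (ω : ℕ → Cube n) => φ (ω j) - ∫ ω, φ (ω j) ∂μ) μ := by
    have := iIndepFun_infinitePi (P := fun _ : ℕ => D.toMeasure)
      (X := fun (j : ℕ) (x : Cube n) => φ x - ∫ ω, φ (ω j) ∂μ)
      (fun j => measurable_of_countable _)
    exact this
  have hsub : ∀ j < m, HasSubgaussianMGF (fun ω : ℕ → Cube n => φ (ω j) - ∫ ω, φ (ω j) ∂μ)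
      ((‖b - a‖₊ / 2) ^ 2) μ := fun j _ =>
    hasSubgaussianMGF_of_mem_Icc (X := fun ω : ℕ → Cube n => φ (ω j))
      (hmeas.comp (measurable_pi_apply j)).aemeasurable (Filter.Eventually.of_forall fun ω => hφ _)
  have h := HasSubgaussianMGF.measure_sum_range_ge_le_of_iIndepFun hind hsub
    (ε := m * γ) (by positivity)
  have e1 : ∀ ω : ℕ → Cube n, ∑ j ∈ Finset.range m, (φ (ω j) - ∫ ω, φ (ω j) ∂μ)
      = ∑ j ∈ Finset.range m, φ (ω j) - m * ∑ x, (D x).toReal * φ x := by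
    intro ω
    rw [Finset.sum_sub_distrib, Finset.sum_congr rfl fun j _ => hmean j]
    simp
  simp_rw [e1] at h
  refine h.trans (le_of_eq ?_)
  congr 1
  have hm' : (m : ℝ) ≠ 0 := by positivity
  rw [hab]
  simp
  field_simp

theorem measure_abs_sum_sub_gt_le (D : PMF (Cube n)) {φ : Cube n → ℝ}
    (hφ : ∀ x, φ x ∈ Set.Icc (0 : ℝ) 1) (m : ℕ) {γ : ℝ} (hγ : 0 ≤ γ) :
    Measure.infinitePi (fun _ : ℕ => D.toMeasure)
        {ω | ¬ |∑ j ∈ Finset.range m, φ (ω j) - m * ∑ x, (D x).toReal * φ x| ≤ m * γ}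
      ≤ ENNReal.ofReal (2 * Real.exp (-(2 * (m * γ ^ 2)))) := by
  set μ := Measure.infinitePi fun _ : ℕ => D.toMeasure
  have h1 := measure_sum_sub_ge_le D hφ (sub_zero 1) m hγ
  have h2 := measure_sum_sub_ge_le D (φ := fun x => - φ x) (a := -1) (b := 0)
    (fun x => ⟨neg_le_neg (hφ x).2, neg_nonpos.2 (hφ x).1⟩) (by norm_num) m hγ
  replace h1 := (ENNReal.le_ofReal_iff_toReal_le (measure_ne_top _ _) (Real.exp_nonneg _)).2 h1
  replace h2 := (ENNReal.le_ofReal_iff_toReal_le (measure_ne_top _ _) (Real.exp_nonneg _)).2 h2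
  calc μ {ω | ¬ |∑ j ∈ Finset.range m, φ (ω j) - m * ∑ x, (D x).toReal * φ x| ≤ m * γ}
      ≤ μ ({ω | m * γ ≤ ∑ j ∈ Finset.range m, φ (ω j) - m * ∑ x, (D x).toReal * φ x}
        ∪ {ω | m * γ ≤ ∑ j ∈ Finset.range m, -φ (ω j) - m * ∑ x, (D x).toReal * -φ x}) := by
        refine measure_mono fun ω hω => ?_
        simp only [Set.mem_ofPred_eq, not_le, lt_abs] at hω
        rcases hω with h | h
        · exact Or.inl h.le
        · right
          simp only [Set.mem_ofPred_eq, mul_neg, Finset.sum_neg_distrib]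
          linarith
    _ ≤ _ := measure_union_le _ _
    _ ≤ _ := add_le_add h1 h2
    _ = _ := by rw [← ENNReal.ofReal_add (by positivity) (by positivity)]; congr 1; ring

/-- Large samples are representative with high probability. -/
theorem measure_representative_ge (D : PMF (Cube n)) (c : Finset (Fin n) → ℝ) {m l : ℕ}
    {γ δ : ℝ} (hγ : 0 ≤ γ) (hδ : 0 < δ) (hl : (1 / 2 : ℝ) ^ l ≤ δ)
    (hm : (n + l + 2 : ℝ) ≤ m * γ ^ 2) :
    ENNReal.ofReal (1 - δ) ≤ Measure.infinitePi (fun _ : ℕ => D.toMeasure)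
      {ω | Representative (fun x => (D x).toReal) c m ω γ} := by
  classical
  set μ := Measure.infinitePi fun _ : ℕ => D.toMeasure
  set w : Cube n → ℝ := fun x => (D x).toReal
  set G := {ω | Representative w c m ω γ} with hG
  set p := 2 * Real.exp (-(2 * (m * γ ^ 2))) with hp
  -- There are `2 · 2 ^ n` events, each with two tails of size `exp (-2mγ²) ≤ 2 ^ (-(n + l + 2))`.
  -- The exponent `n + l + 2` leaves exactly `2 ^ (-l)` in total.
  have hbad : μ Gᶜ ≤ ENNReal.ofReal δ := by
    let E1 : Finset (Fin n) → Set (ℕ → Cube n) := fun S =>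
      {ω | ¬ |∑ j ∈ Finset.range m, monomial S (ω j) - m * ∑ x, w x * monomial S x| ≤ m * γ}
    let φ : Finset (Fin n) → Cube n → ℝ := fun S x => if derivPoly c S x ≠ 0 then 1 else 0
    let E2 : Finset (Fin n) → Set (ℕ → Cube n) := fun S =>
      {ω | ¬ |∑ j ∈ Finset.range m, φ S (ω j) - m * ∑ x, w x * φ S x| ≤ m * γ}
    have hsub : Gᶜ ⊆ (⋃ S ∈ (Finset.univ : Finset (Finset (Fin n))), E1 S)
        ∪ ⋃ S ∈ (Finset.univ : Finset (Finset (Fin n))), E2 S := by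
      intro ω hω
      by_contra hcon
      simp only [Set.mem_union, Set.mem_iUnion, not_or, not_exists, Finset.mem_univ] at hcon
      refine hω ⟨fun S => not_not.1 (hcon.1 S trivial), fun S => ?_⟩
      have h1 := not_not.1 (hcon.2 S trivial)
      have e1 : ∑ j ∈ Finset.range m, φ S (ω j) = (hits c m ω S : ℝ) := by
        unfold hits
        rw [Finset.card_filter]; push_cast; rfl
      have e2 : ∑ x, w x * φ S x = mass w fun x => derivPoly c S x ≠ 0 := by
        unfold mass
        refine Finset.sum_congr rfl fun x _ => ?_
        by_cases h : derivPoly c S x = 0 <;> simp [φ, h]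
      rwa [e1, e2] at h1
    have hE1 : ∀ S, μ (E1 S) ≤ ENNReal.ofReal p := fun S =>
      measure_abs_sum_sub_gt_le D (fun x => ⟨monomial_nonneg S x, (abs_le.1 (abs_monomial_le_one S x)).2⟩)
        m hγ
    have hE2 : ∀ S, μ (E2 S) ≤ ENNReal.ofReal p := fun S =>
      measure_abs_sum_sub_gt_le D (fun x => by by_cases h : derivPoly c S x = 0 <;> simp [φ, h]) m hγ
    have hU : ∀ E : Finset (Fin n) → Set (ℕ → Cube n), (∀ S, μ (E S) ≤ ENNReal.ofReal p) →
        μ (⋃ S ∈ (Finset.univ : Finset (Finset (Fin n))), E S) ≤ ENNReal.ofReal (2 ^ n * p) := by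
      intro E hE
      refine (measure_biUnion_finset_le _ _).trans ?_
      refine (Finset.sum_le_sum fun S _ => hE S).trans (le_of_eq ?_)
      rw [Finset.sum_const, Finset.card_univ, Fintype.card_finset, Fintype.card_fin, nsmul_eq_mul,
        ENNReal.ofReal_mul (p := 2 ^ n) (by positivity), ENNReal.ofReal_pow (by norm_num)]
      simp
    calc μ Gᶜ ≤ _ := measure_mono hsub
      _ ≤ _ := measure_union_le _ _
      _ ≤ _ := add_le_add (hU E1 hE1) (hU E2 hE2)
      _ = ENNReal.ofReal (2 ^ n * p + 2 ^ n * p) :=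
        (ENNReal.ofReal_add (by positivity) (by positivity)).symm
      _ ≤ ENNReal.ofReal δ := by
        refine ENNReal.ofReal_le_ofReal (le_trans ?_ hl)
        have h1 : Real.exp (-(2 * (m * γ ^ 2))) ≤ (1 / 2 : ℝ) ^ (n + l + 2) := by
          calc Real.exp (-(2 * (m * γ ^ 2))) ≤ Real.exp (((n + l + 2 : ℕ) : ℝ) * -1) := by
                rw [Real.exp_le_exp]; push_cast; nlinarith
            _ = Real.exp (-1) ^ (n + l + 2) := Real.exp_nat_mul _ _
            _ ≤ _ := by
              gcongr
              rw [Real.exp_neg, one_div]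
              gcongr
              have := Real.add_one_le_exp (1 : ℝ)
              linarith
        calc 2 ^ n * p + 2 ^ n * p = 2 ^ n * 4 * Real.exp (-(2 * (m * γ ^ 2))) := by rw [hp]; ring
          _ ≤ 2 ^ n * 4 * (1 / 2 : ℝ) ^ (n + l + 2) := by gcongr
          _ = (1 / 2) ^ l := by
            rw [pow_add, pow_add, one_div, inv_pow, inv_pow, inv_pow]
            field_simp
            norm_num
  -- Only subadditivity is used, so `G` need not be shown measurable.
  have h1 : 1 ≤ μ G + μ Gᶜ := by
    calc (1 : ENNReal) = μ Set.univ := measure_univ.symm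
      _ = μ (G ∪ Gᶜ) := by rw [Set.union_compl_self]
      _ ≤ _ := measure_union_le _ _
  rw [ENNReal.ofReal_sub _ hδ.le, ENNReal.ofReal_one]
  exact tsub_le_iff_right.2 (h1.trans (by gcongr))

end Concentration

end LocalMQ

namespace LocalMQ

/-! ### The list of candidate terms -/

section Candidates

variable {n : ℕ} (pass : Finset (Fin n) → Prop) [DecidablePred pass] (cap : ℕ)

/-- Append `insert i S` to the list if it passes the test and the list is not full. -/
def tryAdd (i : Fin n) (L : List (Finset (Fin n))) (S : Finset (Fin n)) : List (Finset (Fin n)) :=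
  if pass (insert i S) ∧ L.length < cap then L ++ [insert i S] else L

/-- Process all candidates with largest variable `i`. -/
def stage (L : List (Finset (Fin n))) (i : Fin n) : List (Finset (Fin n)) :=
  L.foldl (tryAdd pass cap i) L

/-- The list of candidates with variables among the first `k` ones. -/
def candidates (k : ℕ) : List (Finset (Fin n)) :=
  ((List.finRange n).take k).foldl (stage pass cap) [∅]

variable {pass cap}

theorem tryAdd_eq_append (i : Fin n) (L : List (Finset (Fin n))) (S : Finset (Fin n)) :
    ∃ l, tryAdd pass cap i L S = L ++ l := by
  unfold tryAdd; split_ifs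
  · exact ⟨_, rfl⟩
  · exact ⟨[], by simp⟩

theorem foldl_tryAdd_eq_append (i : Fin n) (M L : List (Finset (Fin n))) :
    ∃ l, M.foldl (tryAdd pass cap i) L = L ++ l := by
  induction M generalizing L with
  | nil => exact ⟨[], by simp⟩
  | cons S M ih =>
    obtain ⟨l, hl⟩ := tryAdd_eq_append (pass := pass) (cap := cap) i L S
    obtain ⟨l', hl'⟩ := ih (tryAdd pass cap i L S)
    exact ⟨l ++ l', by rw [List.foldl_cons, hl', hl, List.append_assoc]⟩

theorem length_foldl_tryAdd_le (i : Fin n) (M L : List (Finset (Fin n))) (hL : L.length ≤ cap) :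
    (M.foldl (tryAdd pass cap i) L).length ≤ cap := by
  induction M generalizing L with
  | nil => exact hL
  | cons S M ih =>
    refine ih _ ?_
    unfold tryAdd; split_ifs with h
    · simp; exact h.2
    · exact hL

theorem candidates_succ {k : ℕ} (hk : k < n) :
    candidates pass cap (k + 1) = stage pass cap (candidates pass cap k) ⟨k, hk⟩ := by
  unfold candidates
  rw [List.take_add_one]
  simp [hk]

theorem length_candidates_le (hcap : 1 ≤ cap) (k : ℕ) :
    (candidates pass cap k).length ≤ cap := by
  induction k with
  | zero => simpa [candidates] using hcap
  | succ k ih =>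
    by_cases hk : k < n
    · rw [candidates_succ hk]
      exact length_foldl_tryAdd_le _ _ _ ih
    · convert ih using 2
      unfold candidates
      rw [List.take_of_length_le (by simp; omega), List.take_of_length_le (by simp; omega)]

/-- Every set in the list, except possibly the empty one, has passed. -/
theorem pass_of_mem_candidates {k : ℕ} (hk : k ≤ n) :
    ∀ S ∈ candidates pass cap k, S = ∅ ∨ pass S := by
  induction k with
  | zero => simp [candidates]
  | succ k ih =>
    rw [candidates_succ (by omega)]
    have key : ∀ (M L : List (Finset (Fin n))), (∀ S ∈ L, S = ∅ ∨ pass S) →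
        ∀ S ∈ M.foldl (tryAdd pass cap ⟨k, by omega⟩) L, S = ∅ ∨ pass S := by
      intro M
      induction M with
      | nil => exact fun L h => h
      | cons S M ihM =>
        intro L hL
        refine ihM _ ?_
        unfold tryAdd; split_ifs with h
        · intro T hT
          rcases List.mem_append.1 hT with h' | h'
          · exact hL T h'
          · rw [List.mem_singleton] at h'; subst h'; exact Or.inr h.1
        · exact hL
    exact key _ _ (ih (by omega))

/-- Stage `k` adds the element `k` to distinct sets with all elements below `k`. The new sets are
therefore distinct from each other and from the old ones. -/
theorem candidates_nodup {k : ℕ} (hk : k ≤ n) :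
    (candidates pass cap k).Nodup ∧ ∀ S ∈ candidates pass cap k, ∀ i ∈ S, i.val < k := by
  induction k with
  | zero => simp [candidates]
  | succ k ih =>
    obtain ⟨ih1, ih2⟩ := ih (by omega)
    rw [candidates_succ (by omega)]
    set i : Fin n := ⟨k, by omega⟩
    have key : ∀ (M L : List (Finset (Fin n))), M.Nodup → (∀ S ∈ M, i ∉ S) → L.Nodup →
        (∀ S ∈ L, ∀ j ∈ S, j.val < k + 1) → (∀ S ∈ M, ∀ j ∈ S, j.val < k + 1) →
        (∀ S ∈ M, insert i S ∉ L) →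
        (M.foldl (tryAdd pass cap i) L).Nodup ∧
          ∀ S ∈ M.foldl (tryAdd pass cap i) L, ∀ j ∈ S, j.val < k + 1 := by
      intro M
      induction M with
      | nil => exact fun L _ _ h1 h2 _ _ => ⟨h1, h2⟩
      | cons S M ihM =>
        intro L hM hiM hL hLk hMk hML
        rw [List.nodup_cons] at hM
        have hS := List.mem_cons_self (a := S) (l := M)
        have hsub : ∀ T ∈ M, T ∈ S :: M := fun T hT => List.mem_cons_of_mem _ hT
        rw [List.foldl_cons]
        by_cases h : pass (insert i S) ∧ L.length < cap
        · rw [tryAdd, if_pos h]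
          refine ihM _ hM.2 (fun T hT => hiM T (hsub T hT)) ?_ ?_ (fun T hT => hMk T (hsub T hT)) ?_
          · rw [List.nodup_append]
            refine ⟨hL, List.nodup_singleton _, ?_⟩
            rintro T hT T' hT' rfl
            rw [List.mem_singleton] at hT'
            subst hT'
            exact hML S hS hT
          · intro T hT j hj
            rcases List.mem_append.1 hT with h' | h'
            · exact hLk T h' j hj
            · rw [List.mem_singleton] at h'; subst h'
              rcases Finset.mem_insert.1 hj with rfl | hj
              · exact Nat.lt_succ_self k
              · exact hMk S hS j hj
          · intro T hT hTL
            rcases List.mem_append.1 hTL with h' | h'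
            · exact hML T (hsub T hT) h'
            · rw [List.mem_singleton] at h'
              -- Inserting `i` is injective on sets that do not contain `i`.
              have : T = S := by
                rw [← Finset.erase_insert (hiM T (hsub T hT)), h', Finset.erase_insert (hiM S hS)]
              exact hM.1 (this ▸ hT)
        · rw [tryAdd, if_neg h]
          exact ihM _ hM.2 (fun T hT => hiM T (hsub T hT)) hL hLk (fun T hT => hMk T (hsub T hT))
            (fun T hT => hML T (hsub T hT))
    have hi : ∀ S ∈ candidates pass cap k, i ∉ S := fun S hS h => lt_irrefl _ (ih2 S hS i h)
    refine key _ _ ih1 hi ih1 (fun S hS j hj => (ih2 S hS j hj).trans (Nat.lt_succ_self k))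
      (fun S hS j hj => (ih2 S hS j hj).trans (Nat.lt_succ_self k)) fun S _ h => ?_
    exact hi _ h (Finset.mem_insert_self _ _)

/-- If the list can never be full, it contains all sets whose subsets all pass. -/
theorem mem_candidates (hcap : ∀ 𝒮 : Finset (Finset (Fin n)), (∀ S ∈ 𝒮, pass S) → 𝒮.card + 1 < cap)
    {T : Finset (Fin n)} (hT : ∀ S ⊆ T, pass S) {k : ℕ} (hk : k ≤ n) :
    T.filter (fun i => i.val < k) ∈ candidates pass cap k := by
  classical
  -- The empty set is listed without a test; it accounts for the `+ 1` in `hcap`.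
  have hlen : ∀ L : List (Finset (Fin n)), L.Nodup → (∀ S ∈ L, S = ∅ ∨ pass S) → L.length < cap := by
    intro L hL hp
    have h1 := hcap (L.toFinset.erase ∅) fun S hS => by
      rw [Finset.mem_erase, List.mem_toFinset] at hS
      exact (hp S hS.2).resolve_left hS.1
    have h2 := Finset.pred_card_le_card_erase (s := L.toFinset) (a := ∅)
    rw [List.toFinset_card_of_nodup hL] at h2
    omega
  induction k with
  | zero => simp [candidates]
  | succ k ih =>
    have ih' := ih (by omega)
    have hkn : k < n := by omega
    have hfull : (candidates pass cap (k + 1)).length < cap :=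
      hlen _ (candidates_nodup hk).1 (pass_of_mem_candidates hk)
    rw [candidates_succ hkn] at hfull ⊢
    set i : Fin n := ⟨k, hkn⟩
    -- The list only grows, so if it is not full at the end it was not full at any earlier moment,
    -- and no passing set was refused for lack of room.
    have key : ∀ (M L : List (Finset (Fin n))) (S : Finset (Fin n)), S ∈ M → pass (insert i S) →
        (M.foldl (tryAdd pass cap i) L).length < cap →
        insert i S ∈ M.foldl (tryAdd pass cap i) L := by
      intro M
      induction M with
      | nil => simp
      | cons S' M ihM =>
        intro L S hS hpS hfull
        rw [List.foldl_cons] at hfull ⊢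
        rcases List.mem_cons.1 hS with rfl | hS
        · obtain ⟨l, hl⟩ := foldl_tryAdd_eq_append (pass := pass) (cap := cap) i M
            (tryAdd pass cap i L S)
          obtain ⟨l', hl'⟩ := tryAdd_eq_append (pass := pass) (cap := cap) i L S
          have hL : L.length < cap := by
            rw [hl, hl'] at hfull; simp at hfull; omega
          rw [hl, tryAdd, if_pos ⟨hpS, hL⟩]
          simp
        · exact ihM _ S hS hpS hfull
    by_cases hiT : i ∈ T
    · have e : T.filter (fun j => j.val < k + 1) = insert i (T.filter fun j => j.val < k) := by
        ext j
        simp only [Finset.mem_filter, Finset.mem_insert]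
        constructor
        · rintro ⟨h1, h2⟩
          by_cases h : j = i
          · exact Or.inl h
          · refine Or.inr ⟨h1, ?_⟩
            have : j.val ≠ k := fun h' => h (Fin.ext h')
            omega
        · rintro (rfl | ⟨h1, h2⟩)
          · exact ⟨hiT, Nat.lt_succ_self k⟩
          · exact ⟨h1, by omega⟩
      rw [e]
      refine key _ _ _ ih' (hT _ ?_) hfull
      rw [← e]; exact Finset.filter_subset _ _
    · have e : T.filter (fun j => j.val < k + 1) = T.filter fun j => j.val < k := by
        refine Finset.filter_congr fun j hj => ?_
        have : j.val ≠ k := fun h' => hiT (by rwa [← (Fin.ext h' : j = i)])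
        omega
      rw [e]
      obtain ⟨l, hl⟩ := foldl_tryAdd_eq_append (pass := pass) (cap := cap) i
        (candidates pass cap k) (candidates pass cap k)
      rw [stage, hl]
      exact List.mem_append_left _ ih'

end Candidates

end LocalMQ

namespace LocalMQ

/-! ### The learning guarantee -/

theorem sum_range_getD {α M : Type*} [AddCommMonoid M] (F : α → M) (L : List α) (a : α) :
    ∑ q ∈ Finset.range L.length, F (L.getD q a) = (L.map F).sum := by
  induction L with
  | nil => simp
  | cons b L ih =>
    rw [List.length_cons, Finset.sum_range_succ', List.map_cons, List.sum_cons, ← ih, add_comm]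
    simp

/-- The test of candidates: the derivative is non-zero on a noticeable fraction of the sample. -/
def PassTest {n : ℕ} (c : Finset (Fin n) → ℝ) (m : ℕ) (X : ℕ → Cube n) (d : ℕ) (v : ℝ)
    (S : Finset (Fin n)) : Prop :=
  S.card ≤ d ∧ (m : ℝ) ≤ 2 * v * hits c m X S

section Guarantee

variable {n : ℕ} {w : Cube n → ℝ} {c : Finset (Fin n) → ℝ} {m : ℕ} {X : ℕ → Cube n} {γ α : ℝ}

/-- On representative samples, the candidates include all terms of low degree. -/
theorem Representative.mem_candidates (h : Representative w c m X γ) (hm : 0 < m) (hα : 0 ≤ α)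
    (hw : ∀ x, 0 ≤ w x) (hs : ∀ i, SmoothAt w α i) (h1 : ∑ x, w x = 1) {t d k cap : ℕ} {v : ℝ}
    (ht : (Finset.univ.filter fun S => c S ≠ 0).card ≤ t) (hk : t ≤ 2 ^ k)
    (hv : v = (1 + α) ^ (d + k)) (hγ : γ ≤ 1 / (4 * v)) (hcap : 4 * t * v ^ 2 + 1 < cap)
    [DecidablePred (PassTest c m X d v)] {T : Finset (Fin n)} (hT : c T ≠ 0) (hTd : T.card ≤ d) :
    T ∈ candidates (PassTest c m X d v) cap n := by
  classical
  have h1α : 1 ≤ 1 + α := by linarith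
  have hv1 : 1 ≤ v := by rw [hv]; exact one_le_pow₀ h1α
  have hv0 : 0 < v := by linarith
  have hm' : (0 : ℝ) < m := by exact_mod_cast hm
  have hmγ : m * γ ≤ m * (1 / (4 * v)) := by gcongr
  have key := LocalMQ.mem_candidates (pass := PassTest c m X d v) (cap := cap) (T := T) (k := n)
    ?_ ?_ le_rfl
  · simpa using key
  -- A passing set has empirical frequency at least `1 / (2v)`, hence probability at least `1 / (2v)
  -- - γ ≥ 1 / (4v)`. There are at most `4v · t(1 + α) ^ d ≤ 4tv²` such sets.
  · intro 𝒮 h𝒮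
    have := card_mul_le_of_mass_derivPoly (c := c) hα hw hs h1 (d := d) (θ := 1 / (4 * v)) 𝒮
      fun S hS => ⟨(h𝒮 S hS).1, ?_⟩
    · have h2 : (𝒮.card : ℝ) * (1 / (4 * v)) ≤ t * v := by
        refine this.trans ?_
        have e1 : (1 + α) ^ d ≤ v := by
          rw [hv]; exact pow_le_pow_right₀ h1α (Nat.le_add_right _ _)
        have e2 : ((Finset.univ.filter fun S => c S ≠ 0).card : ℝ) ≤ t := by exact_mod_cast ht
        gcongr
      rw [mul_one_div, div_le_iff₀ (by positivity)] at h2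
      have : (𝒮.card : ℝ) + 1 < cap := by nlinarith
      exact_mod_cast this
    · have h2 := (h𝒮 S hS).2
      have h3 := (abs_le.1 (h.deriv S)).2
      have h4 : (m : ℝ) * (1 / (2 * v)) ≤ hits c m X S := by
        rw [mul_one_div, div_le_iff₀ (by positivity)]; linarith
      have h5 : (m : ℝ) * (1 / (2 * v)) = m * (1 / (4 * v)) + m * (1 / (4 * v)) := by
        field_simp; norm_num
      exact le_of_mul_le_mul_left (by linarith) hm'
  -- A subset of a term has probability at least `1 / v`, hence empirical frequency at least `1 / v
  -- - 1 / (4v)`, which exceeds the threshold `1 / (2v)`.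
  · intro S hS
    refine ⟨(Finset.card_le_card hS).trans hTd, ?_⟩
    have h2 := sum_le_mass_derivPoly (c := c) hα hw hs (ht.trans hk) hS hT
    have h3 := (abs_le.1 (h.deriv S)).1
    have h4 : (1 + α) ^ (T.card + k) ≤ v := by
      rw [hv]; exact pow_le_pow_right₀ h1α (by omega)
    have h5 : 0 ≤ mass w (fun x => derivPoly c S x ≠ 0) := mass_nonneg hw _
    have h6 : 1 ≤ v * mass w (fun x => derivPoly c S x ≠ 0) := by
      rw [h1] at h2; exact h2.trans (by gcongr)
    have h7 : 2 * v * (m * (1 / (4 * v))) = m / 2 := by field_simp; norm_num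
    have h8 : 2 * v * (m * mass w (fun x => derivPoly c S x ≠ 0) - m * (1 / (4 * v)))
        ≤ 2 * v * hits c m X S := by gcongr; linarith
    have h9 : (m : ℝ) * 1 ≤ m * (v * mass w (fun x => derivPoly c S x ≠ 0)) := by gcongr
    linarith

set_option maxHeartbeats 1000000 in
/-- Gradient descent over the candidates finds an accurate hypothesis. -/
theorem Representative.loss_le (h : Representative w c m X γ) (hm : 0 < m) (hα : 0 ≤ α)
    (hw : ∀ x, 0 ≤ w x) (hs : ∀ i, SmoothAt w α i) (h1 : ∑ x, w x = 1) {t d k N : ℕ}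
    {v B ε cap σ : ℝ} (ht1 : 1 ≤ t)
    (ht : (Finset.univ.filter fun S => c S ≠ 0).card ≤ t) (hB1 : 1 ≤ B) (hB : ∀ S, |c S| ≤ B)
    (hε : 0 < ε) (hε1 : ε ≤ 1)
    (hd : 16 * t ^ 2 * B ^ 2 * (α / (1 + α)) ^ d ≤ ε) (hk : t ≤ 2 ^ k)
    (hv : v = (1 + α) ^ (d + k)) (hv2 : 2 ≤ v) (hcap : cap = 5 * t * v ^ 2)
    (hγ : γ = ε / (16 * cap ^ 2 * t ^ 2 * B ^ 2))
    (hN : 16 * t * B ^ 2 * cap / ε ≤ N) (hN' : N ≤ 16 * t * B ^ 2 * cap / ε + 1)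
    (hσ : σ = 1 / (2 * cap * m))
    [DecidablePred (PassTest c m X d v)] (L : List (Finset (Fin n)))
    (hL : L = candidates (PassTest c m X d v) ⌊cap⌋₊ n) (ξ : ℕ → ℕ → ℝ)
    (hξ : ∀ q j, ξ q j = LocalMQ.monomial (L.getD q ∅) (X j)) (y : ℕ → ℝ)
    (hy : ∀ j, y j = multilinear c (X j)) :
    ∑ x, w x * (∑ q ∈ Finset.range L.length,
      gdIter m L.length ξ y σ N q * LocalMQ.monomial (L.getD q ∅) x - multilinear c x) ^ 2 ≤ ε := by
  classical
  have ht1' : (1 : ℝ) ≤ t := by exact_mod_cast ht1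
  have hm' : (0 : ℝ) < m := by exact_mod_cast hm
  have hv0 : 0 < v := by linarith
  have hcap20 : 20 ≤ cap := by rw [hcap]; nlinarith
  have hcapv : v ≤ cap := by rw [hcap]; nlinarith
  have hcap0 : 0 < cap := by linarith
  have hB0 : 0 < B := by linarith
  have hγ0 : 0 ≤ γ := by rw [hγ]; positivity
  -- Rounding the capacity down costs less than one. Together with the entry for the empty set this
  -- is covered by the spare `t v² ≥ 2` in `cap = 5tv²`.
  have hfloor : cap - 1 < (⌊cap⌋₊ : ℝ) := by have := Nat.lt_floor_add_one cap; linarith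
  set K := L.length with hK
  have hKcap : (K : ℝ) ≤ cap := by
    have h2 : K ≤ ⌊cap⌋₊ := by
      rw [hK, hL]; exact length_candidates_le (Nat.le_floor (by norm_num; linarith)) _
    exact (Nat.cast_le.2 h2).trans (Nat.floor_le hcap0.le)
  have hγv : γ ≤ 1 / (4 * v) := by
    rw [hγ]
    refine (div_le_div_iff₀ (by positivity) (by positivity)).2 ?_
    have e1 : ε * (4 * v) ≤ 1 * (4 * v) := by gcongr
    have e2 : (1 : ℝ) ≤ t ^ 2 := one_le_pow₀ ht1'
    have e3 : (1 : ℝ) ≤ B ^ 2 := one_le_pow₀ hB1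
    calc ε * (4 * v) ≤ 1 * (4 * v) := e1
      _ ≤ 16 * cap ^ 2 := by nlinarith
      _ = 16 * cap ^ 2 * 1 * 1 := by ring
      _ ≤ 16 * cap ^ 2 * t ^ 2 * B ^ 2 := by gcongr
      _ = _ := by ring
  have hnodup : L.Nodup := by rw [hL]; exact (candidates_nodup le_rfl).1
  have hLd : ∀ T ∈ L, T.card ≤ d := by
    intro T hT
    rw [hL] at hT
    rcases pass_of_mem_candidates le_rfl T hT with rfl | h2
    · simp
    · exact h2.1
  have hmem : ∀ T, c T ≠ 0 → T.card ≤ d → T ∈ L := by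
    intro T hT hTd
    rw [hL]
    refine h.mem_candidates hm hα hw hs h1 ht hk hv hγv ?_ hT hTd
    have : 2 ≤ t * v ^ 2 := by nlinarith
    linarith
  -- The comparison vector for the gradient descent: the true coefficients on the candidates. Its
  -- residual consists exactly of the terms in `H`, of degree above `d`.
  set b : ℕ → ℝ := fun q => c (L.getD q ∅) with hb
  set H := Finset.univ.filter fun T => c T ≠ 0 ∧ d < T.card with hH
  have hLsum : ∀ F : Finset (Fin n) → ℝ, (∀ T, c T = 0 → F T = 0) →
      ∑ q ∈ Finset.range K, F (L.getD q ∅) = ∑ T with c T ≠ 0 ∧ T.card ≤ d, F T := by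
    intro F hF
    rw [hK, sum_range_getD, ← List.sum_toFinset _ hnodup]
    symm
    refine Finset.sum_subset (fun T hT => ?_) fun T hT hT' => ?_
    · rw [Finset.mem_filter] at hT; exact List.mem_toFinset.2 (hmem T hT.2.1 hT.2.2)
    · rw [List.mem_toFinset] at hT
      have := hLd T hT
      refine hF T ?_
      by_contra h2
      exact hT' (Finset.mem_filter.2 ⟨Finset.mem_univ _, h2, this⟩)
  have hf : ∀ x, multilinear c x = ∑ q ∈ Finset.range K, b q * LocalMQ.monomial (L.getD q ∅) x
      + ∑ T ∈ H, c T * LocalMQ.monomial T x := by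
    intro x
    rw [hLsum (fun T => c T * LocalMQ.monomial T x) (fun T hT => by simp [hT]), multilinear,
      ← Finset.sum_filter_add_sum_filter_not _ (fun T => c T ≠ 0 ∧ T.card ≤ d)]
    congr 1
    rw [hH, Finset.sum_filter, Finset.sum_filter]
    refine Finset.sum_congr rfl fun T _ => ?_
    by_cases h2 : c T = 0
    · simp [h2]
    · simp [h2]
  have hξ1 : ∀ q j, |ξ q j| ≤ 1 := fun q j => by rw [hξ]; exact abs_monomial_le_one _ _
  -- Error budget: `H` has empirical loss at most `m(ε/16 + ε/16) = e`. Gradient descent reaches `4e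
  -- = mε/2`, and generalization takes the other `mε/2`.
  set e := m * (ε / 8) with he
  have hres : ∀ j, resid K ξ y b j = ∑ T ∈ H, c T * LocalMQ.monomial T (X j) := by
    intro j
    unfold resid
    simp_rw [hξ]
    rw [hy, hf]; ring
  have hE : sumSq m K ξ y b ≤ e := by
    unfold sumSq
    simp_rw [hres]
    refine (h.high_degree hα hγ0 hs h1 ht hB).trans ?_
    rw [he]
    refine mul_le_mul_of_nonneg_left ?_ hm'.le
    have e1 : t ^ 2 * B ^ 2 * γ ≤ ε / 16 := by
      rw [hγ, mul_div_assoc', div_le_div_iff₀ (by positivity) (by norm_num)]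
      have : (1 : ℝ) ≤ cap ^ 2 := one_le_pow₀ (by linarith)
      calc t ^ 2 * B ^ 2 * ε * 16 = 1 * (t ^ 2 * B ^ 2 * ε * 16) := by ring
        _ ≤ cap ^ 2 * (t ^ 2 * B ^ 2 * ε * 16) := by gcongr
        _ = _ := by ring
    linarith
  have hsq : ∀ T, c T ^ 2 ≤ B ^ 2 := fun T => by
    rw [← sq_abs]; exact pow_le_pow_left₀ (abs_nonneg _) (hB T) 2
  have hZ : ∑ q ∈ Finset.range K, b q ^ 2 ≤ t * B ^ 2 := by
    rw [hLsum (fun T => c T ^ 2) (fun T hT => by simp [hT])]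
    calc _ ≤ ∑ T with c T ≠ 0 ∧ T.card ≤ d, B ^ 2 := Finset.sum_le_sum fun T _ => hsq T
      _ = ((Finset.univ.filter fun T => c T ≠ 0 ∧ T.card ≤ d).card : ℝ) * B ^ 2 := by
        rw [Finset.sum_const, nsmul_eq_mul]
      _ ≤ _ := by
        gcongr
        refine (Finset.card_le_card fun T hT => ?_).trans ht
        simp only [Finset.mem_filter] at hT ⊢
        exact ⟨hT.1, hT.2.1⟩
  -- The number of rounds is chosen so that this is about `tB²`, the bound on the squared length of
  -- `b`. The lower bound gives convergence, the upper bound keeps the result near `b`.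
  have hNσ : N * (σ * e) = N * (ε / (16 * cap)) := by
    rw [hσ, he]; field_simp; ring
  have hN0 : 0 < N := by
    have : (0 : ℝ) < N := lt_of_lt_of_le (by positivity) hN
    exact_mod_cast this
  have hlow : t * B ^ 2 ≤ N * (σ * e) := by
    rw [hNσ]
    calc t * B ^ 2 = 16 * t * B ^ 2 * cap / ε * (ε / (16 * cap)) := by field_simp
      _ ≤ _ := by gcongr
  have hhigh : N * (σ * e) ≤ 2 * (t * B ^ 2) := by
    rw [hNσ]
    calc N * (ε / (16 * cap)) ≤ (16 * t * B ^ 2 * cap / ε + 1) * (ε / (16 * cap)) := by gcongr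
      _ = t * B ^ 2 + ε / (16 * cap) := by field_simp
      _ ≤ t * B ^ 2 + 1 := by
        gcongr; rw [div_le_one (by positivity)]; linarith
      _ ≤ _ := by nlinarith [one_le_pow₀ hB1 (n := 2)]
  obtain ⟨g1, g2⟩ := gdIter_spec (y := y) (m := m) (K := K) hξ1 (σ := σ) (by rw [hσ]; positivity)
    (by
      rw [hσ, div_mul_eq_mul_div, div_le_div_iff₀ (by positivity) (by norm_num)]
      have : (m : ℝ) * K ≤ m * cap := by gcongr
      linarith) b hN0 hE hZ hlow
  set a := gdIter m K ξ y σ N with ha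
  -- The error of the hypothesis is a single sparse polynomial: coefficients `a - b` on the
  -- candidates and `-c` on `H`. In this form its `ℓ¹` norm does not involve the number of all
  -- monomials.
  have hsplit : ∀ x, ∑ q ∈ Finset.range K, a q * LocalMQ.monomial (L.getD q ∅) x - multilinear c x
      = ∑ u ∈ (Finset.range K).disjSum H, (Sum.elim (fun q => a q - b q) (fun T => - c T) u) *
        LocalMQ.monomial (Sum.elim (fun q => L.getD q ∅) id u) x := by
    intro x
    rw [Finset.sum_disjSum, hf]
    simp only [Sum.elim_inl, Sum.elim_inr, id, sub_mul, Finset.sum_sub_distrib, neg_mul,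
      Finset.sum_neg_distrib]
    ring
  have hgen := h.sq_le ((Finset.range K).disjSum H) (Sum.elim (fun q => a q - b q) (fun T => - c T))
    (Sum.elim (fun q => L.getD q ∅) id)
  simp_rw [← hsplit] at hgen
  have hemp : ∑ j ∈ Finset.range m, (∑ q ∈ Finset.range K,
      a q * LocalMQ.monomial (L.getD q ∅) (X j) - multilinear c (X j)) ^ 2 ≤ m * (ε / 2) := by
    refine le_trans (le_of_eq ?_) (g1.trans (le_of_eq ?_))
    · unfold sumSq resid
      refine Finset.sum_congr rfl fun j _ => ?_
      simp_rw [hξ]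
      rw [hy]; ring
    · rw [he]; ring
  -- The first part has squared Euclidean length at most `3tB²` over at most `cap` coordinates; the
  -- second has at most `t` entries bounded by `B`. The value of `γ` is `ε / 2` divided by this
  -- bound.
  have hW : (∑ u ∈ (Finset.range K).disjSum H, |Sum.elim (fun q => a q - b q) (fun T => - c T) u|) ^ 2
      ≤ 8 * cap ^ 2 * t ^ 2 * B ^ 2 := by
    rw [Finset.sum_disjSum]
    simp only [Sum.elim_inl, Sum.elim_inr, abs_neg]
    have w1 : (∑ q ∈ Finset.range K, |a q - b q|) ^ 2 ≤ cap * (3 * (t * B ^ 2)) := by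
      have := sq_sum_le_card_mul_sum_sq (s := Finset.range K) (f := fun q => |a q - b q|)
      simp only [sq_abs, Finset.card_range] at this
      refine this.trans ?_
      gcongr
      linarith
    have w2 : ∑ T ∈ H, |c T| ≤ t * B := by
      calc _ ≤ ∑ T ∈ H, B := Finset.sum_le_sum fun T _ => hB T
        _ = H.card * B := by rw [Finset.sum_const, nsmul_eq_mul]
        _ ≤ _ := by
          gcongr
          refine (Finset.card_le_card fun T hT => ?_).trans ht
          simp only [hH, Finset.mem_filter] at hT ⊢
          exact ⟨hT.1, hT.2.1⟩
    have w3 : (∑ T ∈ H, |c T|) ^ 2 ≤ (t * B) ^ 2 :=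
      pow_le_pow_left₀ (Finset.sum_nonneg fun _ _ => abs_nonneg _) w2 2
    refine (add_sq_le).trans ?_
    have w4 : cap * (3 * (t * B ^ 2)) ≤ 3 * (cap ^ 2 * t ^ 2 * B ^ 2) := by
      have w6 : 1 ≤ cap * t := by nlinarith
      calc cap * (3 * (t * B ^ 2)) = cap * t * (3 * B ^ 2) := by ring
        _ ≤ (cap * t) ^ 2 * (3 * B ^ 2) := by gcongr; exact le_self_pow₀ w6 (by norm_num)
        _ = _ := by ring
    have w5 : (t * B) ^ 2 ≤ cap ^ 2 * t ^ 2 * B ^ 2 := by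
      have : (1 : ℝ) ≤ cap ^ 2 := one_le_pow₀ (by linarith)
      calc (t * B) ^ 2 = 1 * (t ^ 2 * B ^ 2) := by ring
        _ ≤ cap ^ 2 * (t ^ 2 * B ^ 2) := by gcongr
        _ = _ := by ring
    linarith
  have hγW : m * γ * (∑ u ∈ (Finset.range K).disjSum H,
      |Sum.elim (fun q => a q - b q) (fun T => - c T) u|) ^ 2 ≤ m * (ε / 2) := by
    calc _ ≤ m * γ * (8 * cap ^ 2 * t ^ 2 * B ^ 2) := by gcongr
      _ = m * (ε / 2) := by rw [hγ]; field_simp; norm_num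
  exact le_of_mul_le_mul_left (by linarith) hm'

end Guarantee

end LocalMQ

namespace LocalMQ

/-! ### Reasoning about programs -/

/-- Started in `s`, the program `p` halts within `b` steps in a state that satisfies `Q`. -/
def WP {n : ℕ} (f : Cube n → ℝ) (ω : ℕ → Cube n) (r : ℝ) (p : Program) (s : State) (b : ℕ)
    (Q : State → Prop) : Prop :=
  ∃ k s', Exec f ω r p s k s' ∧ k ≤ b ∧ Q s'

/-- Write a natural number to a cell. -/
def State.setN (s : State) (a v : ℕ) : State := { s with nat := Function.update s.nat a v }

/-- Write a real number to a cell. -/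
noncomputable def State.setR (s : State) (a : ℕ) (v : ℝ) : State :=
  { s with real := Function.update s.real a v }

theorem State.setN_nat (s : State) (a v b : ℕ) :
    (s.setN a v).nat b = if b = a then v else s.nat b := by
  simp [State.setN, Function.update_apply]

@[simp] theorem State.setN_real (s : State) (a v : ℕ) : (s.setN a v).real = s.real := rfl

@[simp] theorem State.setN_seen (s : State) (a v : ℕ) : (s.setN a v).seen = s.seen := rfl

theorem State.setR_real (s : State) (a : ℕ) (v : ℝ) (b : ℕ) :
    (s.setR a v).real b = if b = a then v else s.real b := by
  simp [State.setR, Function.update_apply]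

@[simp] theorem State.setR_nat (s : State) (a : ℕ) (v : ℝ) : (s.setR a v).nat = s.nat := rfl

@[simp] theorem State.setR_seen (s : State) (a : ℕ) (v : ℝ) : (s.setR a v).seen = s.seen := rfl

@[simp] theorem State.setN_nat_self (s : State) (a v : ℕ) : (s.setN a v).nat a = v := by
  simp [State.setN_nat]

@[simp] theorem State.setR_real_self (s : State) (a : ℕ) (v : ℝ) : (s.setR a v).real a = v := by
  simp [State.setR_real]

@[simp] theorem State.setN_nat_ne (s : State) {a b : ℕ} (v : ℕ) (h : b ≠ a) :
    (s.setN a v).nat b = s.nat b := by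
  rw [State.setN_nat, if_neg h]

@[simp] theorem State.setR_real_ne (s : State) {a b : ℕ} (v : ℝ) (h : b ≠ a) :
    (s.setR a v).real b = s.real b := by
  rw [State.setR_real, if_neg h]

theorem State.setN_setN (s : State) (a v v' : ℕ) : (s.setN a v).setN a v' = s.setN a v' := by
  simp [State.setN]

/-- The content of a fixed natural cell. -/
abbrev reg (k : ℕ) : NatExpr := .load (.const k)

/-- The content of a fixed real cell. -/
abbrev rreg (k : ℕ) : RealExpr := .load (.const k)

/-- A counting loop: the cell `I` runs from `0` to the value of `bound`. -/
def forLoop (I : ℕ) (bound : NatExpr) (body : Program) : Program :=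
  .seq (.setNat (.const I) (.const 0))
    (.while (.not (.natLE bound (reg I)))
      (.seq body (.setNat (.const I) (.add (reg I) (.const 1)))))

section Rules

variable {n : ℕ} {f : Cube n → ℝ} {ω : ℕ → Cube n} {r : ℝ} {s : State} {Q : State → Prop}

theorem WP.mono {p : Program} {b b' : ℕ} {Q' : State → Prop} (h : WP f ω r p s b Q) (hb : b ≤ b')
    (hQ : ∀ s', Q s' → Q' s') : WP f ω r p s b' Q' := by
  obtain ⟨k, s', h1, h2, h3⟩ := h
  exact ⟨k, s', h1, h2.trans hb, hQ s' h3⟩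

theorem WP.skip (h : Q s) : WP f ω r .skip s 1 Q := ⟨1, s, .skip s, le_rfl, h⟩

theorem WP.setNat {a v : NatExpr} (h : Q (s.setN (a.eval s) (v.eval s))) :
    WP f ω r (.setNat a v) s (a.cost + v.cost + 1) Q :=
  ⟨_, _, .setNat s a v, le_rfl, h⟩

theorem WP.setReal {a : NatExpr} {v : RealExpr} (h : Q (s.setR (a.eval s) (v.eval s))) :
    WP f ω r (.setReal a v) s (a.cost + v.cost + 1) Q :=
  ⟨_, _, .setReal s a v, le_rfl, h⟩

theorem WP.query {a b : NatExpr}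
    (hloc : ∃ j < s.seen, (hammingDist (ω j) (s.readPoint n (a.eval s)) : ℝ) ≤ r)
    (h : Q (s.setR (b.eval s) (f (s.readPoint n (a.eval s))))) :
    WP f ω r (.query a b) s (a.cost + b.cost + (n + 1)) Q :=
  ⟨_, _, .query s a b hloc, le_rfl, h⟩

theorem WP.example_ {a b : NatExpr}
    (h : Q (s.receive (a.eval s) (b.eval s) (ω s.seen) (f (ω s.seen)))) :
    WP f ω r (.example_ a b) s (a.cost + b.cost + (n + 1)) Q :=
  ⟨_, _, .example_ s a b, le_rfl, h⟩

theorem WP.seq {p q : Program} {b₁ b₂ : ℕ}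
    (h : WP f ω r p s b₁ fun s₁ => WP f ω r q s₁ b₂ Q) : WP f ω r (.seq p q) s (b₁ + b₂) Q := by
  obtain ⟨k₁, s₁, h1, h2, k₂, s₂, h3, h4, h5⟩ := h
  exact ⟨k₁ + k₂, s₂, .seq h1 h3, by omega, h5⟩

theorem WP.ite {t : Test} {p q : Program} {b : ℕ} (h1 : t.holds s → WP f ω r p s b Q)
    (h2 : ¬ t.holds s → WP f ω r q s b Q) : WP f ω r (.ite t p q) s (t.cost + b) Q := by
  by_cases h : t.holds s
  · obtain ⟨k, s', a1, a2, a3⟩ := h1 h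
    exact ⟨_, s', .iteTrue h a1, by omega, a3⟩
  · obtain ⟨k, s', a1, a2, a3⟩ := h2 h
    exact ⟨_, s', .iteFalse h a1, by omega, a3⟩

/-- The number `N` of rounds is known in advance, so termination and the step count follow by
induction on the rounds that remain. -/
theorem WP.while {t : Test} {p : Program} {c : ℕ} (N : ℕ) (Inv : ℕ → State → Prop)
    (h0 : Inv 0 s) (hstep : ∀ i < N, ∀ s, Inv i s → t.holds s ∧ WP f ω r p s c (Inv (i + 1)))
    (hend : ∀ s, Inv N s → ¬ t.holds s) :
    WP f ω r (.while t p) s (N * (t.cost + c) + t.cost) (Inv N) := by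
  have key : ∀ j ≤ N, ∀ s, Inv (N - j) s →
      WP f ω r (.while t p) s (j * (t.cost + c) + t.cost) (Inv N) := by
    intro j
    induction j with
    | zero => exact fun _ s hs => ⟨_, s, .whileFalse (hend s hs), by simp, hs⟩
    | succ j ih =>
      intro hj s hs
      obtain ⟨ht, k, s₁, h1, h2, h3⟩ := hstep (N - (j + 1)) (by omega) s hs
      rw [show N - (j + 1) + 1 = N - j by omega] at h3
      obtain ⟨k', s₂, h4, h5, h6⟩ := ih (by omega) s₁ h3
      refine ⟨_, s₂, .whileTrue ht h1 h4, ?_, h6⟩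
      rw [Nat.succ_mul]; omega
  exact key N le_rfl s (by simpa using h0)

/-- The bound is evaluated anew in each round, hence the requirement that the invariant fixes its
value. The invariant is imposed after the counter is written, so it need not mention the counter. -/
theorem WP.forLoop {I : ℕ} {bound : NatExpr} {body : Program} {c : ℕ} (N : ℕ)
    (Inv : ℕ → State → Prop) (h0 : Inv 0 (s.setN I 0))
    (hb : ∀ i ≤ N, ∀ s, Inv i s → bound.eval s = N)
    (hstep : ∀ i < N, ∀ s, Inv i s → s.nat I = i →
      WP f ω r body s c fun s' => s'.nat I = i ∧ Inv (i + 1) (s'.setN I (i + 1))) :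
    WP f ω r (forLoop I bound body) s (N * (c + bound.cost + 10) + bound.cost + 7)
      fun s' => Inv N s' ∧ s'.nat I = N := by
  have hw : WP f ω r (.while (.not (.natLE bound (reg I)))
      (.seq body (.setNat (.const I) (.add (reg I) (.const 1))))) (s.setN I 0) _ _ :=
    WP.while (c := c + 6) N (fun i s => Inv i s ∧ s.nat I = i) ⟨h0, by simp⟩
      (by
        rintro i hi s ⟨h1, h2⟩
        constructor
        · simp [Test.holds, NatExpr.eval, hb i hi.le s h1, h2, hi]
        · refine WP.seq (b₂ := 6) ((hstep i hi s h1 h2).mono le_rfl ?_)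
          rintro s' ⟨h3, h4⟩
          refine WP.setNat ?_
          simp only [NatExpr.eval, h3]
          exact ⟨h4, by simp⟩)
      (by
        rintro s ⟨h1, h2⟩
        simp [Test.holds, NatExpr.eval, hb N le_rfl s h1, h2])
  refine (WP.seq (b₁ := 3) (WP.setNat (by simpa [NatExpr.eval] using hw))).mono ?_ fun s' h => h
  simp only [Test.cost, NatExpr.cost]
  have : N * (bound.cost + (1 + 1) + 1 + 1 + (c + 6)) = N * (c + bound.cost + 10) := by ring
  omega

end Rules

/-! ### Frames -/

/-- The cells from `N` on in the natural memory, except for the working point in the cells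
`100, …, 100 + n - 1`, and the cells from `M` on in the real memory are unchanged. -/
structure Keep (n N M : ℕ) (s s' : State) : Prop where
  seen : s'.seen = s.seen
  nat : ∀ a, N ≤ a → (a < 100 ∨ 100 + n ≤ a) → s'.nat a = s.nat a
  real : ∀ a, M ≤ a → s'.real a = s.real a

section Frames

variable {n N M : ℕ} {s s' s'' : State}

theorem Keep.refl : Keep n N M s s := ⟨rfl, fun _ _ _ => rfl, fun _ _ => rfl⟩

theorem Keep.trans (h : Keep n N M s s') (h' : Keep n N M s' s'') : Keep n N M s s'' :=
  ⟨h'.seen.trans h.seen, fun a h1 h2 => (h'.nat a h1 h2).trans (h.nat a h1 h2),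
    fun a h1 => (h'.real a h1).trans (h.real a h1)⟩

theorem Keep.mono {N' M' : ℕ} (h : Keep n N M s s') (hN : N ≤ N') (hM : M ≤ M') :
    Keep n N' M' s s' :=
  ⟨h.seen, fun a h1 h2 => h.nat a (hN.trans h1) h2, fun a h1 => h.real a (hM.trans h1)⟩

theorem Keep.setN (h : Keep n N M s s') {a : ℕ} (v : ℕ) (ha : a < N ∨ 100 ≤ a ∧ a < 100 + n) :
    Keep n N M s (s'.setN a v) :=
  ⟨h.seen, fun b h1 h2 => by
    rw [State.setN_nat, if_neg (by omega)]; exact h.nat b h1 h2, h.real⟩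

theorem Keep.setR (h : Keep n N M s s') {a : ℕ} (v : ℝ) (ha : a < M) :
    Keep n N M s (s'.setR a v) :=
  ⟨h.seen, h.nat, fun b h1 => by
    rw [State.setR_real, if_neg (by omega)]; exact h.real b h1⟩

theorem readPoint_congr {a : ℕ} (h : ∀ i < n, s'.nat (a + i) = s.nat (a + i)) :
    s'.readPoint n a = s.readPoint n a := by
  funext i; simp [State.readPoint, h i i.2]

theorem Keep.readPoint (h : Keep n N M s s') {a : ℕ} (ha : N ≤ a) (ha' : 100 + n ≤ a) :
    s'.readPoint n a = s.readPoint n a :=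
  readPoint_congr fun i _ => h.nat _ (by omega) (by omega)

/-- The set whose bit vector starts at the address `a`. -/
def setAt (n : ℕ) (s : State) (a : ℕ) : Finset (Fin n) :=
  Finset.univ.filter fun i => s.readPoint n a i = true

theorem mem_setAt {a : ℕ} {i : Fin n} : i ∈ setAt n s a ↔ s.nat (a + i) ≠ 0 := by
  simp [setAt, State.readPoint]

theorem setAt_congr {a : ℕ} (h : ∀ i < n, s'.nat (a + i) = s.nat (a + i)) :
    setAt n s' a = setAt n s a := by
  unfold setAt; rw [readPoint_congr h]

theorem Keep.setAt (h : Keep n N M s s') {a : ℕ} (ha : N ≤ a) (ha' : 100 + n ≤ a) :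
    setAt n s' a = setAt n s a := by
  unfold LocalMQ.setAt; rw [h.readPoint ha ha']

end Frames

end LocalMQ

namespace LocalMQ

/-! ### Enumeration of the points of a subcube -/

/-- The bits of `c` are written, lowest bit first, to the coordinates in `S` along the list. -/
def subcubePoint {n : ℕ} (S : Finset (Fin n)) : List (Fin n) → ℕ → Cube n → Cube n
  | [], _, x => x
  | i :: l, c, x =>
    if i ∈ S then subcubePoint S l (c / 2) (Function.update x i (decide (c % 2 ≠ 0)))
    else subcubePoint S l c x

/-- The sign of the point in the iterated difference. -/
noncomputable def subcubeSign {n : ℕ} (S : Finset (Fin n)) : List (Fin n) → ℕ → ℝ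
  | [], _ => 1
  | i :: l, c =>
    if i ∈ S then (if c % 2 = 0 then -1 else 1) * subcubeSign S l (c / 2) else subcubeSign S l c

section Subcube

variable {n : ℕ}

theorem sum_range_two_mul (k : ℕ) (g : ℕ → ℝ) :
    ∑ c ∈ Finset.range (2 * k), g c = ∑ c ∈ Finset.range k, (g (2 * c) + g (2 * c + 1)) := by
  induction k with
  | zero => simp
  | succ k ih =>
    rw [Nat.mul_succ, Finset.sum_range_succ, Finset.sum_range_succ, Finset.sum_range_succ, ih]
    ring

/-- The lowest bit of the number selects the value of the first coordinate in `S`. Even numbers give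
the subtracted half of the difference and odd ones the added half. -/
theorem sum_subcube (S : Finset (Fin n)) (f : Cube n → ℝ) (l : List (Fin n)) (x : Cube n) :
    ∑ c ∈ Finset.range (2 ^ (l.filter (· ∈ S)).length),
      subcubeSign S l c * f (subcubePoint S l c x) = derivList (l.filter (· ∈ S)) f x := by
  induction l generalizing x with
  | nil => simp [subcubeSign, subcubePoint, derivList]
  | cons i l ih =>
    by_cases hi : i ∈ S
    · rw [List.filter_cons_of_pos (by simpa using hi), List.length_cons, pow_succ', sum_range_two_mul,
        derivList, ← ih, ← ih, ← Finset.sum_sub_distrib]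
      refine Finset.sum_congr rfl fun c _ => ?_
      have h1 : (2 * c + 1) / 2 = c := by omega
      have h2 : (2 * c + 1) % 2 = 1 := by omega
      simp [subcubeSign, subcubePoint, hi, h1]
      ring
    · rw [List.filter_cons_of_neg (by simpa using hi), ← ih]
      simp [subcubeSign, subcubePoint, hi]

theorem subcubePoint_apply_of_notMem {S : Finset (Fin n)} {j : Fin n} (hj : j ∉ S)
    (l : List (Fin n)) (c : ℕ) (x : Cube n) : subcubePoint S l c x j = x j := by
  induction l generalizing c x with
  | nil => rfl
  | cons i l ih =>
    rw [subcubePoint]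
    split_ifs with hi
    · rw [ih, Function.update_of_ne (by rintro rfl; exact hj hi)]
    · exact ih _ _

/-- Only coordinates in `S` are overwritten. This is the source of the locality of all queries. -/
theorem hammingDist_subcubePoint_le (S : Finset (Fin n)) (l : List (Fin n)) (c : ℕ) (x : Cube n) :
    hammingDist x (subcubePoint S l c x) ≤ S.card := by
  refine Finset.card_le_card fun j hj => ?_
  by_contra h
  simp [subcubePoint_apply_of_notMem h] at hj

theorem sum_subcube_finRange (c : Finset (Fin n) → ℝ) (S : Finset (Fin n)) (x : Cube n) :
    ∑ k ∈ Finset.range (2 ^ S.card), subcubeSign S (List.finRange n) k *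
      multilinear c (subcubePoint S (List.finRange n) k x) = derivPoly c S x := by
  have h1 : ((List.finRange n).filter (· ∈ S)).toFinset = S := by ext i; simp
  have h2 : ((List.finRange n).filter (· ∈ S)).Nodup := (List.nodup_finRange n).filter _
  have h3 : ((List.finRange n).filter (· ∈ S)).length = S.card := by
    rw [← List.toFinset_card_of_nodup h2, h1]
  rw [← h3, sum_subcube, derivList_multilinear h2, h1]

end Subcube

/-! ### Programs for derivatives -/

/-- Cell `4` receives half of cell `3`. -/
def halveProg : Program :=
  .seq (.setNat (.const 4) (.const 0))
    (.while (.natLE (.add (.add (reg 4) (reg 4)) (.const 2)) (reg 3))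
      (.setNat (.const 4) (.add (reg 4) (.const 1))))

/-- The working point becomes the point number `nat 10` of the subcube through the point at
`nat 21` in the directions of the set at `nat 20`; its sign goes to the real cell `3`. -/
def pointProg : Program :=
  .seq (.setNat (.const 3) (reg 10)) <|
  .seq (.setReal (.const 3) (.ofNat (.const 1))) <|
  forLoop 5 (reg 50) <|
    .ite (.natLE (.const 1) (.load (.add (reg 20) (reg 5))))
      (.seq halveProg <|
       .seq (.setNat (.add (.const 100) (reg 5)) (.sub (.sub (reg 3) (reg 4)) (reg 4))) <|
       .seq (.setNat (.const 3) (reg 4)) <|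
       .ite (.natLE (.load (.add (.const 100) (reg 5))) (.const 0))
        (.setReal (.const 3) (.sub (.ofNat (.const 0)) (rreg 3))) .skip)
      (.setNat (.add (.const 100) (reg 5)) (.load (.add (reg 21) (reg 5))))

/-- The real cell `4` receives the derivative at the point at `nat 21`; `nat 11` holds the number
of points of the subcube. -/
def derivProg : Program :=
  .seq (.setReal (.const 4) (.ofNat (.const 0))) <|
  forLoop 10 (reg 11) <|
    .seq pointProg <|
    .seq (.query (.const 100) (.const 5)) <|
    .setReal (.const 4) (.add (rreg 4) (.mul (rreg 3) (rreg 5)))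

section DerivPrograms

variable {n : ℕ} {f : Cube n → ℝ} {ω : ℕ → Cube n} {r : ℝ} {s : State}

/-- The machine has no division of natural numbers, so the quotient is found by counting. The linear
cost is affordable because the argument is below the number of points of a subcube. -/
theorem wp_halveProg : WP f ω r halveProg s (16 * (s.nat 3 + 1)) fun s' =>
    s' = s.setN 4 (s.nat 3 / 2) := by
  have hw := WP.while (f := f) (ω := ω) (r := r)
    (t := .natLE (.add (.add (reg 4) (reg 4)) (.const 2)) (reg 3))
    (p := .setNat (.const 4) (.add (reg 4) (.const 1))) (s := s.setN 4 0) (c := 6) (s.nat 3 / 2)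
    (fun i s' => s' = s.setN 4 i) rfl
    (by
      rintro i hi _ rfl
      constructor
      · simp [Test.holds, NatExpr.eval]; omega
      · refine WP.setNat ?_
        simp [NatExpr.eval, State.setN_setN])
    (by
      rintro _ rfl
      simp [Test.holds, NatExpr.eval]; omega)
  refine (WP.seq (b₁ := 3) (WP.setNat (by simpa [NatExpr.eval] using hw))).mono ?_ fun _ h => h
  simp only [Test.cost, NatExpr.cost]
  omega

/-- The loop runs the recursions of `subcubePoint` and `subcubeSign` along the coordinates. The
invariant says that the rest of each recursion, started from the current data, still leads to the
final value. -/
theorem wp_pointProg {S : Finset (Fin n)} {x : Cube n} (hn : s.nat 50 = n)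
    (hp : 100 + n ≤ s.nat 20) (hq : 100 + n ≤ s.nat 21) (hS : setAt n s (s.nat 20) = S)
    (hx : s.readPoint n (s.nat 21) = x) :
    WP f ω r pointProg s (100 * (n + 1) * (s.nat 10 + 1)) fun s' =>
      Keep n 6 4 s s' ∧ s'.readPoint n 100 = subcubePoint S (List.finRange n) (s.nat 10) x ∧
      s'.real 3 = subcubeSign S (List.finRange n) (s.nat 10) := by
  -- The intermediate point of the recursion: coordinates below `i` are already in the working
  -- memory, the others are still those of `x`.
  let hyb : ℕ → State → Cube n := fun i s' k => if k.val < i then decide (s'.nat (100 + k) ≠ 0) else x k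
  let Inv : ℕ → State → Prop := fun i s' => Keep n 6 4 s s' ∧ s'.nat 3 ≤ s.nat 10 ∧
    subcubePoint S ((List.finRange n).drop i) (s'.nat 3) (hyb i s')
      = subcubePoint S (List.finRange n) (s.nat 10) x ∧
    s'.real 3 * subcubeSign S ((List.finRange n).drop i) (s'.nat 3)
      = subcubeSign S (List.finRange n) (s.nat 10)
  refine WP.mono (WP.seq (WP.setNat (WP.seq (WP.setReal ((WP.forLoop
    (c := 16 * (s.nat 10 + 1) + 60) n Inv ?_ ?_ ?_).mono le_rfl ?_))))) ?_ (fun _ h => h)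
  rotate_left 3
  · rintro s' ⟨⟨h1, h2, h3, h4⟩, -⟩
    have hd : (List.finRange n).drop n = [] := by simp
    rw [hd] at h3 h4
    simp only [subcubePoint, subcubeSign, mul_one] at h3 h4
    refine ⟨h1, ?_, h4⟩
    rw [← h3]
    funext k
    simp [hyb, State.readPoint]
  · simp only [RealExpr.cost, NatExpr.cost]
    nlinarith [Nat.zero_le (n * s.nat 10), Nat.zero_le n, Nat.zero_le (s.nat 10)]
  · simp only [NatExpr.eval, RealExpr.eval]
    refine ⟨((Keep.refl.setN _ (by omega)).setR _ (by omega)).setN _ (by omega), by simp, ?_, ?_⟩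
    · simp [hyb]
    · simp
  · rintro i hi s' ⟨h1, -⟩
    simp [NatExpr.eval, h1.nat 50 (by omega) (by omega), hn]
  · rintro i hi s' ⟨h1, h2, h3, h4⟩ h5
    have e20 : s'.nat 20 = s.nat 20 := h1.nat 20 (by omega) (by omega)
    have e21 : s'.nat 21 = s.nat 21 := h1.nat 21 (by omega) (by omega)
    have eS : s'.nat (s.nat 20 + i) ≠ 0 ↔ (⟨i, hi⟩ : Fin n) ∈ S := by
      rw [← hS, mem_setAt, h1.nat _ (by omega) (by omega)]
    have ex : decide (s'.nat (s.nat 21 + i) ≠ 0) = x ⟨i, hi⟩ := by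
      rw [← hx, h1.nat _ (by omega) (by omega)]; rfl
    have hdrop : (List.finRange n).drop i = ⟨i, hi⟩ :: (List.finRange n).drop (i + 1) := by
      rw [List.drop_eq_getElem_cons (by simpa using hi)]; simp
    rw [hdrop] at h3 h4
    refine WP.mono (WP.ite (b := 16 * (s.nat 10 + 1) + 35) (fun ht => ?_) fun ht => ?_) ?_
      fun _ h => h
    · have hiS : (⟨i, hi⟩ : Fin n) ∈ S := by
        rw [← eS]
        simp only [Test.holds, NatExpr.eval, e20, h5] at ht
        omega
      rw [subcubePoint, if_pos hiS] at h3
      rw [subcubeSign, if_pos hiS] at h4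
      refine WP.mono (WP.seq (b₂ := 33) ((wp_halveProg (s := s')).mono
        (show _ ≤ 16 * (s.nat 10 + 1) by omega) ?_)) ?_ fun _ h => h
      · rintro _ rfl
        have e1 : s'.nat 3 - s'.nat 3 / 2 - s'.nat 3 / 2 = s'.nat 3 % 2 := by omega
        have hK : Keep n 6 4 s (((s'.setN 4 (s'.nat 3 / 2)).setN (100 + i) (s'.nat 3 % 2)).setN 3
            (s'.nat 3 / 2)) :=
          ((h1.setN _ (by omega)).setN _ (by omega)).setN _ (by omega)
        have hhyb : ∀ s'' : State, (∀ k < i, s''.nat (100 + k) = s'.nat (100 + k)) →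
            s''.nat (100 + i) = s'.nat 3 % 2 → hyb (i + 1) s''
            = Function.update (hyb i s') ⟨i, hi⟩ (decide (s'.nat 3 % 2 ≠ 0)) := by
          intro s'' g1 g2
          funext k
          by_cases hk : k = ⟨i, hi⟩
          · subst hk; simp [hyb, g2]; rcases Nat.mod_two_eq_zero_or_one (s'.nat 3) with h | h <;> simp [h]
          · have hk' : k.val ≠ i := fun h => hk (Fin.ext h)
            rw [Function.update_of_ne hk]
            simp only [hyb]
            by_cases hki : k.val < i
            · simp [hki, g1 k hki, Nat.lt_succ_of_lt hki]
            · simp [hki, show ¬ k.val < i + 1 by omega]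
        refine WP.mono (WP.seq (WP.setNat (WP.seq (WP.setNat (WP.ite (b := 7)
          (fun ht' => ?_) fun ht' => ?_))))) ?_ fun _ h => h
        · refine WP.mono (WP.setReal ?_) (by simp [RealExpr.cost, NatExpr.cost]) fun _ h => h
          simp (disch := omega) [Test.holds, NatExpr.eval, RealExpr.eval, h5, e1] at ht' ⊢
          refine ⟨(hK.setR _ (by omega)).setN _ (by omega), by simp; omega, ?_, ?_⟩
          · rw [hhyb]
            · simpa using h3
            · intro k hk; simp (disch := omega)
            · simp (disch := omega)
          · rw [if_pos ht'] at h4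
            simpa using h4
        · refine WP.mono (WP.skip ?_) (by omega) fun _ h => h
          simp (disch := omega) [Test.holds, NatExpr.eval, h5, e1] at ht' ⊢
          refine ⟨hK.setN _ (by omega), by simp; omega, ?_, ?_⟩
          · rw [hhyb]
            · simpa using h3
            · intro k hk; simp (disch := omega)
            · simp (disch := omega)
          · rw [if_neg (by omega)] at h4
            simpa using h4
        · simp [NatExpr.cost, Test.cost]
      · omega
    · have hiS : (⟨i, hi⟩ : Fin n) ∉ S := by
        rw [← eS]
        simp only [Test.holds, NatExpr.eval, e20, h5] at ht
        omega
      rw [subcubePoint, if_neg hiS] at h3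
      rw [subcubeSign, if_neg hiS] at h4
      refine WP.mono (WP.setNat ?_) (by simp [NatExpr.cost]) fun _ h => h
      simp only [NatExpr.eval, h5, e21]
      refine ⟨by simp (disch := omega) [h5], (h1.setN _ (by omega)).setN _ (by omega), by simp (disch := omega) [h2], ?_, ?_⟩
      · convert h3 using 2
        · simp (disch := omega)
        funext k
        simp only [hyb]
        by_cases hki : k.val < i
        · rw [if_pos (by omega), if_pos hki, State.setN_nat_ne _ _ (by omega),
            State.setN_nat_ne _ _ (by omega)]
        · by_cases hk : k = ⟨i, hi⟩
          · subst hk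
            rw [if_pos (by simp), if_neg (by simp), State.setN_nat_ne _ _ (by simp; omega), ← ex]
            simp
          · have hk' : k.val ≠ i := fun h => hk (Fin.ext h)
            simp [hki, show ¬ k.val < i + 1 by omega]
      · simpa (disch := omega) using h4
    · simp only [Test.cost, NatExpr.cost]; omega

end DerivPrograms

end LocalMQ

/-! ### Programs that count the examples with a non-zero derivative. -/

namespace LocalMQ

/-- The cells `11` and `12` receive `2 ^ |S|` and `|S|` for the set `S` at `nat 20`. -/
def sizeProg : Program :=
  .seq (.setNat (.const 11) (.const 1)) <|
  .seq (.setNat (.const 12) (.const 0)) <|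
  forLoop 5 (reg 50) <|
    .ite (.natLE (.const 1) (.load (.add (reg 20) (reg 5))))
      (.seq (.setNat (.const 11) (.add (reg 11) (reg 11)))
        (.setNat (.const 12) (.add (reg 12) (.const 1)))) .skip

/-- Cell `24` receives the number of examples at which the derivative is non-zero. -/
def countProg : Program :=
  .seq (.setNat (.const 21) (.add (.const 100) (reg 50))) <|
  .seq (.setNat (.const 24) (.const 0)) <|
  forLoop 23 (reg 55) <|
    .seq derivProg <|
    .seq (.ite (.and (.realLE (rreg 4) (.ofNat (.const 0))) (.realLE (.ofNat (.const 0)) (rreg 4)))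
      .skip (.setNat (.const 24) (.add (reg 24) (.const 1)))) <|
    .setNat (.const 21) (.add (reg 21) (reg 50))

/-- The first `m` examples are stored in the memory. -/
structure Samples {n : ℕ} (ω : ℕ → Cube n) (m : ℕ) (s : State) : Prop where
  dim : s.nat 50 = n
  size : s.nat 55 = m
  seen : m ≤ s.seen
  point : ∀ j < m, s.readPoint n (100 + n + j * n) = ω j

section CountPrograms

variable {n : ℕ} {f : Cube n → ℝ} {ω : ℕ → Cube n} {r : ℝ} {s s' : State} {m : ℕ}

theorem Samples.keep {N M : ℕ} (h : Samples ω m s) (hk : Keep n N M s s') (hN : N ≤ 50) :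
    Samples ω m s' where
  dim := (hk.nat 50 hN (by omega)).trans h.dim
  size := (hk.nat 55 (by omega) (by omega)).trans h.size
  seen := by rw [hk.seen]; exact h.seen
  point j hj := by rw [hk.readPoint (by omega) (by omega)]; exact h.point j hj

/-- The derivative is accumulated over `2 ^ |S|` points. Decoding the number of a point costs up to
another factor `2 ^ |S|`, hence the square in the bound. -/
theorem wp_derivProg {c : Finset (Fin n) → ℝ} {S : Finset (Fin n)} {j : ℕ} (hn : s.nat 50 = n)
    (hp : 100 + n ≤ s.nat 20) (hq : 100 + n ≤ s.nat 21) (hS : setAt n s (s.nat 20) = S)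
    (hx : s.readPoint n (s.nat 21) = ω j) (hj : j < s.seen) (hr : (S.card : ℝ) ≤ r)
    (hpw : s.nat 11 = 2 ^ S.card) :
    WP (multilinear c) ω r derivProg s (200 * (n + 1) * (2 ^ S.card) ^ 2) fun s' =>
      Keep n 11 6 s s' ∧ s'.real 4 = derivPoly c S (ω j) := by
  let Inv : ℕ → State → Prop := fun i s' => Keep n 11 6 s s' ∧
    s'.real 4 = ∑ k ∈ Finset.range i, subcubeSign S (List.finRange n) k *
      multilinear c (subcubePoint S (List.finRange n) k (ω j))
  refine WP.mono (WP.seq (WP.setReal ((WP.forLoop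
    (c := 100 * (n + 1) * 2 ^ S.card + (n + 20)) (2 ^ S.card) Inv ?_ ?_ ?_).mono le_rfl ?_))) ?_
    (fun _ h => h)
  · simp only [NatExpr.eval, RealExpr.eval]
    exact ⟨(Keep.refl.setR _ (by omega)).setN _ (by omega), by simp⟩
  · rintro i hi s' ⟨h1, -⟩
    simp [NatExpr.eval, h1.nat 11 (by omega) (by omega), hpw]
  · rintro i hi s' ⟨h1, h2⟩ h3
    have e20 : s'.nat 20 = s.nat 20 := h1.nat 20 (by omega) (by omega)
    have e21 : s'.nat 21 = s.nat 21 := h1.nat 21 (by omega) (by omega)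
    refine WP.mono (WP.seq (b₂ := n + 20) ((wp_pointProg (S := S) (x := ω j)
      ((h1.nat 50 (by omega) (by omega)).trans hn) (by omega) (by omega)
      (by rw [e20, h1.setAt (by omega) hp, hS]) (by rw [e21, h1.readPoint (by omega) hq, hx])).mono
      (b' := 100 * (n + 1) * 2 ^ S.card) ?_ ?_)) le_rfl fun _ h => h
    · rw [h3]; gcongr; omega
    · rintro s₁ ⟨g1, g2, g3⟩
      rw [h3] at g2 g3
      refine WP.mono (WP.seq (WP.query ⟨j, ?_, ?_⟩ (WP.setReal ?_))) ?_ fun _ h => h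
      · rw [g1.seen, h1.seen]; exact hj
      -- The queried point is within distance `|S| ≤ r` of the example number `j`, which has already
      -- been received.
      · simp only [NatExpr.eval]
        rw [g2]
        refine le_trans ?_ hr
        exact_mod_cast hammingDist_subcubePoint_le _ _ _ _
      · simp only [NatExpr.eval, RealExpr.eval, g2]
        refine ⟨?_, ?_, ?_⟩
        · simp [g1.nat 10 (by omega) (by omega), h3]
        · exact (((h1.trans (g1.mono (by omega) (by omega))).setR _ (by omega)).setR _
            (by omega)).setN _ (by omega)
        · simp [Finset.sum_range_succ, g3, g1.real 4 (by omega), h2]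
      · simp only [NatExpr.cost, RealExpr.cost]; omega
  · rintro s' ⟨⟨h1, h2⟩, -⟩
    exact ⟨h1, by rw [h2, sum_subcube_finRange]⟩
  · simp only [NatExpr.cost, RealExpr.cost]
    have : 1 ≤ 2 ^ S.card := Nat.one_le_two_pow
    generalize 2 ^ S.card = u at this
    have h1 : u ≤ u ^ 2 := Nat.le_self_pow (by norm_num) u
    have h2 : n * u ≤ n * u ^ 2 := Nat.mul_le_mul_left _ h1
    have h3 : u * (100 * (n + 1) * u + (n + 20) + (1 + 1) + 10)
        = 100 * (n * u ^ 2) + 100 * u ^ 2 + n * u + 32 * u := by ring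
    have h4 : 200 * (n + 1) * u ^ 2 = 200 * (n * u ^ 2) + 200 * u ^ 2 := by ring
    omega

theorem filter_val_lt_succ (S : Finset (Fin n)) {i : ℕ} (hi : i < n) :
    S.filter (fun k => k.val < i + 1)
      = if (⟨i, hi⟩ : Fin n) ∈ S then insert ⟨i, hi⟩ (S.filter fun k => k.val < i)
        else S.filter fun k => k.val < i := by
  ext j
  split_ifs with h
  · simp only [Finset.mem_filter, Finset.mem_insert, Fin.ext_iff]
    constructor
    · rintro ⟨h1, h2⟩
      by_cases hj : j.val = i
      · exact Or.inl hj
      · exact Or.inr ⟨h1, by omega⟩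
    · rintro (h1 | ⟨h1, h2⟩)
      · have : j = ⟨i, hi⟩ := Fin.ext h1
        exact ⟨this ▸ h, by omega⟩
      · exact ⟨h1, by omega⟩
  · simp only [Finset.mem_filter]
    refine and_congr_right fun h1 => ?_
    have : j.val ≠ i := fun h' => h (by rwa [← (Fin.ext h' : j = ⟨i, hi⟩)])
    omega

theorem wp_sizeProg {S : Finset (Fin n)} (hn : s.nat 50 = n)
    (hp : 100 + n ≤ s.nat 20) (hS : setAt n s (s.nat 20) = S) :
    WP f ω r sizeProg s (60 * (n + 1)) fun s' =>
      Keep n 13 0 s s' ∧ s'.nat 11 = 2 ^ S.card ∧ s'.nat 12 = S.card := by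
  let Inv : ℕ → State → Prop := fun i s' => Keep n 13 0 s s' ∧
    s'.nat 11 = 2 ^ (S.filter fun k => k.val < i).card ∧
    s'.nat 12 = (S.filter fun k => k.val < i).card
  refine WP.mono (WP.seq (WP.setNat (WP.seq (WP.setNat ((WP.forLoop
    (c := 30) n Inv ?_ ?_ ?_).mono le_rfl ?_))))) ?_ (fun _ h => h)
  · simp only [NatExpr.eval]
    exact ⟨((Keep.refl.setN _ (by omega)).setN _ (by omega)).setN _ (by omega), by simp, by simp⟩
  · rintro i hi s' ⟨h1, -⟩
    simp [NatExpr.eval, h1.nat 50 (by omega) (by omega), hn]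
  · rintro i hi s' ⟨h1, h2, h3⟩ h4
    have e20 : s'.nat 20 = s.nat 20 := h1.nat 20 (by omega) (by omega)
    have eS : s'.nat (s.nat 20 + i) ≠ 0 ↔ (⟨i, hi⟩ : Fin n) ∈ S := by
      rw [← hS, mem_setAt, h1.nat _ (by omega) (by omega)]
    refine WP.mono (WP.ite (b := 15) (fun ht => ?_) fun ht => ?_) ?_ fun _ h => h
    · have hiS : (⟨i, hi⟩ : Fin n) ∈ S := by
        rw [← eS]
        simp only [Test.holds, NatExpr.eval, e20, h4] at ht
        omega
      have hcard : (S.filter fun k => k.val < i + 1).card = (S.filter fun k => k.val < i).card + 1 := by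
        rw [filter_val_lt_succ S hi, if_pos hiS, Finset.card_insert_of_notMem (by simp)]
      refine WP.mono (WP.seq (WP.setNat (WP.setNat ?_))) (by simp [NatExpr.cost]) fun _ h => h
      simp only [NatExpr.eval]
      refine ⟨by simp [h4], ((h1.setN _ (by omega)).setN _ (by omega)).setN _ (by omega), ?_, ?_⟩
      · rw [hcard]; simp [h2]; ring
      · rw [hcard]; simp [h3]
    · have hiS : (⟨i, hi⟩ : Fin n) ∉ S := by
        rw [← eS]
        simp only [Test.holds, NatExpr.eval, e20, h4] at ht
        omega
      refine WP.mono (WP.skip ?_) (by omega) fun _ h => h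
      rw [← if_neg (c := (⟨i, hi⟩ : Fin n) ∈ S) (t := insert ⟨i, hi⟩ (S.filter fun k => k.val < i))
        (e := S.filter fun k => k.val < i) hiS, ← filter_val_lt_succ S hi] at h2 h3
      exact ⟨h4, h1.setN _ (by omega), by simpa using h2, by simpa using h3⟩
    · simp [Test.cost, NatExpr.cost]
  · rintro s' ⟨⟨h1, h2, h3⟩, -⟩
    have : S.filter (fun k => k.val < n) = S := Finset.filter_true_of_mem fun k _ => k.2
    rw [this] at h2 h3
    exact ⟨h1, h2, h3⟩
  · simp only [NatExpr.cost]; omega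

theorem wp_countProg {c : Finset (Fin n) → ℝ} {S : Finset (Fin n)} (hs : Samples ω m s)
    (hp : 100 + n ≤ s.nat 20) (hS : setAt n s (s.nat 20) = S) (hr : (S.card : ℝ) ≤ r)
    (hpw : s.nat 11 = 2 ^ S.card) :
    WP (multilinear c) ω r countProg s (300 * (m + 1) * (n + 1) * (2 ^ S.card) ^ 2) fun s' =>
      Keep n 25 6 s s' ∧ s'.nat 24 = hits c m ω S := by
  let Inv : ℕ → State → Prop := fun i s' => Keep n 25 6 s s' ∧
    s'.nat 20 = s.nat 20 ∧ s'.nat 11 = s.nat 11 ∧ s'.nat 21 = 100 + n + i * n ∧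
    s'.nat 24 = hits c i ω S
  refine WP.mono (WP.seq (WP.setNat (WP.seq (WP.setNat ((WP.forLoop
    (c := 200 * (n + 1) * (2 ^ S.card) ^ 2 + 50) m Inv ?_ ?_ ?_).mono le_rfl ?_))))) ?_
    (fun _ h => h)
  · simp only [NatExpr.eval]
    exact ⟨((Keep.refl.setN _ (by omega)).setN _ (by omega)).setN _ (by omega), by simp, by simp,
      by simp [hs.dim], by simp [hits]⟩
  · rintro i hi s' ⟨h1, -⟩
    simp [NatExpr.eval, (hs.keep h1 (by omega)).size]
  · rintro i hi s' ⟨h1, h20, h11, h21, h24⟩ h23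
    have hs' := hs.keep h1 (by omega)
    refine WP.mono (WP.seq (b₂ := 50) ((wp_derivProg (c := c) (S := S) (j := i) hs'.dim (by omega)
      (by omega) ?_ ?_ ?_ hr (h11.trans hpw)).mono le_rfl ?_)) le_rfl fun _ h => h
    · rw [h20, h1.setAt (by omega) hp, hS]
    · rw [h21, hs'.point i hi]
    · exact lt_of_lt_of_le hi hs'.seen
    · rintro s₁ ⟨g1, g2⟩
      have k1 : Keep n 25 6 s s₁ := h1.trans (g1.mono (by omega) (by omega))
      have e50 : s₁.nat 50 = n := (hs.keep k1 (by omega)).dim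
      have e20 : s₁.nat 20 = s.nat 20 := (g1.nat 20 (by omega) (by omega)).trans h20
      have e11 : s₁.nat 11 = s.nat 11 := (g1.nat 11 (by omega) (by omega)).trans h11
      have e21 : s₁.nat 21 = 100 + n + i * n := (g1.nat 21 (by omega) (by omega)).trans h21
      have e23 : s₁.nat 23 = i := (g1.nat 23 (by omega) (by omega)).trans h23
      have e24 : s₁.nat 24 = hits c i ω S := (g1.nat 24 (by omega) (by omega)).trans h24
      refine WP.mono (WP.seq (b₂ := 7) (WP.ite (b := 6) (fun ht => ?_) fun ht => ?_)) ?_ fun _ h => h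
      · refine WP.mono (WP.skip (WP.setNat ?_)) (by omega) fun _ h => h
        simp only [Test.holds, RealExpr.eval, NatExpr.eval, g2] at ht ⊢
        refine ⟨by simp [e23], (k1.setN _ (by omega)).setN _ (by omega), by simp [e20],
          by simp [e11], by simp [e21, e50]; ring, ?_⟩
        -- The machine compares reals only by `≤`, so the test for zero consists of two
        -- inequalities.
        have : derivPoly c S (ω i) = 0 := by
          have := ht.1; have := ht.2; push_cast at *; linarith
        simp [e24, hits, Finset.range_add_one, Finset.filter_insert, this]
      · refine WP.mono (WP.setNat (WP.setNat ?_)) (by simp [NatExpr.cost]) fun _ h => h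
        simp only [Test.holds, RealExpr.eval, NatExpr.eval, g2] at ht ⊢
        refine ⟨by simp [e23], ((k1.setN _ (by omega)).setN _ (by omega)).setN _ (by omega),
          by simp [e20], by simp [e11], by simp [e21, e50]; ring, ?_⟩
        have : derivPoly c S (ω i) ≠ 0 := by
          intro h0; apply ht; simp [h0]
        simp [e24, hits, Finset.range_add_one, Finset.filter_insert, this]
      · simp [Test.cost, RealExpr.cost, NatExpr.cost]
  · rintro s' ⟨⟨h1, -, -, -, h2⟩, -⟩
    exact ⟨h1, h2⟩
  · simp only [NatExpr.cost]
    have : 1 ≤ (2 ^ S.card) ^ 2 := Nat.one_le_pow _ _ (by positivity)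
    generalize (2 ^ S.card) ^ 2 = u at this
    have e1 : m * (200 * (n + 1) * u + 50 + (1 + 1) + 10) = 200 * (m * n * u) + 200 * (m * u) + 62 * m := by
      ring
    have e2 : 300 * (m + 1) * (n + 1) * u = 300 * (m * n * u) + 300 * (m * u) + 300 * (n * u) + 300 * u := by
      ring
    have e3 : m ≤ m * u := Nat.le_mul_of_pos_right _ (by omega)
    omega

end CountPrograms

end LocalMQ

namespace LocalMQ

/-! ### Programs for the list of candidates -/

/-- Copy the bit vector at `nat 25` to the address `nat 58`. -/
def copyProg : Program :=
  forLoop 5 (reg 50) (.setNat (.add (reg 58) (reg 5)) (.load (.add (reg 25) (reg 5))))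

/-- Append the set at `nat 25` with the additional element `nat 26` to the list if it passes. -/
def tryProg : Program :=
  .seq copyProg <|
  .seq (.setNat (.add (reg 58) (reg 26)) (.const 1)) <|
  .seq (.setNat (.const 20) (reg 58)) <|
  .seq sizeProg <|
  .ite (.and (.natLE (reg 12) (reg 52)) (.realLE (.ofNat (.add (reg 57) (.const 1))) (rreg 53)))
    (.seq countProg <|
      .ite (.realLE (.ofNat (reg 55)) (.mul (.add (rreg 52) (rreg 52)) (.ofNat (reg 24))))
        (.seq (.setNat (.const 58) (.add (reg 58) (reg 50)))
          (.setNat (.const 57) (.add (reg 57) (.const 1)))) .skip) .skip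

/-- Compute the list of candidates. -/
def buildProg : Program :=
  .seq (.setNat (.const 57) (.const 1)) <|
  .seq (.setNat (.const 58) (.add (reg 56) (reg 50))) <|
  forLoop 26 (reg 50) <|
    .seq (.setNat (.const 27) (reg 57)) <|
    .seq (.setNat (.const 25) (reg 56)) <|
    forLoop 28 (reg 27) <|
      .seq tryProg <|
      .setNat (.const 25) (.add (reg 25) (reg 50))

/-- The list `L` of sets is stored at the address `a`, which is in cell `56`; its length is in
cell `57` and its end in cell `58`. -/
structure Listed (n a : ℕ) (L : List (Finset (Fin n))) (s : State) : Prop where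
  base : s.nat 56 = a
  len : s.nat 57 = L.length
  finish : s.nat 58 = a + L.length * n
  sets : ∀ q < L.length, setAt n s (a + q * n) = L.getD q ∅

/-- Nothing is changed, except for the natural cells below `N`, the cells `57` and `58`, the
working point, the natural cells from `E` on, and the real cells below `6`. -/
structure KeepList (n N E : ℕ) (s s' : State) : Prop where
  seen : s'.seen = s.seen
  nat : ∀ a, N ≤ a → a ≠ 57 → a ≠ 58 → (a < 100 ∨ 100 + n ≤ a ∧ a < E) → s'.nat a = s.nat a
  real : ∀ a, 6 ≤ a → s'.real a = s.real a

section ListPrograms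

variable {n : ℕ} {f : Cube n → ℝ} {ω : ℕ → Cube n} {r : ℝ} {s s' s'' : State} {m N E : ℕ}

theorem KeepList.refl : KeepList n N E s s := ⟨rfl, fun _ _ _ _ _ => rfl, fun _ _ => rfl⟩

theorem KeepList.trans (h : KeepList n N E s s') (h' : KeepList n N E s' s'') :
    KeepList n N E s s'' :=
  ⟨h'.seen.trans h.seen, fun a h1 h2 h3 h4 => (h'.nat a h1 h2 h3 h4).trans (h.nat a h1 h2 h3 h4),
    fun a h1 => (h'.real a h1).trans (h.real a h1)⟩

theorem KeepList.mono {N' E' : ℕ} (h : KeepList n N E s s') (hN : N ≤ N') (hE : E' ≤ E) :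
    KeepList n N' E' s s' :=
  ⟨h.seen, fun a h1 h2 h3 h4 => h.nat a (hN.trans h1) h2 h3 (by omega), h.real⟩

theorem KeepList.setN (h : KeepList n N E s s') {a : ℕ} (v : ℕ)
    (ha : a < N ∨ a = 57 ∨ a = 58 ∨ E ≤ a ∧ 100 ≤ a) : KeepList n N E s (s'.setN a v) :=
  ⟨h.seen, fun b h1 h2 h3 h4 => by
    rw [State.setN_nat, if_neg (by omega)]; exact h.nat b h1 h2 h3 h4, h.real⟩

theorem Keep.keepList {M : ℕ} (h : Keep n N M s s') (hM : M ≤ 6) : KeepList n N E s s' :=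
  ⟨h.seen, fun a h1 _ _ h4 => h.nat a h1 (by omega), fun a h1 => h.real a (hM.trans h1)⟩

theorem mul_add_lt_mul {q i l n : ℕ} (hq : q < l) (hi : i < n) : q * n + i < l * n := by
  have : (q + 1) * n ≤ l * n := Nat.mul_le_mul_right n hq
  rw [Nat.succ_mul] at this
  omega

theorem Samples.keepList (h : Samples ω m s) (hk : KeepList n N E s s') (hN : N ≤ 50)
    (hE : 100 + n + m * n ≤ E) : Samples ω m s' where
  dim := (hk.nat 50 hN (by omega) (by omega) (by omega)).trans h.dim
  size := (hk.nat 55 (by omega) (by omega) (by omega) (by omega)).trans h.size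
  seen := by rw [hk.seen]; exact h.seen
  point j hj := by
    rw [← h.point j hj]
    refine readPoint_congr fun i hi => hk.nat _ (by omega) (by omega) (by omega) (Or.inr ⟨by omega, ?_⟩)
    have := mul_add_lt_mul hj hi
    omega

theorem wp_copyProg (hn : s.nat 50 = n) (h25 : 100 + n ≤ s.nat 25)
    (h58 : s.nat 25 + n ≤ s.nat 58) :
    WP f ω r copyProg s (30 * (n + 1)) fun s' => KeepList n 6 (s.nat 58) s s' ∧
      s'.nat 58 = s.nat 58 ∧ s'.nat 57 = s.nat 57 ∧
      ∀ k < n, s'.nat (s.nat 58 + k) = s.nat (s.nat 25 + k) := by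
  let Inv : ℕ → State → Prop := fun i s' => KeepList n 6 (s.nat 58) s s' ∧
      s'.nat 58 = s.nat 58 ∧ s'.nat 57 = s.nat 57 ∧
      ∀ k < i, s'.nat (s.nat 58 + k) = s.nat (s.nat 25 + k)
  refine WP.mono (WP.forLoop (c := 12) n Inv ?_ ?_ ?_) ?_ fun _ h => h.1
  · exact ⟨KeepList.refl.setN _ (by omega), by simp, by simp, by simp⟩
  · rintro i hi s' ⟨h1, -⟩
    simp [NatExpr.eval, h1.nat 50 (by omega) (by omega) (by omega) (by omega), hn]
  · rintro i hi s' ⟨h1, h2, h3, h4⟩ h5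
    have e25 : s'.nat 25 = s.nat 25 := h1.nat 25 (by omega) (by omega) (by omega) (by omega)
    refine WP.mono (WP.setNat ?_) (by simp [NatExpr.cost]) fun _ h => h
    simp only [NatExpr.eval, h2, h5, e25]
    refine ⟨by simp (disch := omega) [h5], (h1.setN _ (by omega)).setN _ (by omega),
      by simp (disch := omega) [h2], by simp (disch := omega) [h3], ?_⟩
    intro k hk
    rw [State.setN_nat_ne _ _ (by omega)]
    by_cases hki : k = i
    · subst hki
      rw [State.setN_nat_self]
      exact h1.nat _ (by omega) (by omega) (by omega) (by omega)
    · rw [State.setN_nat_ne _ _ (by omega)]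
      exact h4 k (by omega)
  · simp only [NatExpr.cost]; omega

/-- The candidate is written into the free space behind the list and accepted by advancing the end
of the list; a rejected one is simply overwritten later. Its size is tested before any query is
made, so all queries have radius at most `d ≤ r`, for every sample. -/
theorem wp_tryProg {c : Finset (Fin n) → ℝ} {d a q : ℕ} {v cap : ℝ} (hcap : 0 ≤ cap)
    [DecidablePred (PassTest c m ω d v)] {L : List (Finset (Fin n))} {i : Fin n}
    (hs : Samples ω m s) (ha : 100 + n + m * n ≤ a) (hL : Listed n a L s) (hd : s.nat 52 = d)
    (hr : (d : ℝ) ≤ r) (hv : s.real 52 = v) (hc : s.real 53 = cap) (hq : q < L.length)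
    (h25 : s.nat 25 = a + q * n) (h26 : s.nat 26 = i) :
    WP (multilinear c) ω r tryProg s (600 * (m + 1) * (n + 1) * (2 ^ d) ^ 2) fun s' =>
      KeepList n 25 (a + L.length * n) s s' ∧
      Listed n a (tryAdd (PassTest c m ω d v) ⌊cap⌋₊ i L (L.getD q ∅)) s' := by
  set S := L.getD q ∅ with hS
  set E := a + L.length * n with hE
  have hqE : a + q * n + n ≤ E := by
    have : (q + 1) * n ≤ L.length * n := Nat.mul_le_mul_right n hq
    rw [Nat.succ_mul] at this; omega
  have hin : i.val < n := i.2
  have h58 : s.nat 58 = E := hL.finish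
  refine WP.mono (WP.seq (b₂ := 300 * (m + 1) * (n + 1) * (2 ^ d) ^ 2 + 60 * (n + 1) + 80)
    ((wp_copyProg hs.dim (by omega) (by omega)).mono le_rfl ?_)) ?_ fun _ h => h
  · rw [h58]
    rintro s₁ ⟨k1, k58, k57, kc⟩
    have e26 : s₁.nat 26 = i := (k1.nat 26 (by omega) (by omega) (by omega) (by omega)).trans h26
    -- the state in which the candidate is complete
    set s₂ := (s₁.setN (E + i) 1).setN 20 E with hs₂
    have k2 : KeepList n 21 E s s₂ := ((k1.mono (by omega) le_rfl).setN _ (by omega)).setN _ (by omega)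
    have hs2 : Samples ω m s₂ := hs.keepList k2 (by omega) (by omega)
    have e58 : s₂.nat 58 = E := by
      rw [hs₂]; simp (disch := omega) [k58]
    have e57 : s₂.nat 57 = L.length := by
      rw [hs₂]; simp (disch := omega) [k57, hL.len]
    have e20 : s₂.nat 20 = E := by rw [hs₂]; simp
    have eset : setAt n s₂ E = insert i S := by
      ext j
      rw [mem_setAt, Finset.mem_insert, hs₂, State.setN_nat_ne _ _ (by omega)]
      by_cases hj : j = i
      · subst hj; simp
      · have hj' : j.val ≠ i.val := fun h => hj (Fin.ext h)
        rw [State.setN_nat_ne _ _ (by omega), kc j j.2, h25, ← mem_setAt, hL.sets q hq]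
        simp [hj, hS]
    have hsets : ∀ s₃ : State, KeepList n 25 E s s₃ → ∀ p < L.length,
        setAt n s₃ (a + p * n) = L.getD p ∅ := by
      intro s₃ k3 p hp
      rw [← hL.sets p hp]
      refine setAt_congr fun l hl => k3.nat _ (by omega) (by omega) (by omega) (Or.inr ⟨by omega, ?_⟩)
      have := mul_add_lt_mul hp hl
      omega
    refine WP.mono (WP.seq (WP.setNat (WP.seq (WP.setNat (WP.seq (b₁ := 60 * (n + 1))
      (b₂ := 300 * (m + 1) * (n + 1) * (2 ^ d) ^ 2 + 60) ?_))))) ?_ fun _ h => h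
    · have : (s₁.setN (NatExpr.eval s₁ ((reg 58).add (reg 26))) (NatExpr.eval s₁ (NatExpr.const 1))).setN
        (NatExpr.eval (s₁.setN (NatExpr.eval s₁ ((reg 58).add (reg 26))) (NatExpr.eval s₁ (NatExpr.const 1)))
          (NatExpr.const 20))
        (NatExpr.eval (s₁.setN (NatExpr.eval s₁ ((reg 58).add (reg 26))) (NatExpr.eval s₁ (NatExpr.const 1)))
          (reg 58)) = s₂ := by
        simp (disch := omega) [NatExpr.eval, k58, e26, hs₂]
      rw [this]
      refine (wp_sizeProg (S := insert i S) hs2.dim (by omega) (by rw [e20, eset])).mono le_rfl ?_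
      rintro s₃ ⟨g1, g11, g12⟩
      have k3 : KeepList n 21 E s s₃ := k2.trans ((g1.mono (by omega) le_rfl).keepList (by omega))
      have hs3 : Samples ω m s₃ := hs2.keep g1 (by omega)
      have f58 : s₃.nat 58 = E := (g1.nat 58 (by omega) (by omega)).trans e58
      have f57 : s₃.nat 57 = L.length := (g1.nat 57 (by omega) (by omega)).trans e57
      have f20 : s₃.nat 20 = E := (g1.nat 20 (by omega) (by omega)).trans e20
      have f52 : s₃.nat 52 = d :=
        (k3.nat 52 (by omega) (by omega) (by omega) (by omega)).trans hd
      have f56 : s₃.nat 56 = a :=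
        (k3.nat 56 (by omega) (by omega) (by omega) (by omega)).trans hL.base
      have fset : setAt n s₃ E = insert i S := by rw [g1.setAt (by omega) (by omega), eset]
      refine WP.mono (WP.ite (b := 300 * (m + 1) * (n + 1) * (2 ^ d) ^ 2 + 40) (fun ht => ?_)
        fun ht => ?_) ?_ fun _ h => h
      · simp only [Test.holds, NatExpr.eval, RealExpr.eval, g12, f52, f57] at ht
        obtain ⟨ht1, ht2⟩ := ht
        -- The program compares `length + 1` with the real number `cap`; this is equivalent to the
        -- comparison with the floor and needs no rounding.
        have hlen : L.length < ⌊cap⌋₊ := by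
          rw [k3.real 53 (by omega), hc] at ht2
          exact Nat.lt_of_succ_le (Nat.le_floor (by simpa using ht2))
        refine WP.mono (WP.seq (b₂ := 40) ((wp_countProg (c := c) (S := insert i S) hs3 (by omega)
          (by rw [f20, fset]) ?_ g11).mono (b' := 300 * (m + 1) * (n + 1) * (2 ^ d) ^ 2) ?_ ?_)) le_rfl
          fun _ h => h
        · exact le_trans (by exact_mod_cast ht1) hr
        · gcongr
          norm_num
        · rintro s₄ ⟨g2, g24⟩
          have k4 : KeepList n 25 E s s₄ :=
            (k3.mono (by omega) le_rfl).trans (g2.keepList (by omega))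
          have hs4 : Samples ω m s₄ := hs3.keep g2 (by omega)
          have h58' : s₄.nat 58 = E := (g2.nat 58 (by omega) (by omega)).trans f58
          have h57' : s₄.nat 57 = L.length := (g2.nat 57 (by omega) (by omega)).trans f57
          have h56' : s₄.nat 56 = a := (g2.nat 56 (by omega) (by omega)).trans f56
          have hset' : setAt n s₄ E = insert i S := by rw [g2.setAt (by omega) (by omega), fset]
          have hpass : PassTest c m ω d v (insert i S) ↔
              (m : ℝ) ≤ (v + v) * hits c m ω (insert i S) := by
            unfold PassTest
            rw [two_mul]
            exact and_iff_right ht1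
          refine WP.mono (WP.ite (b := 20) (fun ht => ?_) fun ht => ?_) ?_ fun _ h => h
          · have hp : PassTest c m ω d v (insert i S) := by
              simp only [Test.holds, NatExpr.eval, RealExpr.eval, g24, hs4.size,
                k4.real 52 (by omega), hv] at ht
              exact hpass.2 ht
            refine WP.mono (WP.seq (WP.setNat (WP.setNat ?_))) (by simp [NatExpr.cost]) fun _ h => h
            simp (disch := omega) only [NatExpr.eval, h58', h57', hs4.dim, State.setN_nat_ne]
            have k5 : KeepList n 25 E s ((s₄.setN 58 (E + n)).setN 57 (L.length + 1)) :=
              (k4.setN _ (by omega)).setN _ (by omega)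
            refine ⟨k5, ?_⟩
            rw [tryAdd, if_pos ⟨hp, hlen⟩]
            refine ⟨by simp [h56'], by simp, by simp [hE]; ring, fun p hp' => ?_⟩
            rw [List.length_append, List.length_singleton] at hp'
            by_cases hpl : p < L.length
            · rw [hsets _ k5 p hpl, List.getD_append _ _ _ _ hpl]
            · have : p = L.length := by omega
              subst this
              rw [← hE, List.getD_append_right _ _ _ _ le_rfl]
              simp only [Nat.sub_self, List.getD_cons_zero]
              rw [← hset']
              exact setAt_congr fun l hl => by simp (disch := omega)
          · have hp : ¬ PassTest c m ω d v (insert i S) := by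
              simp only [Test.holds, NatExpr.eval, RealExpr.eval, g24, hs4.size,
                k4.real 52 (by omega), hv] at ht
              exact fun h => ht (hpass.1 h)
            refine WP.mono (WP.skip ?_) (by omega) fun _ h => h
            rw [tryAdd, if_neg fun h => hp h.1]
            exact ⟨k4, h56', h57', h58', hsets _ k4⟩
          · simp [Test.cost, NatExpr.cost, RealExpr.cost]
      · have hno : ¬ (PassTest c m ω d v (insert i S) ∧ L.length < ⌊cap⌋₊) := by
          rintro ⟨h1, h2⟩
          apply ht
          simp only [Test.holds, NatExpr.eval, RealExpr.eval, g12, f52, f57]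
          refine ⟨h1.1, ?_⟩
          rw [k3.real 53 (by omega), hc]
          exact (Nat.le_floor_iff hcap).1 h2
        refine WP.mono (WP.skip ?_) (by omega) fun _ h => h
        rw [tryAdd, if_neg hno]
        have k4 : KeepList n 25 E s s₃ := k3.mono (by omega) le_rfl
        exact ⟨k4, f56, f57, f58, hsets _ k4⟩
      · simp [Test.cost, NatExpr.cost, RealExpr.cost]; omega
    · simp [NatExpr.cost]; omega
  · have : 1 ≤ (2 ^ d) ^ 2 := Nat.one_le_pow _ _ (by positivity)
    generalize (2 ^ d) ^ 2 = u at this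
    have h1 : (n + 1) * 1 ≤ (n + 1) * u := Nat.mul_le_mul_left _ this
    have h2 : 1 * ((n + 1) * u) ≤ (m + 1) * ((n + 1) * u) := Nat.mul_le_mul_right _ (by omega)
    have h3 : 300 * (m + 1) * (n + 1) * u = 300 * ((m + 1) * ((n + 1) * u)) := by ring
    have h4 : 600 * (m + 1) * (n + 1) * u = 600 * ((m + 1) * ((n + 1) * u)) := by ring
    omega

/-- The zero cells demanded by `h0` are the initial entry, the empty set. Within a stage, cell `27`
freezes the old length, so that sets appended during the stage are not extended by the same variable
again. -/
theorem wp_buildProg {c : Finset (Fin n) → ℝ} {d a : ℕ} {v cap : ℝ} (hcap : 1 ≤ cap)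
    [DecidablePred (PassTest c m ω d v)] (hs : Samples ω m s) (ha : 100 + n + m * n ≤ a)
    (h56 : s.nat 56 = a) (hd : s.nat 52 = d) (hr : (d : ℝ) ≤ r) (hv : s.real 52 = v)
    (hc : s.real 53 = cap) (h0 : ∀ k < n, s.nat (a + k) = 0) :
    WP (multilinear c) ω r buildProg s
      (1200 * (m + 1) * (n + 1) ^ 2 * (2 ^ d) ^ 2 * (⌊cap⌋₊ + 1)) fun s' =>
      KeepList n 29 a s s' ∧ Listed n a (candidates (PassTest c m ω d v) ⌊cap⌋₊ n) s' := by
  have hcap1 : 1 ≤ ⌊cap⌋₊ := Nat.le_floor (by simpa using hcap)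
  set K := ⌊cap⌋₊ with hK
  set TC := 600 * (m + 1) * (n + 1) * (2 ^ d) ^ 2 with hTC
  let Inv : ℕ → State → Prop := fun k s' => KeepList n 29 a s s' ∧ Listed n a (candidates (PassTest c m ω d v) K k) s'
  refine WP.mono (WP.seq (WP.setNat (WP.seq (WP.setNat ((WP.forLoop
    (c := (K + 1) * (TC + 30)) n Inv ?_ ?_ ?_).mono le_rfl ?_))))) ?_ (fun _ h => h)
  · simp (disch := omega) only [NatExpr.eval, State.setN_nat_ne, h56, hs.dim]
    refine ⟨((KeepList.refl.setN _ (by omega)).setN _ (by omega)).setN _ (by omega), ?_⟩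
    have e0 : candidates (PassTest c m ω d v) K 0 = [∅] := by simp [candidates]
    rw [e0]
    refine ⟨by simp [h56], by simp, by simp, fun q hq => ?_⟩
    have : q = 0 := by simpa using hq
    subst this
    ext k
    have hk := k.2
    rw [mem_setAt]
    simp (disch := omega) [h0 k hk]
  · rintro k hk s' ⟨h1, -⟩
    simp [NatExpr.eval, (hs.keepList h1 (by omega) ha).dim]
  · rintro k hk s' ⟨h1, h2⟩ h26
    set L := candidates (PassTest c m ω d v) K k with hL
    have hLK : L.length ≤ K := length_candidates_le hcap1 k
    let Inv' : ℕ → State → Prop := fun j s₁ => KeepList n 29 a s s₁ ∧ s₁.nat 26 = k ∧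
      s₁.nat 27 = L.length ∧ s₁.nat 25 = a + j * n ∧
      Listed n a ((L.take j).foldl (tryAdd (PassTest c m ω d v) K ⟨k, hk⟩) L) s₁
    refine WP.mono (WP.seq (WP.setNat (WP.seq (WP.setNat ((WP.forLoop
      (c := TC + 7) L.length Inv' ?_ ?_ ?_).mono le_rfl ?_))))) ?_ (fun _ h => h)
    · simp (disch := omega) only [NatExpr.eval, State.setN_nat_ne, h2.base, h2.len]
      refine ⟨((h1.setN _ (by omega)).setN _ (by omega)).setN _ (by omega), by simp [h26], by simp,
        by simp, ?_⟩
      rw [List.take_zero, List.foldl_nil]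
      refine ⟨by simp [h2.base], by simp [h2.len], by simp [h2.finish], fun q hq => ?_⟩
      rw [← h2.sets q hq]
      exact setAt_congr fun l _ => by simp (disch := omega)
    · rintro j hj s₁ ⟨-, -, g27, -⟩
      simp [NatExpr.eval, g27]
    · rintro j hj s₁ ⟨g1, g26, g27, g25, gL⟩ g28
      -- The list being extended is also the one being read; since it only grows at the end, its
      -- entry number `j` is still that of `L`.
      obtain ⟨l, hl⟩ := foldl_tryAdd_eq_append (pass := PassTest c m ω d v) (cap := K) ⟨k, hk⟩ (L.take j) L
      have hs1 := hs.keepList g1 (by omega) ha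
      have hget : ((L.take j).foldl (tryAdd (PassTest c m ω d v) K ⟨k, hk⟩) L).getD j ∅ = L.getD j ∅ := by
        rw [hl, List.getD_append _ _ _ _ hj]
      have hnext : (L.take (j + 1)).foldl (tryAdd (PassTest c m ω d v) K ⟨k, hk⟩) L
          = tryAdd (PassTest c m ω d v) K ⟨k, hk⟩ ((L.take j).foldl (tryAdd (PassTest c m ω d v) K ⟨k, hk⟩) L) (L.getD j ∅) := by
        rw [List.take_succ_eq_append_getElem hj, List.foldl_append]
        rw [List.getD_eq_getElem _ _ hj]
        rfl
      refine WP.mono (WP.seq (b₂ := 7) ((wp_tryProg (c := c) (d := d) (a := a) (q := j) (v := v)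
        (cap := cap) (L := (L.take j).foldl (tryAdd (PassTest c m ω d v) K ⟨k, hk⟩) L) (i := ⟨k, hk⟩) (by linarith)
        hs1 ha gL ?_ hr ?_ ?_ ?_ g25 g26).mono le_rfl ?_)) le_rfl fun _ h => h
      · rw [g1.nat 52 (by omega) (by omega) (by omega) (by omega), hd]
      · rw [g1.real 52 (by omega), hv]
      · rw [g1.real 53 (by omega), hc]
      · rw [hl, List.length_append]; omega
      · rintro s₂ ⟨q1, q2⟩
        rw [hget, ← hnext] at q2
        have q3 : KeepList n 25 a s₁ s₂ := q1.mono le_rfl (by omega)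
        refine WP.mono (WP.setNat ?_) (by simp [NatExpr.cost]) fun _ h => h
        have e25 : s₂.nat 25 = a + j * n :=
          (q3.nat 25 (by omega) (by omega) (by omega) (by omega)).trans g25
        have e26 : s₂.nat 26 = k :=
          (q3.nat 26 (by omega) (by omega) (by omega) (by omega)).trans g26
        have e27 : s₂.nat 27 = L.length :=
          (q3.nat 27 (by omega) (by omega) (by omega) (by omega)).trans g27
        have e28 : s₂.nat 28 = j :=
          (q3.nat 28 (by omega) (by omega) (by omega) (by omega)).trans g28
        have e50 : s₂.nat 50 = n := (hs1.keepList q3 (by omega) ha).dim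
        simp only [NatExpr.eval, e25, e50]
        refine ⟨by simp [e28], ((g1.trans (q3.mono (by omega) le_rfl)).setN _ (by omega)).setN _
          (by omega), by simp [e26], by simp [e27], by simp; ring, ?_⟩
        refine ⟨by simp [q2.base], by simp [q2.len], by simp [q2.finish], fun q hq => ?_⟩
        rw [← q2.sets q hq]
        exact setAt_congr fun l _ => by simp (disch := omega)
    · rintro s₁ ⟨⟨g1, g26, -, -, gL⟩, -⟩
      rw [List.take_length] at gL
      refine ⟨g26, g1.setN _ (by omega), ?_⟩
      rw [candidates_succ hk]
      refine ⟨by simp [gL.base], by simp [gL.len, stage, hL], by simp [gL.finish, stage, hL],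
        fun q hq => ?_⟩
      refine Eq.trans ?_ (gL.sets q hq)
      exact setAt_congr fun l _ => by simp (disch := omega)
    · simp only [NatExpr.cost]
      have : L.length * (TC + 7 + (1 + 1) + 10) ≤ K * (TC + 30) := Nat.mul_le_mul hLK (by omega)
      rw [Nat.succ_mul]
      omega
  · rintro s' ⟨⟨h1, h2⟩, -⟩
    exact ⟨h1, h2⟩
  · simp only [NatExpr.cost]
    have h1 : 600 ≤ TC := by
      rw [hTC]
      have : 1 ≤ (m + 1) * (n + 1) * (2 ^ d) ^ 2 := Nat.one_le_iff_ne_zero.2 (by positivity)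
      calc 600 ≤ 600 * ((m + 1) * (n + 1) * (2 ^ d) ^ 2) := by omega
        _ = _ := by ring
    have h2 : 1200 * (m + 1) * (n + 1) ^ 2 * (2 ^ d) ^ 2 * (K + 1) = (n + 1) * ((K + 1) * (2 * TC)) := by
      rw [hTC]; ring
    rw [h2]
    have h3 : (K + 1) * (TC + 30) + 12 + 30 ≤ (K + 1) * (2 * TC) := by nlinarith
    have h4 := Nat.mul_le_mul_left (n + 1) h3
    have h5 : (n + 1) * ((K + 1) * (TC + 30) + 12 + 30)
      = n * ((K + 1) * (TC + 30) + (1 + 1) + 10) + n * 30 + ((K + 1) * (TC + 30) + 42) := by ring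
    omega

end ListPrograms

end LocalMQ

namespace LocalMQ

/-! ### Programs for the gradient descent -/

/-- The real cell `3` receives the value of the monomial `nat 20` at the point `nat 21`. -/
def monoProg : Program :=
  .seq (.setReal (.const 3) (.ofNat (.const 1))) <|
  forLoop 5 (reg 50) <|
    .ite (.and (.natLE (.const 1) (.load (.add (reg 20) (reg 5))))
        (.natLE (.load (.add (reg 21) (reg 5))) (.const 0)))
      (.setReal (.const 3) (.ofNat (.const 0))) .skip

/-- Compute the residual at the example number `nat 22`, which is at `nat 21`. -/
def predictProg : Program :=
  .seq (.setReal (.const 6) (.load (.add (.const 100) (reg 22)))) <|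
  .seq (.setNat (.const 20) (reg 56)) <|
  .seq (forLoop 19 (reg 57) <|
    .seq monoProg <|
    .seq (.setReal (.const 6) (.sub (rreg 6) (.mul (.load (.add (reg 54) (reg 19))) (rreg 3)))) <|
    .setNat (.const 20) (.add (reg 20) (reg 50))) <|
  .setReal (.add (reg 53) (reg 22)) (rreg 6)

/-- Compute all residuals. -/
def residProg : Program :=
  .seq (.setNat (.const 21) (.add (.const 100) (reg 50))) <|
  forLoop 22 (reg 55) <|
    .seq predictProg <|
    .setNat (.const 21) (.add (reg 21) (reg 50))

/-- Update the coefficient number `nat 24`, whose set is at `nat 20`. -/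
def gradProg : Program :=
  .seq (.setReal (.const 6) (.ofNat (.const 0))) <|
  .seq (.setNat (.const 21) (.add (.const 100) (reg 50))) <|
  .seq (forLoop 22 (reg 55) <|
    .seq monoProg <|
    .seq (.setReal (.const 6) (.add (rreg 6) (.mul (.load (.add (reg 53) (reg 22))) (rreg 3)))) <|
    .setNat (.const 21) (.add (reg 21) (reg 50))) <|
  .setReal (.add (reg 54) (reg 24)) (.add (.load (.add (reg 54) (reg 24))) (.mul (rreg 56) (rreg 6)))

/-- Update all coefficients. -/
def updateProg : Program :=
  .seq (.setNat (.const 20) (reg 56)) <|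
  forLoop 24 (reg 57) <|
    .seq gradProg <|
    .setNat (.const 20) (.add (reg 20) (reg 50))

/-- Gradient descent; the number of rounds is the real cell `55`, rounded up. -/
def descentProg : Program :=
  .seq (.setNat (.const 28) (.const 0)) <|
  .while (.not (.realLE (rreg 55) (.ofNat (reg 28)))) <|
    .seq residProg <|
    .seq updateProg <|
    .setNat (.const 28) (.add (reg 28) (.const 1))

/-- Nothing is changed, except for the natural cells below `N`, the working point, the real cells
below `10` and the real cells `lo, …, hi - 1`. -/
structure KeepFit (n N lo hi : ℕ) (s s' : State) : Prop where
  seen : s'.seen = s.seen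
  nat : ∀ a, N ≤ a → (a < 100 ∨ 100 + n ≤ a) → s'.nat a = s.nat a
  real : ∀ a, 10 ≤ a → (a < lo ∨ hi ≤ a) → s'.real a = s.real a

/-- The memory holds the examples, the labels `y`, the list `L` and the step size `σ`; the
residuals start at `100 + m` and the coefficients at `100 + m + m`. -/
structure Fitting {n : ℕ} (ω : ℕ → Cube n) (m a : ℕ) (L : List (Finset (Fin n))) (y : ℕ → ℝ)
    (σ : ℝ) (s : State) : Prop where
  samples : Samples ω m s
  listed : Listed n a L s
  high : 100 + n ≤ a
  labels : ∀ j < m, s.real (100 + j) = y j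
  step : s.real 56 = σ
  resBase : s.nat 53 = 100 + m
  coefBase : s.nat 54 = 100 + m + m

section DescentPrograms

variable {n : ℕ} {f : Cube n → ℝ} {ω : ℕ → Cube n} {r : ℝ} {s s' s'' : State} {m N lo hi : ℕ}

theorem KeepFit.refl : KeepFit n N lo hi s s := ⟨rfl, fun _ _ _ => rfl, fun _ _ _ => rfl⟩

theorem KeepFit.trans (h : KeepFit n N lo hi s s') (h' : KeepFit n N lo hi s' s'') :
    KeepFit n N lo hi s s'' :=
  ⟨h'.seen.trans h.seen, fun a h1 h2 => (h'.nat a h1 h2).trans (h.nat a h1 h2),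
    fun a h1 h2 => (h'.real a h1 h2).trans (h.real a h1 h2)⟩

theorem KeepFit.mono {N' lo' hi' : ℕ} (h : KeepFit n N lo hi s s') (hN : N ≤ N') (hlo : lo' ≤ lo)
    (hhi : hi ≤ hi') : KeepFit n N' lo' hi' s s' :=
  ⟨h.seen, fun a h1 h2 => h.nat a (hN.trans h1) h2, fun a h1 h2 => h.real a h1 (by omega)⟩

theorem KeepFit.setN (h : KeepFit n N lo hi s s') {a : ℕ} (v : ℕ) (ha : a < N) :
    KeepFit n N lo hi s (s'.setN a v) :=
  ⟨h.seen, fun b h1 h2 => by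
    rw [State.setN_nat, if_neg (by omega)]; exact h.nat b h1 h2, h.real⟩

theorem KeepFit.setR (h : KeepFit n N lo hi s s') {a : ℕ} (v : ℝ)
    (ha : a < 10 ∨ lo ≤ a ∧ a < hi) : KeepFit n N lo hi s (s'.setR a v) :=
  ⟨h.seen, h.nat, fun b h1 h2 => by
    rw [State.setR_real, if_neg (by omega)]; exact h.real b h1 h2⟩

theorem Keep.keepFit {M : ℕ} (h : Keep n N M s s') (hM : M ≤ 10) : KeepFit n N lo hi s s' :=
  ⟨h.seen, h.nat, fun a h1 _ => h.real a (hM.trans h1)⟩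

theorem Fitting.keep {a : ℕ} {L : List (Finset (Fin n))} {y : ℕ → ℝ} {σ : ℝ}
    (h : Fitting ω m a L y σ s) (hk : KeepFit n N lo hi s s') (hN : N ≤ 50) (hlo : 100 + m ≤ lo) :
    Fitting ω m a L y σ s' where
  samples :=
    { dim := (hk.nat 50 hN (by omega)).trans h.samples.dim
      size := (hk.nat 55 (by omega) (by omega)).trans h.samples.size
      seen := by rw [hk.seen]; exact h.samples.seen
      point := fun j hj => by
        rw [← h.samples.point j hj]
        exact readPoint_congr fun i _ => hk.nat _ (by omega) (by omega) }
  listed :=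
    { base := (hk.nat 56 (by omega) (by omega)).trans h.listed.base
      len := (hk.nat 57 (by omega) (by omega)).trans h.listed.len
      finish := (hk.nat 58 (by omega) (by omega)).trans h.listed.finish
      sets := fun q hq => by
        rw [← h.listed.sets q hq]
        have := h.high
        exact setAt_congr fun i _ => hk.nat _ (by omega) (by omega) }
  high := h.high
  labels j hj := (hk.real _ (by omega) (by omega)).trans (h.labels j hj)
  step := (hk.real _ (by omega) (by omega)).trans h.step
  resBase := (hk.nat _ (by omega) (by omega)).trans h.resBase
  coefBase := (hk.nat _ (by omega) (by omega)).trans h.coefBase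

theorem wp_monoProg {S : Finset (Fin n)} {x : Cube n} (hn : s.nat 50 = n)
    (hp : 100 + n ≤ s.nat 20) (hq : 100 + n ≤ s.nat 21) (hS : setAt n s (s.nat 20) = S)
    (hx : s.readPoint n (s.nat 21) = x) :
    WP f ω r monoProg s (60 * (n + 1)) fun s' => Keep n 6 4 s s' ∧ s'.real 3 = monomial S x := by
  let Inv : ℕ → State → Prop := fun i s' => Keep n 6 4 s s' ∧
    s'.real 3 = monomial (S.filter fun k => k.val < i) x
  refine WP.mono (WP.seq (WP.setReal ((WP.forLoop (c := 25) n Inv ?_ ?_ ?_).mono le_rfl ?_))) ?_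
    (fun _ h => h)
  · simp only [NatExpr.eval, RealExpr.eval]
    exact ⟨(Keep.refl.setR _ (by omega)).setN _ (by omega), by simp [monomial]⟩
  · rintro i hi s' ⟨h1, -⟩
    simp [NatExpr.eval, h1.nat 50 (by omega) (by omega), hn]
  · rintro i hi s' ⟨h1, h2⟩ h3
    have e20 : s'.nat 20 = s.nat 20 := h1.nat 20 (by omega) (by omega)
    have e21 : s'.nat 21 = s.nat 21 := h1.nat 21 (by omega) (by omega)
    have eS : s'.nat (s.nat 20 + i) ≠ 0 ↔ (⟨i, hi⟩ : Fin n) ∈ S := by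
      rw [← hS, mem_setAt, h1.nat _ (by omega) (by omega)]
    have ex : s'.nat (s.nat 21 + i) ≠ 0 ↔ x ⟨i, hi⟩ = true := by
      rw [← hx, h1.nat _ (by omega) (by omega)]; simp [State.readPoint]
    have hnext : monomial (S.filter fun k => k.val < i + 1) x =
        if (⟨i, hi⟩ : Fin n) ∈ S ∧ ¬ x ⟨i, hi⟩ = true then 0
        else monomial (S.filter fun k => k.val < i) x := by
      rw [filter_val_lt_succ S hi]
      by_cases h4 : (⟨i, hi⟩ : Fin n) ∈ S
      · rw [if_pos h4, monomial, Finset.prod_insert (by simp)]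
        by_cases h5 : x ⟨i, hi⟩ = true <;> simp [h4, h5, monomial]
      · simp [h4]
    refine WP.mono (WP.ite (b := 4) (fun ht => ?_) fun ht => ?_) ?_ fun _ h => h
    · simp only [Test.holds, NatExpr.eval, e20, e21, h3] at ht
      refine WP.mono (WP.setReal ?_) (by simp [NatExpr.cost, RealExpr.cost]) fun _ h => h
      simp only [NatExpr.eval, RealExpr.eval]
      refine ⟨by simp [h3], (h1.setR _ (by omega)).setN _ (by omega), ?_⟩
      rw [hnext, if_pos ⟨eS.1 (by omega), fun h => ex.2 h (by omega)⟩]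
      simp
    · simp only [Test.holds, NatExpr.eval, e20, e21, h3] at ht
      refine WP.mono (WP.skip ?_) (by omega) fun _ h => h
      refine ⟨h3, h1.setN _ (by omega), ?_⟩
      rw [hnext, if_neg]
      · simpa using h2
      · rintro ⟨h4, h5⟩
        have := eS.2 h4
        have := mt ex.1 h5
        omega
    · simp [Test.cost, NatExpr.cost]
  · rintro s' ⟨⟨h1, h2⟩, -⟩
    have : S.filter (fun k => k.val < n) = S := Finset.filter_true_of_mem fun k _ => k.2
    rw [this] at h2
    exact ⟨h1, h2⟩
  · simp only [NatExpr.cost, RealExpr.cost]; omega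

variable {a : ℕ} {L : List (Finset (Fin n))} {y : ℕ → ℝ} {σ : ℝ} {ξ : ℕ → ℕ → ℝ} {A : ℕ → ℝ}

theorem wp_predictProg (hf : Fitting ω m a L y σ s)
    (hξ : ∀ q j, ξ q j = monomial (L.getD q ∅) (ω j))
    (hA : ∀ q < L.length, s.real (100 + m + m + q) = A q) {j : ℕ} (hj : j < m)
    (h22 : s.nat 22 = j) (h21 : s.nat 21 = 100 + n + j * n) :
    WP f ω r predictProg s (120 * (L.length + 1) * (n + 1)) fun s' =>
      KeepFit n 21 (100 + m + j) (100 + m + j + 1) s s' ∧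
      s'.real (100 + m + j) = resid L.length ξ y A j := by
  let Inv : ℕ → State → Prop := fun q s' => KeepFit n 21 (100 + m + j) (100 + m + j) s s' ∧
    s'.nat 20 = a + q * n ∧ s'.real 6 = y j - ∑ p ∈ Finset.range q, A p * ξ p j
  have hfk : ∀ {s'}, KeepFit n 21 (100 + m + j) (100 + m + j) s s' → Fitting ω m a L y σ s' :=
    fun h => hf.keep h (by omega) (by omega)
  have ha := hf.high
  refine WP.mono (WP.seq (WP.setReal (WP.seq (WP.setNat (WP.seq (b₂ := 10) ((WP.forLoop
    (c := 60 * (n + 1) + 21) L.length Inv ?_ ?_ ?_).mono le_rfl ?_)))))) ?_ (fun _ h => h)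
  · simp (disch := omega) only [NatExpr.eval, RealExpr.eval, State.setR_nat, hf.listed.base, h22]
    refine ⟨((KeepFit.refl.setR _ (by omega)).setN _ (by omega)).setN _ (by omega), by simp, ?_⟩
    simp [hf.labels j hj]
  · rintro q hq s' ⟨h1, -⟩
    simp [NatExpr.eval, (hfk h1).listed.len]
  · rintro q hq s' ⟨h1, h20, h6⟩ h19
    have hf' := hfk h1
    have e21 : s'.nat 21 = 100 + n + j * n := (h1.nat 21 (by omega) (by omega)).trans h21
    refine WP.mono (WP.seq (b₂ := 21) ((wp_monoProg (S := L.getD q ∅) (x := ω j) hf'.samples.dim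
      (by omega) (by omega) (by rw [h20, hf'.listed.sets q hq])
      (by rw [e21, hf'.samples.point j hj])).mono le_rfl ?_)) le_rfl fun _ h => h
    rintro s₁ ⟨g1, g3⟩
    have k1 : KeepFit n 21 (100 + m + j) (100 + m + j) s s₁ :=
      h1.trans ((g1.mono (by omega) le_rfl).keepFit (by omega))
    have e19 : s₁.nat 19 = q := (g1.nat 19 (by omega) (by omega)).trans h19
    have e20 : s₁.nat 20 = a + q * n := (g1.nat 20 (by omega) (by omega)).trans h20
    have eA : s₁.real (100 + m + m + q) = A q :=
      (k1.real _ (by omega) (by omega)).trans (hA q hq)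
    refine WP.mono (WP.seq (WP.setReal (WP.setNat ?_))) (by simp [NatExpr.cost, RealExpr.cost])
      fun _ h => h
    simp only [NatExpr.eval, RealExpr.eval, State.setR_nat, e19, e20, (hfk k1).coefBase,
      (hfk k1).samples.dim, eA, g3]
    refine ⟨by simp [e19], ((k1.setR _ (by omega)).setN _ (by omega)).setN _ (by omega),
      by simp; ring, ?_⟩
    simp [g1.real 6 (by omega), h6, Finset.sum_range_succ, hξ]
    ring
  · rintro s' ⟨⟨h1, -, h6⟩, -⟩
    have e22 : s'.nat 22 = j := (h1.nat 22 (by omega) (by omega)).trans h22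
    refine WP.mono (WP.setReal ?_) (by simp [NatExpr.cost, RealExpr.cost]) fun _ h => h
    simp only [NatExpr.eval, RealExpr.eval, e22, (hfk h1).resBase]
    exact ⟨(h1.mono le_rfl le_rfl (by omega)).setR _ (by omega), by simp [h6, resid]⟩
  · simp only [NatExpr.cost, RealExpr.cost]
    generalize L.length = K
    have e1 : K * (60 * (n + 1) + 21 + (1 + 1) + 10) = 60 * (K * n) + 93 * K := by ring
    have e2 : 120 * (K + 1) * (n + 1) = 120 * (K * n) + 120 * K + 120 * n + 120 := by ring
    omega

theorem wp_residProg (hf : Fitting ω m a L y σ s)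
    (hξ : ∀ q j, ξ q j = monomial (L.getD q ∅) (ω j))
    (hA : ∀ q < L.length, s.real (100 + m + m + q) = A q) :
    WP f ω r residProg s (160 * (m + 1) * (L.length + 1) * (n + 1)) fun s' =>
      KeepFit n 23 (100 + m) (100 + m + m) s s' ∧
      ∀ j < m, s'.real (100 + m + j) = resid L.length ξ y A j := by
  let Inv : ℕ → State → Prop := fun i s' => KeepFit n 23 (100 + m) (100 + m + m) s s' ∧
    s'.nat 21 = 100 + n + i * n ∧ ∀ j < i, s'.real (100 + m + j) = resid L.length ξ y A j
  have hfk : ∀ {s'}, KeepFit n 23 (100 + m) (100 + m + m) s s' → Fitting ω m a L y σ s' :=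
    fun h => hf.keep h (by omega) (by omega)
  refine WP.mono (WP.seq (WP.setNat ((WP.forLoop
    (c := 120 * (L.length + 1) * (n + 1) + 7) m Inv ?_ ?_ ?_).mono le_rfl ?_))) ?_ (fun _ h => h)
  · simp only [NatExpr.eval, hf.samples.dim]
    exact ⟨(KeepFit.refl.setN _ (by omega)).setN _ (by omega), by simp, by simp⟩
  · rintro i hi s' ⟨h1, -⟩
    simp [NatExpr.eval, (hfk h1).samples.size]
  · rintro i hi s' ⟨h1, h21, h⟩ h22
    refine WP.mono (WP.seq (b₂ := 7) ((wp_predictProg (A := A) (hfk h1) hξ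
      (fun q hq => (h1.real _ (by omega) (by omega)).trans (hA q hq)) hi h22 h21).mono le_rfl ?_))
      le_rfl fun _ h => h
    rintro s₁ ⟨g1, g2⟩
    have k1 : KeepFit n 23 (100 + m) (100 + m + m) s s₁ :=
      h1.trans (g1.mono (by omega) (by omega) (by omega))
    have e21 : s₁.nat 21 = 100 + n + i * n := (g1.nat 21 (by omega) (by omega)).trans h21
    have e22 : s₁.nat 22 = i := (g1.nat 22 (by omega) (by omega)).trans h22
    refine WP.mono (WP.setNat ?_) (by simp [NatExpr.cost]) fun _ h => h
    simp only [NatExpr.eval, e21, (hfk k1).samples.dim]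
    refine ⟨by simp [e22], (k1.setN _ (by omega)).setN _ (by omega), by simp; ring, fun j hj => ?_⟩
    simp only [State.setN_real]
    by_cases hji : j = i
    · rw [hji, g2]
    · rw [g1.real _ (by omega) (by omega), h j (by omega)]
  · rintro s' ⟨⟨h1, -, h⟩, -⟩
    exact ⟨h1, h⟩
  · simp only [NatExpr.cost]
    generalize hu : (L.length + 1) * (n + 1) = u
    have : 1 ≤ u := hu ▸ Nat.one_le_iff_ne_zero.2 (by positivity)
    have e1 : m * (120 * (L.length + 1) * (n + 1) + 7 + (1 + 1) + 10) = 120 * (m * u) + 19 * m := by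
      rw [← hu]; ring
    have e2 : 160 * (m + 1) * (L.length + 1) * (n + 1) = 160 * (m * u) + 160 * u := by
      rw [← hu]; ring
    have e3 : m * 1 ≤ m * u := Nat.mul_le_mul_left m this
    omega

theorem wp_gradProg (hf : Fitting ω m a L y σ s)
    (hξ : ∀ q j, ξ q j = monomial (L.getD q ∅) (ω j)) {ρ : ℕ → ℝ}
    (hρ : ∀ j < m, s.real (100 + m + j) = ρ j) {q : ℕ} (hq : q < L.length)
    (h24 : s.nat 24 = q) (h20 : s.nat 20 = a + q * n) :
    WP f ω r gradProg s (120 * (m + 1) * (n + 1)) fun s' =>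
      KeepFit n 23 (100 + m + m + q) (100 + m + m + q + 1) s s' ∧ s'.nat 20 = s.nat 20 ∧
      s'.real (100 + m + m + q)
        = s.real (100 + m + m + q) + σ * ∑ j ∈ Finset.range m, ρ j * ξ q j := by
  let Inv : ℕ → State → Prop := fun j s' =>
    KeepFit n 23 (100 + m + m + q) (100 + m + m + q) s s' ∧ s'.nat 20 = s.nat 20 ∧
    s'.nat 21 = 100 + n + j * n ∧ s'.real 6 = ∑ i ∈ Finset.range j, ρ i * ξ q i
  have hfk : ∀ {s'}, KeepFit n 23 (100 + m + m + q) (100 + m + m + q) s s' →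
      Fitting ω m a L y σ s' := fun h => hf.keep h (by omega) (by omega)
  have ha := hf.high
  refine WP.mono (WP.seq (WP.setReal (WP.seq (WP.setNat (WP.seq (b₂ := 20) ((WP.forLoop
    (c := 60 * (n + 1) + 21) m Inv ?_ ?_ ?_).mono le_rfl ?_)))))) ?_ (fun _ h => h)
  · simp only [NatExpr.eval, RealExpr.eval, State.setR_nat, hf.samples.dim]
    exact ⟨((KeepFit.refl.setR _ (by omega)).setN _ (by omega)).setN _ (by omega), by simp,
      by simp, by simp⟩
  · rintro j hj s' ⟨h1, -⟩
    simp [NatExpr.eval, (hfk h1).samples.size]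
  · rintro j hj s' ⟨h1, h20', h21, h6⟩ h22
    have hf' := hfk h1
    refine WP.mono (WP.seq (b₂ := 21) ((wp_monoProg (S := L.getD q ∅) (x := ω j) hf'.samples.dim
      (by omega) (by omega) (by rw [h20', h20, hf'.listed.sets q hq])
      (by rw [h21, hf'.samples.point j hj])).mono le_rfl ?_)) le_rfl fun _ h => h
    rintro s₁ ⟨g1, g3⟩
    have k1 : KeepFit n 23 (100 + m + m + q) (100 + m + m + q) s s₁ :=
      h1.trans ((g1.mono (by omega) le_rfl).keepFit (by omega))
    have e22 : s₁.nat 22 = j := (g1.nat 22 (by omega) (by omega)).trans h22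
    have e21 : s₁.nat 21 = 100 + n + j * n := (g1.nat 21 (by omega) (by omega)).trans h21
    have e20 : s₁.nat 20 = s.nat 20 := (g1.nat 20 (by omega) (by omega)).trans h20'
    have eρ : s₁.real (100 + m + j) = ρ j := (k1.real _ (by omega) (by omega)).trans (hρ j hj)
    refine WP.mono (WP.seq (WP.setReal (WP.setNat ?_))) (by simp [NatExpr.cost, RealExpr.cost])
      fun _ h => h
    simp only [NatExpr.eval, RealExpr.eval, State.setR_nat, e21, e22, (hfk k1).resBase,
      (hfk k1).samples.dim, eρ, g3]
    refine ⟨by simp [e22], ((k1.setR _ (by omega)).setN _ (by omega)).setN _ (by omega),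
      by simp [e20], by simp; ring, ?_⟩
    simp [g1.real 6 (by omega), h6, Finset.sum_range_succ, hξ]
  · rintro s' ⟨⟨h1, e20, -, h6⟩, -⟩
    have e24 : s'.nat 24 = q := (h1.nat 24 (by omega) (by omega)).trans h24
    refine WP.mono (WP.setReal ?_) (by simp [NatExpr.cost, RealExpr.cost]) fun _ h => h
    simp only [NatExpr.eval, RealExpr.eval, e24, (hfk h1).coefBase, (hfk h1).step]
    exact ⟨(h1.mono le_rfl le_rfl (by omega)).setR _ (by omega), by simp [e20],
      by simp [h6, h1.real (100 + m + m + q) (by omega) (by omega)]⟩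
  · simp only [NatExpr.cost, RealExpr.cost]
    have e1 : m * (60 * (n + 1) + 21 + (1 + 1) + 10) = 60 * (m * n) + 93 * m := by ring
    have e2 : 120 * (m + 1) * (n + 1) = 120 * (m * n) + 120 * m + 120 * n + 120 := by ring
    omega

/-- The residuals are stored before the update, so overwriting the coefficients one by one still
performs a simultaneous gradient step. The invariant separates coefficients already updated from old
ones. -/
theorem wp_updateProg (hf : Fitting ω m a L y σ s)
    (hξ : ∀ q j, ξ q j = monomial (L.getD q ∅) (ω j))
    (hA : ∀ q < L.length, s.real (100 + m + m + q) = A q)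
    (hR : ∀ j < m, s.real (100 + m + j) = resid L.length ξ y A j) :
    WP f ω r updateProg s (160 * (m + 1) * (L.length + 1) * (n + 1)) fun s' =>
      KeepFit n 25 (100 + m + m) (100 + m + m + L.length) s s' ∧
      ∀ q < L.length, s'.real (100 + m + m + q) = gdStep m L.length ξ y σ A q := by
  let Inv : ℕ → State → Prop := fun i s' =>
    KeepFit n 25 (100 + m + m) (100 + m + m + L.length) s s' ∧ s'.nat 20 = a + i * n ∧
    (∀ q < i, s'.real (100 + m + m + q) = gdStep m L.length ξ y σ A q) ∧
    ∀ q, i ≤ q → q < L.length → s'.real (100 + m + m + q) = A q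
  have hfk : ∀ {s'}, KeepFit n 25 (100 + m + m) (100 + m + m + L.length) s s' →
      Fitting ω m a L y σ s' := fun h => hf.keep h (by omega) (by omega)
  refine WP.mono (WP.seq (WP.setNat ((WP.forLoop
    (c := 120 * (m + 1) * (n + 1) + 7) L.length Inv ?_ ?_ ?_).mono le_rfl ?_))) ?_ (fun _ h => h)
  · simp only [NatExpr.eval, hf.listed.base]
    exact ⟨(KeepFit.refl.setN _ (by omega)).setN _ (by omega), by simp, by simp,
      fun q _ hq => by simp [hA q hq]⟩
  · rintro i hi s' ⟨h1, -⟩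
    simp [NatExpr.eval, (hfk h1).listed.len]
  · rintro i hi s' ⟨h1, h20, hnew, hold⟩ h24
    refine WP.mono (WP.seq (b₂ := 7) ((wp_gradProg (hfk h1) hξ
      (fun j hj => (h1.real _ (by omega) (by omega)).trans (hR j hj)) hi h24 h20).mono le_rfl ?_))
      le_rfl fun _ h => h
    rintro s₁ ⟨g1, g20, g2⟩
    have k1 : KeepFit n 25 (100 + m + m) (100 + m + m + L.length) s s₁ :=
      h1.trans (g1.mono (by omega) (by omega) (by omega))
    have e24 : s₁.nat 24 = i := (g1.nat 24 (by omega) (by omega)).trans h24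
    refine WP.mono (WP.setNat ?_) (by simp [NatExpr.cost]) fun _ h => h
    simp only [NatExpr.eval, g20, h20, (hfk k1).samples.dim]
    refine ⟨by simp [e24], (k1.setN _ (by omega)).setN _ (by omega), by simp; ring,
      fun q hq => ?_, fun q hq hqL => ?_⟩
    · simp only [State.setN_real]
      by_cases hqi : q = i
      · rw [hqi, g2, hold i le_rfl hi, gdStep]
      · rw [g1.real _ (by omega) (by omega), hnew q (by omega)]
    · simp only [State.setN_real]
      rw [g1.real _ (by omega) (by omega), hold q (by omega) hqL]
  · rintro s' ⟨⟨h1, -, h, -⟩, -⟩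
    exact ⟨h1, h⟩
  · simp only [NatExpr.cost]
    generalize hu : (m + 1) * (n + 1) = u
    have : 1 ≤ u := hu ▸ Nat.one_le_iff_ne_zero.2 (by positivity)
    generalize L.length = K
    have e1 : K * (120 * (m + 1) * (n + 1) + 7 + (1 + 1) + 10) = 120 * (K * u) + 19 * K := by
      rw [← hu]; ring
    have e2 : 160 * (m + 1) * (K + 1) * (n + 1) = 160 * (K * u) + 160 * u := by
      rw [← hu]; ring
    have e3 : K * 1 ≤ K * u := Nat.mul_le_mul_left K this
    omega

theorem wp_descentProg (hf : Fitting ω m a L y σ s)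
    (hξ : ∀ q j, ξ q j = monomial (L.getD q ∅) (ω j))
    (h0 : ∀ q < L.length, s.real (100 + m + m + q) = 0) {T : ℝ} (hT : s.real 55 = T) :
    WP f ω r descentProg s (400 * (⌈T⌉₊ + 1) * (m + 1) * (L.length + 1) * (n + 1)) fun s' =>
      Fitting ω m a L y σ s' ∧
      ∀ q < L.length, s'.real (100 + m + m + q) = gdIter m L.length ξ y σ ⌈T⌉₊ q := by
  let Inv : ℕ → State → Prop := fun i s' =>
    KeepFit n 29 (100 + m) (100 + m + m + L.length) s s' ∧ s'.nat 28 = i ∧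
    ∀ q < L.length, s'.real (100 + m + m + q) = gdIter m L.length ξ y σ i q
  have hfk : ∀ {s'}, KeepFit n 29 (100 + m) (100 + m + m + L.length) s s' →
      Fitting ω m a L y σ s' := fun h => hf.keep h (by omega) (by omega)
  set c := 160 * (m + 1) * (L.length + 1) * (n + 1) with hc
  refine WP.mono (WP.seq (WP.setNat ((WP.while (c := c + (c + 6)) ⌈T⌉₊ Inv ?_ ?_ ?_).mono le_rfl
    ?_))) ?_ (fun _ h => h)
  · simp only [NatExpr.eval]
    exact ⟨KeepFit.refl.setN _ (by omega), by simp, fun q hq => by simp [gdIter, h0 q hq]⟩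
  · rintro i hi s' ⟨h1, h28, hq⟩
    refine ⟨?_, ?_⟩
    · simp only [Test.holds, RealExpr.eval, NatExpr.eval, h28, not_le]
      rw [h1.real 55 (by omega) (by omega), hT]
      -- Counting up while the counter is below the real `T` makes exactly `⌈T⌉₊` rounds, without
      -- rounding a real to a natural number.
      exact Nat.lt_ceil.1 hi
    · refine WP.seq (b₂ := c + 6) ((wp_residProg (hfk h1) hξ hq).mono le_rfl ?_)
      rintro s₁ ⟨g1, g2⟩
      have k1 : KeepFit n 29 (100 + m) (100 + m + m + L.length) s s₁ :=
        h1.trans (g1.mono (by omega) (by omega) (by omega))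
      refine WP.seq (b₂ := 6) ((wp_updateProg (hfk k1) hξ (fun q hq' =>
        (g1.real _ (by omega) (by omega)).trans (hq q hq')) g2).mono le_rfl ?_)
      rintro s₂ ⟨q1, q2⟩
      have k2 : KeepFit n 29 (100 + m) (100 + m + m + L.length) s s₂ :=
        k1.trans (q1.mono (by omega) (by omega) (by omega))
      have e28 : s₂.nat 28 = i := by
        rw [q1.nat 28 (by omega) (by omega), g1.nat 28 (by omega) (by omega), h28]
      refine WP.setNat ?_
      simp only [NatExpr.eval, e28]
      exact ⟨k2.setN _ (by omega), by simp, q2⟩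
  · rintro s' ⟨h1, h28, -⟩
    simp only [Test.holds, RealExpr.eval, NatExpr.eval, h28, not_not]
    rw [h1.real 55 (by omega) (by omega), hT]
    exact Nat.le_ceil T
  · rintro s' ⟨h1, -, hq⟩
    exact ⟨hfk h1, hq⟩
  · simp only [Test.cost, NatExpr.cost, RealExpr.cost]
    generalize ⌈T⌉₊ = N
    generalize hu : (m + 1) * (L.length + 1) * (n + 1) = u at hc
    have : 1 ≤ u := hu ▸ Nat.one_le_iff_ne_zero.2 (by positivity)
    have e0 : c = 160 * u := by rw [hc, ← hu]; ring
    have e1 : N * (1 + 1 + (1 + 1 + 1) + 1 + 1 + (c + (c + 6))) = 320 * (N * u) + 13 * N := by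
      rw [e0]; ring
    have e2 : 400 * (N + 1) * (m + 1) * (L.length + 1) * (n + 1) = 400 * (N * u) + 400 * u := by
      rw [← hu]; ring
    have e3 : N * 1 ≤ N * u := Nat.mul_le_mul_left N this
    omega

end DescentPrograms

end LocalMQ

namespace LocalMQ

/-! ### The learner -/

/-- The real cell `50` receives `max B 1`. -/
def scaleProg : Program :=
  .ite (.realLE (rreg 0) (.ofNat (.const 1))) (.setReal (.const 50) (.ofNat (.const 1)))
    (.setReal (.const 50) (rreg 0))

/-- Choose the degree `nat 52`; the real cell `52` receives the corresponding power of `1 + α`. -/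
def degreeProg : Program :=
  .seq (.setNat (.const 52) (.const 0)) <|
  .seq (.setReal (.const 52) (.ofNat (.const 1))) <|
  .seq (.setReal (.const 7) (.div (.mul (.mul (.ofNat (.const 16)) (.mul (.ofNat (reg 1))
    (.ofNat (reg 1)))) (.mul (rreg 50) (rreg 50))) (rreg 2))) <|
  .while (.not (.realLE (rreg 7) (.ofNat (.const 1)))) <|
    .seq (.setReal (.const 7) (.mul (rreg 7) (.div (rreg 1) (.add (.ofNat (.const 1)) (rreg 1))))) <|
    .seq (.setNat (.const 52) (.add (reg 52) (.const 1))) <|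
    .setReal (.const 52) (.mul (rreg 52) (.add (.ofNat (.const 1)) (rreg 1)))

/-- Multiply the real cell `52` with `1 + α`, once for each doubling that leads from `1` to `t`. -/
def levelProg : Program :=
  .seq (.setNat (.const 7) (.const 1)) <|
  .while (.not (.natLE (reg 1) (reg 7))) <|
    .seq (.setNat (.const 7) (.add (reg 7) (reg 7))) <|
    .setReal (.const 52) (.mul (rreg 52) (.add (.ofNat (.const 1)) (rreg 1)))

/-- Cell `8` receives the number of halvings that lead from `1` to `δ`. -/
def confidenceProg : Program :=
  .seq (.setNat (.const 8) (.const 0)) <|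
  .seq (.setReal (.const 7) (.ofNat (.const 1))) <|
  .while (.not (.realLE (rreg 7) (rreg 3))) <|
    .seq (.setReal (.const 7) (.div (rreg 7) (.ofNat (.const 2)))) <|
    .setNat (.const 8) (.add (reg 8) (.const 1))

/-- The capacity, the number of rounds and the number of examples go to the real cells `53`, `55`
and `54`. -/
def sizesProg : Program :=
  .seq (.setReal (.const 53) (.mul (.mul (.ofNat (.const 5)) (.ofNat (reg 1)))
    (.mul (rreg 52) (rreg 52)))) <|
  .seq (.setReal (.const 55) (.div (.mul (.mul (.mul (.ofNat (.const 16)) (.ofNat (reg 1)))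
    (.mul (rreg 50) (rreg 50))) (rreg 53)) (rreg 2))) <|
  .seq (.setReal (.const 7) (.div (rreg 2) (.mul (.mul (.mul (.ofNat (.const 16))
    (.mul (rreg 53) (rreg 53))) (.mul (.ofNat (reg 1)) (.ofNat (reg 1))))
    (.mul (rreg 50) (rreg 50))))) <|
  .setReal (.const 54) (.div (.ofNat (.add (.add (reg 50) (reg 8)) (.const 2)))
    (.mul (rreg 7) (rreg 7)))

/-- All parameters of the learner. -/
def setupProg : Program :=
  .seq (.setNat (.const 50) (reg 0)) <|
  .seq scaleProg <| .seq degreeProg <| .seq levelProg <| .seq confidenceProg sizesProg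

/-- Draw the examples. -/
def sampleProg : Program :=
  .seq (.setNat (.const 55) (.const 0)) <|
  .seq (.setNat (.const 56) (.add (.const 100) (reg 50))) <|
  .while (.not (.realLE (rreg 54) (.ofNat (reg 55)))) <|
    .seq (.example_ (reg 56) (.add (.const 100) (reg 55))) <|
    .seq (.setNat (.const 56) (.add (reg 56) (reg 50))) <|
    .setNat (.const 55) (.add (reg 55) (.const 1))

/-- Fix the memory layout and the step size of the gradient descent. -/
def layoutProg : Program :=
  .seq (.setNat (.const 53) (.add (.const 100) (reg 55))) <|
  .seq (.setNat (.const 54) (.add (reg 53) (reg 55))) <|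
  .setReal (.const 56) (.div (.ofNat (.const 1)) (.mul (.mul (.ofNat (.const 2)) (rreg 53))
    (.ofNat (reg 55))))

/-- Announce the list of terms. -/
def outputProg : Program :=
  .seq (.setNat (.const 0) (reg 57)) <|
  .seq (.setNat (.const 1) (reg 56)) <|
  .setNat (.const 2) (reg 54)

/-- The learner. -/
def learnProg : Program :=
  .seq setupProg <| .seq sampleProg <| .seq layoutProg <| .seq buildProg <|
    .seq descentProg outputProg

/-- The input, the dimension in cell `50`, the scale in the real cell `50` and the cells from `100`
on are unchanged. -/
structure KeepInput (s s' : State) : Prop where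
  seen : s'.seen = s.seen
  nat : ∀ a, (a < 2 ∨ a = 50 ∨ 100 ≤ a) → s'.nat a = s.nat a
  real : ∀ a, (a < 4 ∨ a = 50 ∨ 100 ≤ a) → s'.real a = s.real a

section Learner

variable {n : ℕ} {f : Cube n → ℝ} {ω : ℕ → Cube n} {r : ℝ} {s s' s'' : State}

theorem KeepInput.refl : KeepInput s s := ⟨rfl, fun _ _ => rfl, fun _ _ => rfl⟩

theorem KeepInput.trans (h : KeepInput s s') (h' : KeepInput s' s'') : KeepInput s s'' :=
  ⟨h'.seen.trans h.seen, fun a h1 => (h'.nat a h1).trans (h.nat a h1),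
    fun a h1 => (h'.real a h1).trans (h.real a h1)⟩

theorem KeepInput.setN (h : KeepInput s s') {a : ℕ} (v : ℕ) (ha : 2 ≤ a ∧ a ≠ 50 ∧ a < 100) :
    KeepInput s (s'.setN a v) :=
  ⟨h.seen, fun b h1 => by rw [State.setN_nat, if_neg (by omega)]; exact h.nat b h1, h.real⟩

theorem KeepInput.setR (h : KeepInput s s') {a : ℕ} (v : ℝ) (ha : 4 ≤ a ∧ a ≠ 50 ∧ a < 100) :
    KeepInput s (s'.setR a v) :=
  ⟨h.seen, h.nat, fun b h1 => by rw [State.setR_real, if_neg (by omega)]; exact h.real b h1⟩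

theorem wp_scaleProg : WP f ω r scaleProg s 10 fun s' => s' = s.setR 50 (max (s.real 0) 1) := by
  refine WP.mono (WP.ite (b := 4) (fun ht => ?_) fun ht => ?_) (by
    simp [Test.cost, RealExpr.cost, NatExpr.cost]) fun _ h => h
  · simp only [Test.holds, RealExpr.eval, NatExpr.eval, Nat.cast_one] at ht
    refine WP.mono (WP.setReal ?_) (by simp [RealExpr.cost, NatExpr.cost]) fun _ h => h
    simp [RealExpr.eval, NatExpr.eval, max_eq_right ht]
  · simp only [Test.holds, RealExpr.eval, NatExpr.eval, Nat.cast_one, not_le] at ht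
    refine WP.mono (WP.setReal ?_) (by simp [RealExpr.cost, NatExpr.cost]) fun _ h => h
    simp [RealExpr.eval, NatExpr.eval, max_eq_left ht.le]

theorem wp_degreeProg {t d : ℕ} {B α ε : ℝ} (ht : s.nat 1 = t) (hB : s.real 50 = B)
    (hα : s.real 1 = α) (hε : s.real 2 = ε)
    (hd : 16 * t ^ 2 * B ^ 2 / ε * (α / (1 + α)) ^ d ≤ 1)
    (hd' : ∀ i < d, 1 < 16 * t ^ 2 * B ^ 2 / ε * (α / (1 + α)) ^ i) :
    WP f ω r degreeProg s (40 * (d + 1)) fun s' =>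
      KeepInput s s' ∧ s'.nat 52 = d ∧ s'.real 52 = (1 + α) ^ d := by
  let Inv : ℕ → State → Prop := fun i s' => KeepInput s s' ∧ s'.nat 52 = i ∧
    s'.real 52 = (1 + α) ^ i ∧ s'.real 7 = 16 * t ^ 2 * B ^ 2 / ε * (α / (1 + α)) ^ i
  refine WP.mono (WP.seq (WP.setNat (WP.seq (WP.setReal (WP.seq (WP.setReal ((WP.while (c := 30) d
    Inv ?_ ?_ ?_).mono le_rfl ?_))))))) ?_ fun _ h => h
  · simp only [NatExpr.eval, RealExpr.eval]
    refine ⟨((KeepInput.refl.setN _ (by omega)).setR _ (by omega)).setR _ (by omega), by simp,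
      by simp, ?_⟩
    simp [ht, hB, hε]
    ring
  · rintro i hi s' ⟨h1, h52, hv, h7⟩
    have e1 : s'.real 1 = α := (h1.real 1 (by omega)).trans hα
    refine ⟨?_, WP.mono (WP.seq (WP.setReal (WP.seq (WP.setNat (WP.setReal ?_))))) (by
      simp [NatExpr.cost, RealExpr.cost]) fun _ h => h⟩
    · simpa [Test.holds, RealExpr.eval, NatExpr.eval, h7] using hd' i hi
    · simp only [NatExpr.eval, RealExpr.eval]
      refine ⟨((h1.setR _ (by omega)).setN _ (by omega)).setR _ (by omega), by simp [h52], ?_, ?_⟩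
      · simp [hv, e1, pow_succ]
      · simp [h7, e1, pow_succ, mul_assoc]
  · rintro s' ⟨-, -, -, h7⟩
    simpa [Test.holds, RealExpr.eval, NatExpr.eval, h7] using hd
  · rintro s' ⟨h1, h2, h3, -⟩
    exact ⟨h1, h2, h3⟩
  · simp only [Test.cost, NatExpr.cost, RealExpr.cost]; omega

theorem wp_levelProg {t k : ℕ} {α v : ℝ} (ht : s.nat 1 = t) (hα : s.real 1 = α)
    (hv : s.real 52 = v) (hk : t ≤ 2 ^ k) (hk' : ∀ i < k, 2 ^ i < t) :
    WP f ω r levelProg s (40 * (k + 1)) fun s' =>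
      KeepInput s s' ∧ s'.nat 52 = s.nat 52 ∧ s'.real 52 = v * (1 + α) ^ k := by
  let Inv : ℕ → State → Prop := fun i s' => KeepInput s s' ∧ s'.nat 52 = s.nat 52 ∧
    s'.real 52 = v * (1 + α) ^ i ∧ s'.nat 7 = 2 ^ i
  refine WP.mono (WP.seq (WP.setNat ((WP.while (c := 20) k
    Inv ?_ ?_ ?_).mono le_rfl ?_))) ?_ fun _ h => h
  · simp only [NatExpr.eval]
    exact ⟨KeepInput.refl.setN _ (by omega), by simp, by simp [hv], by simp⟩
  · rintro i hi s' ⟨h1, h52, hv', h7⟩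
    have e1 : s'.real 1 = α := (h1.real 1 (by omega)).trans hα
    have e2 : s'.nat 1 = t := (h1.nat 1 (by omega)).trans ht
    refine ⟨?_, WP.mono (WP.seq (WP.setNat (WP.setReal ?_))) (by
      simp [NatExpr.cost, RealExpr.cost]) fun _ h => h⟩
    · simpa [Test.holds, NatExpr.eval, h7, e2] using hk' i hi
    · simp only [NatExpr.eval, RealExpr.eval]
      refine ⟨(h1.setN _ (by omega)).setR _ (by omega), by simp [h52], ?_, ?_⟩
      · simp [hv', e1, pow_succ, mul_assoc]
      · simp [h7, pow_succ]; ring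
  · rintro s' ⟨h1, -, -, h7⟩
    have e2 : s'.nat 1 = t := (h1.nat 1 (by omega)).trans ht
    simpa [Test.holds, NatExpr.eval, h7, e2] using hk
  · rintro s' ⟨h1, h2, h3, -⟩
    exact ⟨h1, h2, h3⟩
  · simp only [Test.cost, NatExpr.cost]; omega

theorem wp_confidenceProg {l : ℕ} {δ : ℝ} (hδ : s.real 3 = δ) (hl : (1 / 2 : ℝ) ^ l ≤ δ)
    (hl' : ∀ i < l, δ < (1 / 2 : ℝ) ^ i) :
    WP f ω r confidenceProg s (40 * (l + 1)) fun s' =>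
      KeepInput s s' ∧ s'.nat 52 = s.nat 52 ∧ s'.real 52 = s.real 52 ∧ s'.nat 8 = l := by
  let Inv : ℕ → State → Prop := fun i s' => KeepInput s s' ∧ s'.nat 52 = s.nat 52 ∧
    s'.real 52 = s.real 52 ∧ s'.nat 8 = i ∧ s'.real 7 = (1 / 2 : ℝ) ^ i
  refine WP.mono (WP.seq (WP.setNat (WP.seq (WP.setReal ((WP.while (c := 20) l
    Inv ?_ ?_ ?_).mono le_rfl ?_))))) ?_ fun _ h => h
  · simp only [NatExpr.eval, RealExpr.eval]
    exact ⟨(KeepInput.refl.setN _ (by omega)).setR _ (by omega), by simp, by simp, by simp, by simp⟩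
  · rintro i hi s' ⟨h1, h52, hv', h8, h7⟩
    have e1 : s'.real 3 = δ := (h1.real 3 (by omega)).trans hδ
    refine ⟨?_, WP.mono (WP.seq (WP.setReal (WP.setNat ?_))) (by
      simp [NatExpr.cost, RealExpr.cost]) fun _ h => h⟩
    · simp only [Test.holds, RealExpr.eval, NatExpr.eval, h7, e1, not_le]
      exact hl' i hi
    · simp only [NatExpr.eval, RealExpr.eval]
      refine ⟨(h1.setR _ (by omega)).setN _ (by omega), by simp [h52], by simp [hv'], by simp [h8],
        ?_⟩
      simp [h7, pow_succ]; ring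
  · rintro s' ⟨h1, -, -, -, h7⟩
    have e1 : s'.real 3 = δ := (h1.real 3 (by omega)).trans hδ
    simp only [Test.holds, RealExpr.eval, NatExpr.eval, h7, e1, not_not]
    exact hl
  · rintro s' ⟨h1, h2, h3, h4, -⟩
    exact ⟨h1, h2, h3, h4⟩
  · simp only [Test.cost, NatExpr.cost, RealExpr.cost]; omega

/-- The parameters are in their cells, and the cells from `100` on are zero. -/
structure Ready (n d : ℕ) (v cap T μ : ℝ) (s : State) : Prop where
  dim : s.nat 50 = n
  degree : s.nat 52 = d
  threshold : s.real 52 = v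
  capacity : s.real 53 = cap
  rounds : s.real 55 = T
  examples : s.real 54 = μ
  seen : s.seen = 0
  nat_zero : ∀ a, 100 ≤ a → s.nat a = 0
  real_zero : ∀ a, 100 ≤ a → s.real a = 0

theorem wp_setupProg {t d k l : ℕ} {B α ε δ v cap T γ μ : ℝ}
    (hd : 16 * t ^ 2 * max B 1 ^ 2 / ε * (α / (1 + α)) ^ d ≤ 1)
    (hd' : ∀ i < d, 1 < 16 * t ^ 2 * max B 1 ^ 2 / ε * (α / (1 + α)) ^ i)
    (hk : t ≤ 2 ^ k) (hk' : ∀ i < k, 2 ^ i < t) (hl : (1 / 2 : ℝ) ^ l ≤ δ)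
    (hl' : ∀ i < l, δ < (1 / 2 : ℝ) ^ i) (hv : v = (1 + α) ^ (d + k)) (hcap : cap = 5 * t * v ^ 2)
    (hT : T = 16 * t * max B 1 ^ 2 * cap / ε)
    (hγ : γ = ε / (16 * cap ^ 2 * t ^ 2 * max B 1 ^ 2)) (hμ : μ = (n + l + 2) / γ ^ 2) :
    WP f ω r setupProg (inputState n t B α ε δ) (40 * (d + k + l) + 250)
      (Ready n d v cap T μ) := by
  set B' := max B 1 with hB'
  refine WP.mono (WP.seq (WP.setNat (WP.seq (b₂ := 40 * (d + 1) + (40 * (k + 1) + (40 * (l + 1) + 90)))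
    (wp_scaleProg.mono le_rfl ?_)))) ?_ fun _ h => h
  · rintro s₀ rfl
    set s₁ := (State.setN (inputState n t B α ε δ) (NatExpr.eval (inputState n t B α ε δ) (.const 50))
      (NatExpr.eval (inputState n t B α ε δ) (reg 0))).setR 50 (max ((State.setN (inputState n t B α ε δ) (NatExpr.eval (inputState n t B α ε δ) (.const 50))
      (NatExpr.eval (inputState n t B α ε δ) (reg 0))).real 0) 1) with hs₁
    have hs₁' : s₁ = ((inputState n t B α ε δ).setN 50 n).setR 50 B' := by
      rw [hs₁]; simp [NatExpr.eval, inputState, hB']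
    clear_value s₁
    subst hs₁'
    refine WP.seq ((wp_degreeProg (t := t) (d := d) (B := B') (α := α) (ε := ε) ?_ ?_ ?_ ?_ hd
      hd').mono le_rfl ?_)
    · simp [inputState]
    · simp
    · simp [inputState]
    · simp [inputState]
    rintro s₂ ⟨k2, d2, v2⟩
    refine WP.seq ((wp_levelProg (t := t) (k := k) (α := α) ?_ ?_ v2 hk hk').mono le_rfl ?_)
    · rw [k2.nat 1 (by omega)]; simp [inputState]
    · rw [k2.real 1 (by omega)]; simp [inputState]
    rintro s₃ ⟨k3, d3, v3⟩
    refine WP.seq ((wp_confidenceProg (l := l) (δ := δ) ?_ hl hl').mono le_rfl ?_)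
    · rw [k3.real 3 (by omega), k2.real 3 (by omega)]; simp [inputState]
    rintro s₄ ⟨k4, d4, v4, l4⟩
    have k := (k2.trans k3).trans k4
    have e50 : s₄.nat 50 = n := by rw [k.nat 50 (by omega)]; simp
    have e1 : s₄.nat 1 = t := by rw [k.nat 1 (by omega)]; simp [inputState]
    have eB : s₄.real 50 = B' := by rw [k.real 50 (by omega)]; simp
    have eε : s₄.real 2 = ε := by rw [k.real 2 (by omega)]; simp [inputState]
    have ev : s₄.real 52 = v := by rw [v4, v3, hv, pow_add]
    have ecap : 5 * (t : ℝ) * (v * v) = cap := by rw [hcap]; ring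
    have eT : 16 * (t : ℝ) * (B' * B') * cap / ε = T := by rw [hT]; ring
    have eγ : ε / (16 * (cap * cap) * ((t : ℝ) * t) * (B' * B')) = γ := by rw [hγ]; ring
    have eμ : ((n : ℝ) + l + 2) / (γ * γ) = μ := by rw [hμ]; ring
    refine WP.mono (WP.seq (WP.setReal (WP.seq (WP.setReal (WP.seq (WP.setReal (WP.setReal ?_)))))))
      (by simp [NatExpr.cost, RealExpr.cost]) fun _ h => h
    simp only [NatExpr.eval, RealExpr.eval, State.setR_nat, e1, e50, l4, State.setR_real_self]
    simp (disch := omega) only [State.setR_real_ne, State.setR_real_self, eB, ev, eε]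
    push_cast
    simp only [ecap, eT, eγ, eμ]
    refine ⟨by simp [e50], by simp [d4, d3, d2], by simp [ev], by simp, by simp, by simp, ?_, ?_, ?_⟩
    · simp [k.seen, inputState]
    · intro a ha
      have e : a ≠ 0 := by omega
      have e' : a ≠ 1 := by omega
      have := k.nat a (by omega)
      simp (disch := omega) [this, inputState, e, e']
    · intro a ha
      have := k.real a (by omega)
      have e0 : a ≠ 0 := by omega
      have e1 : a ≠ 1 := by omega
      have e2 : a ≠ 2 := by omega
      have e3 : a ≠ 3 := by omega
      simp (disch := omega) [this, inputState, e0, e1, e2, e3]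
  · simp only [NatExpr.cost]; omega

/-- The memory after the examples have been drawn. -/
structure Sampled {n : ℕ} (f : Cube n → ℝ) (ω : ℕ → Cube n) (m d : ℕ) (v cap T : ℝ) (s : State) :
    Prop where
  samples : Samples ω m s
  base : s.nat 56 = 100 + n + m * n
  labels : ∀ j < m, s.real (100 + j) = f (ω j)
  degree : s.nat 52 = d
  threshold : s.real 52 = v
  capacity : s.real 53 = cap
  rounds : s.real 55 = T
  nat_zero : ∀ a, 100 + n + m * n ≤ a → s.nat a = 0
  real_zero : ∀ a, 100 + m ≤ a → s.real a = 0

/-- The loop compares its counter with the real `μ` and so draws `⌈μ⌉₊` examples. That the memory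
behind them is still zero is recorded because it later serves as the first candidate, the empty set,
and as the zero starting vector of the descent. -/
theorem wp_sampleProg {d : ℕ} {v cap T μ : ℝ} (hs : Ready n d v cap T μ s) :
    WP f ω r sampleProg s (50 * (⌈μ⌉₊ + 1) * (n + 1)) (Sampled f ω ⌈μ⌉₊ d v cap T) := by
  let Inv : ℕ → State → Prop := fun i s' => Sampled f ω i d v cap T s' ∧ s'.real 54 = μ ∧ s'.seen = i
  refine WP.mono (WP.seq (WP.setNat (WP.seq (WP.setNat ((WP.while (c := n + 30) ⌈μ⌉₊
    Inv ?_ ?_ ?_).mono le_rfl ?_))))) ?_ fun _ h => h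
  · simp only [NatExpr.eval]
    refine ⟨⟨⟨?_, ?_, ?_, ?_⟩, ?_, ?_, ?_, ?_, ?_, ?_, ?_, ?_⟩, ?_, ?_⟩
    · simp [hs.dim]
    · simp
    · simp
    · simp
    · simp [hs.dim]
    · simp
    · simp [hs.degree]
    · simp [hs.threshold]
    · simp [hs.capacity]
    · simp [hs.rounds]
    · intro a ha
      simp (disch := omega) [hs.nat_zero a (by omega)]
    · intro a ha
      simp [hs.real_zero a (by omega)]
    · simp [hs.examples]
    · simp [hs.seen]
  · rintro i hi s' ⟨h, h54, hseen⟩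
    refine ⟨?_, ?_⟩
    · simp only [Test.holds, RealExpr.eval, NatExpr.eval, h54, h.samples.size, not_le]
      exact Nat.lt_ceil.1 hi
    · refine WP.mono (WP.seq (WP.example_ (WP.seq (WP.setNat (WP.setNat ?_))))) ?_ fun _ h => h
      · simp only [NatExpr.eval, h.base, h.samples.size, hseen]
        set s₁ := s'.receive (100 + n + i * n) (100 + i) (ω i) (f (ω i)) with hs₁
        have hnat : ∀ a, (a < 100 + n + i * n ∨ 100 + n + i * n + n ≤ a) → s₁.nat a = s'.nat a := by
          intro a ha
          rw [hs₁]
          simp only [State.receive]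
          rw [dif_neg (by omega)]
        have hreal : ∀ a, a ≠ 100 + i → s₁.real a = s'.real a := by
          intro a ha
          simp [hs₁, State.receive, Function.update_of_ne ha]
        have hlabel : s₁.real (100 + i) = f (ω i) := by simp [hs₁, State.receive]
        have hpoint : s₁.readPoint n (100 + n + i * n) = ω i := by
          funext j
          have := j.2
          simp only [State.readPoint, hs₁, State.receive]
          rw [dif_pos (by omega)]
          have e : (⟨100 + n + i * n + j.val - (100 + n + i * n), by omega⟩ : Fin n) = j :=
            Fin.ext (by simp)
          rw [e]
          cases ω i j <;> simp
        have hse : s₁.seen = i + 1 := by simp [hs₁, State.receive, hseen]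
        have e50 : s₁.nat 50 = n := (hnat 50 (by omega)).trans h.samples.dim
        have e55 : s₁.nat 55 = i := (hnat 55 (by omega)).trans h.samples.size
        have e56 : s₁.nat 56 = 100 + n + i * n := (hnat 56 (by omega)).trans h.base
        have e52 : s₁.nat 52 = d := (hnat 52 (by omega)).trans h.degree
        clear_value s₁
        simp (disch := omega) only [e50, e56, State.setN_nat_ne, e55]
        refine ⟨⟨⟨?_, ?_, ?_, ?_⟩, ?_, ?_, ?_, ?_, ?_, ?_, ?_, ?_⟩, ?_, ?_⟩
        · simp [e50]
        · simp
        · simp [hse]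
        · intro j hj
          rw [readPoint_congr (s := s₁) fun l hl => by simp (disch := omega)]
          by_cases hji : j = i
          · rw [hji, hpoint]
          · rw [← h.samples.point j (by omega)]
            refine readPoint_congr fun l hl => hnat _ (Or.inl ?_)
            have := mul_add_lt_mul (show j < i by omega) hl
            omega
        · simp; ring
        · intro j hj
          simp only [State.setN_real]
          by_cases hji : j = i
          · rw [hji, hlabel]
          · rw [hreal _ (by omega), h.labels j (by omega)]
        · simp [e52]
        · simp [hreal 52 (by omega), h.threshold]
        · simp [hreal 53 (by omega), h.capacity]
        · simp [hreal 55 (by omega), h.rounds]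
        · intro a ha
          rw [Nat.succ_mul] at ha
          simp (disch := omega) only [State.setN_nat_ne]
          rw [hnat a (by omega), h.nat_zero a (by omega)]
        · intro a ha
          simp only [State.setN_real]
          rw [hreal a (by omega), h.real_zero a (by omega)]
        · simp [hreal 54 (by omega), h54]
        · simp [hse]
      · simp only [NatExpr.cost]; omega
  · rintro s' ⟨h, h54, -⟩
    simp only [Test.holds, RealExpr.eval, NatExpr.eval, h54, h.samples.size, not_not]
    exact Nat.le_ceil μ
  · rintro s' ⟨h, -⟩
    exact h
  · simp only [Test.cost, NatExpr.cost, RealExpr.cost]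
    generalize ⌈μ⌉₊ = m
    have e1 : m * (1 + 1 + (1 + 1 + 1) + 1 + 1 + (n + 30)) = m * n + 37 * m := by ring
    have e2 : 50 * (m + 1) * (n + 1) = 50 * (m * n) + 50 * m + 50 * n + 50 := by ring
    omega

/-- The polynomial that the output list describes. -/
theorem multilinear_output (x : Cube n) : multilinear (s.output n) x
    = ∑ q ∈ Finset.range (s.nat 0), s.real (s.nat 2 + q) * monomial (setAt n s (s.nat 1 + q * n)) x := by
  simp only [multilinear, State.output, State.numTerms, Finset.sum_mul]
  rw [Finset.sum_comm]
  refine Finset.sum_congr rfl fun q _ => ?_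
  have e : s.termVars n q = setAt n s (s.nat 1 + q * n) := rfl
  rw [Finset.sum_eq_single (setAt n s (s.nat 1 + q * n))]
  · rw [if_pos e]
  · intro S _ hS
    rw [e, if_neg (fun h => hS h.symm), zero_mul]
  · simp

/-- Nothing is assumed about the sample `ω`: halting, locality and the step bound hold for every
outcome, and the output is a deterministic function of it. The pairs such as `hd` and `hd'` make
`d`, `k` and `l` the least exponents, which are the numbers of rounds of the loops that compute
them. -/
theorem wp_learnProg {c : Finset (Fin n) → ℝ} {t d k l m K : ℕ} {B α ε δ v cap T γ μ σ : ℝ}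
    (hd : 16 * t ^ 2 * max B 1 ^ 2 / ε * (α / (1 + α)) ^ d ≤ 1)
    (hd' : ∀ i < d, 1 < 16 * t ^ 2 * max B 1 ^ 2 / ε * (α / (1 + α)) ^ i)
    (hk : t ≤ 2 ^ k) (hk' : ∀ i < k, 2 ^ i < t) (hl : (1 / 2 : ℝ) ^ l ≤ δ)
    (hl' : ∀ i < l, δ < (1 / 2 : ℝ) ^ i) (hv : v = (1 + α) ^ (d + k)) (hcap : cap = 5 * t * v ^ 2)
    (hcap1 : 1 ≤ cap) (hT : T = 16 * t * max B 1 ^ 2 * cap / ε)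
    (hγ : γ = ε / (16 * cap ^ 2 * t ^ 2 * max B 1 ^ 2)) (hμ : μ = (n + l + 2) / γ ^ 2)
    (hm : m = ⌈μ⌉₊) (hK : K = ⌊cap⌋₊) (hσ : σ = 1 / (2 * cap * m)) (hr : (d : ℝ) ≤ r)
    [DecidablePred (PassTest c m ω d v)] :
    WP (multilinear c) ω r learnProg (inputState n t B α ε δ)
      (40 * (d + k + l) + 400 + 50 * (m + 1) * (n + 1)
        + 1200 * (m + 1) * (n + 1) ^ 2 * (2 ^ d) ^ 2 * (K + 1)
        + 400 * (⌈T⌉₊ + 1) * (m + 1) * (K + 1) * (n + 1)) fun s' =>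
      s'.numTerms = (candidates (PassTest c m ω d v) K n).length ∧
      ∀ x, multilinear (s'.output n) x
        = ∑ q ∈ Finset.range (candidates (PassTest c m ω d v) K n).length,
          gdIter m (candidates (PassTest c m ω d v) K n).length
            (fun q j => monomial ((candidates (PassTest c m ω d v) K n).getD q ∅) (ω j))
            (fun j => multilinear c (ω j)) σ ⌈T⌉₊ q *
            monomial ((candidates (PassTest c m ω d v) K n).getD q ∅) x := by
  have hK1 : 1 ≤ K := hK ▸ Nat.le_floor (by simpa using hcap1)
  have hlen : (candidates (PassTest c m ω d v) K n).length ≤ K := length_candidates_le hK1 n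
  set a := 100 + n + m * n with ha
  refine WP.mono (WP.seq (b₂ := 50 * (m + 1) * (n + 1) + (50
    + (1200 * (m + 1) * (n + 1) ^ 2 * (2 ^ d) ^ 2 * (K + 1)
      + (400 * (⌈T⌉₊ + 1) * (m + 1) * (K + 1) * (n + 1) + 50))))
    ((wp_setupProg (n := n) hd hd' hk hk' hl hl' hv hcap hT hγ hμ).mono le_rfl ?_)) (by omega)
    fun _ h => h
  intro s₁ h1
  refine WP.seq ((wp_sampleProg h1).mono (by rw [hm]) ?_)
  rw [← hm]
  intro s₂ h2
  refine WP.mono (WP.seq (b₁ := 50) (WP.mono (WP.seq (WP.setNat (WP.seq (WP.setNat (WP.setReal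
    (Q := fun s' => WP (multilinear c) ω r (.seq buildProg (.seq descentProg outputProg)) s'
      (1200 * (m + 1) * (n + 1) ^ 2 * (2 ^ d) ^ 2 * (K + 1)
      + (400 * (⌈T⌉₊ + 1) * (m + 1) * (K + 1) * (n + 1) + 50)) _) ?_))))) (by
    simp [NatExpr.cost, RealExpr.cost]) fun _ h => h)) le_rfl fun _ h => h
  simp (disch := omega) only [NatExpr.eval, RealExpr.eval, State.setN_nat_ne, State.setN_nat_self,
    State.setN_real, h2.samples.size, h2.capacity, Nat.cast_one, Nat.cast_ofNat]
  rw [← hσ]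
  set s₃ := ((s₂.setN 53 (100 + m)).setN 54 (100 + m + m)).setR 56 σ with hs₃
  have n3 : ∀ b, b ≠ 53 → b ≠ 54 → s₃.nat b = s₂.nat b := fun b _ _ => by
    rw [hs₃]; simp (disch := omega)
  have r3 : ∀ b, b ≠ 56 → s₃.real b = s₂.real b := fun b _ => by rw [hs₃]; simp (disch := omega)
  have s3 : Samples ω m s₃ := ⟨(n3 _ (by omega) (by omega)).trans h2.samples.dim,
    (n3 _ (by omega) (by omega)).trans h2.samples.size, h2.samples.seen, fun j hj => by
      rw [← h2.samples.point j hj]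
      exact readPoint_congr fun i _ => n3 _ (by omega) (by omega)⟩
  have e53 : s₃.nat 53 = 100 + m := by rw [hs₃]; simp
  have e54 : s₃.nat 54 = 100 + m + m := by rw [hs₃]; simp
  have e56 : s₃.real 56 = σ := by rw [hs₃]; simp
  clear_value s₃
  refine WP.seq ((wp_buildProg (c := c) (d := d) (a := a) (v := v) (cap := cap) hcap1 s3 le_rfl
    ((n3 _ (by omega) (by omega)).trans h2.base) ((n3 _ (by omega) (by omega)).trans h2.degree) hr
    ((r3 _ (by omega)).trans h2.threshold) ((r3 _ (by omega)).trans h2.capacity)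
    (fun i _ => (n3 _ (by omega) (by omega)).trans (h2.nat_zero _ (by omega)))).mono
    (by rw [hK]) ?_)
  rw [← hK]
  rintro s₄ ⟨k4, l4⟩
  set L := candidates (PassTest c m ω d v) K n with hL
  clear_value L
  have hf : Fitting ω m a L (fun j => multilinear c (ω j)) σ s₄ :=
    ⟨s3.keepList k4 (by omega) le_rfl, l4, by omega,
      fun j hj => by rw [k4.real _ (by omega), r3 _ (by omega), h2.labels j hj],
      (k4.real _ (by omega)).trans e56,
      (k4.nat _ (by omega) (by omega) (by omega) (by omega)).trans e53,
      (k4.nat _ (by omega) (by omega) (by omega) (by omega)).trans e54⟩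
  refine WP.seq ((wp_descentProg (ξ := fun q j => monomial (L.getD q ∅) (ω j)) hf
    (fun _ _ => rfl) (fun q _ => by
      rw [k4.real _ (by omega), r3 _ (by omega), h2.real_zero _ (by omega)]) (T := T)
    (by rw [k4.real _ (by omega), r3 _ (by omega), h2.rounds])).mono (by gcongr) ?_)
  rintro s₅ ⟨f5, c5⟩
  refine WP.mono (WP.seq (WP.setNat (WP.seq (WP.setNat (WP.setNat ?_))))) (by simp [NatExpr.cost])
    fun _ h => h
  simp (disch := omega) only [NatExpr.eval, State.setN_nat_ne, f5.listed.base, f5.listed.len,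
    f5.coefBase]
  refine ⟨by simp [State.numTerms], fun x => ?_⟩
  rw [multilinear_output]
  simp (disch := omega) only [State.setN_nat_ne, State.setN_nat_self, State.setN_real]
  refine Finset.sum_congr rfl fun q hq => ?_
  have hq' := Finset.mem_range.1 hq
  rw [c5 q hq', ← f5.listed.sets q hq']
  congr 2
  exact setAt_congr fun i _ => by simp (disch := omega)

end Learner

end LocalMQ

namespace LocalMQ

/-! ### Bounds for the parameters -/

section Bounds

/-- Since `P ≥ 2`, numerical constants can be traded for further powers of `P`. -/
theorem le_pow_of_two_le {P c : ℝ} {i j : ℕ} (hP : 2 ≤ P) (hc : c ≤ 2 ^ i) :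
    c * P ^ j ≤ P ^ (i + j) := by
  rw [pow_add]
  have h : (2 : ℝ) ^ i ≤ P ^ i := pow_le_pow_left₀ (by norm_num) hP i
  exact mul_le_mul_of_nonneg_right (hc.trans h) (by positivity)

/-- The exponents in the hypotheses are those obtained in `learner_cost_le`. Each of the six
summands, the last of which bounds the size of the output, is at most `P ^ 285 * E`, and `6 ≤ 8 ≤ P
^ 3`. -/
theorem cost_le {P E : ℝ} (hP : 2 ≤ P) (hE : 1 ≤ E) {n d k l m K N : ℕ} (hn : (n : ℝ) ≤ P)
    (hd : (d : ℝ) ≤ P ^ 14) (hd2 : (2 : ℝ) ^ d ≤ P ^ 14) (hk : (k : ℝ) ≤ P ^ 4)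
    (hl : (l : ℝ) ≤ 2 * E) (hK : (K : ℝ) ≤ P ^ 40) (hN : (N : ℝ) ≤ P ^ 48 + 1)
    (hm : (m : ℝ) ≤ P ^ 181 * E + 1) :
    (40 * (d + k + l) + 400 + 50 * (m + 1) * (n + 1)
        + 1200 * (m + 1) * (n + 1) ^ 2 * (2 ^ d) ^ 2 * (K + 1)
        + 400 * (N + 1) * (m + 1) * (K + 1) * (n + 1) + K * (n + 1) : ℝ) ≤ P ^ 288 * E := by
  have hP1 : 1 ≤ P := by linarith
  have hP0 : 0 < P := by linarith
  have one (i : ℕ) : 1 ≤ P ^ i := one_le_pow₀ hP1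
  have hn1 : (n : ℝ) + 1 ≤ P ^ 2 := by
    have := le_pow_of_two_le (c := 2) (i := 1) (j := 1) hP (by norm_num)
    simp only [pow_one] at this
    norm_num at this
    linarith
  have hK1 : (K : ℝ) + 1 ≤ P ^ 41 := by
    have := le_pow_of_two_le (c := 2) (i := 1) (j := 40) hP (by norm_num)
    norm_num at this
    linarith [one 40]
  have hN1 : (N : ℝ) + 1 ≤ P ^ 50 := by
    have := le_pow_of_two_le (c := 4) (i := 2) (j := 48) hP (by norm_num)
    norm_num at this
    linarith [one 48]
  have hm1 : (m : ℝ) + 1 ≤ P ^ 183 * E := by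
    have h1 := le_pow_of_two_le (c := 4) (i := 2) (j := 181) hP (by norm_num)
    have h2 : 1 ≤ P ^ 181 * E := one_le_mul_of_one_le_of_one_le (one _) hE
    norm_num at h1
    have h3 : 4 * P ^ 181 * E ≤ P ^ 183 * E := by gcongr
    linarith
  have up {i j : ℕ} (h : i ≤ j) : P ^ i * E ≤ P ^ j * E := by gcongr
  have c1 : (40 * (d + k + l) : ℝ) ≤ P ^ 285 * E := by
    have h1 := le_pow_of_two_le (c := 160) (i := 8) (j := 14) hP (by norm_num)
    have h2 : P ^ 14 ≤ P ^ 14 * E := le_mul_of_one_le_right (by positivity) hE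
    have h3 : P ^ 4 ≤ P ^ 14 := pow_le_pow_right₀ hP1 (by norm_num)
    have h4 : 1 * E ≤ P ^ 14 * E := by gcongr; exact one _
    have h5 : 160 * P ^ 14 * E ≤ P ^ (8 + 14) * E := by gcongr
    have h6 := up (show 8 + 14 ≤ 285 by norm_num)
    linarith
  have c2 : (400 : ℝ) ≤ P ^ 285 * E := by
    have h1 := le_pow_of_two_le (c := 400) (i := 9) (j := 0) hP (by norm_num)
    have h2 : P ^ (9 + 0) ≤ P ^ (9 + 0) * E := le_mul_of_one_le_right (by positivity) hE
    have h3 := up (show 9 + 0 ≤ 285 by norm_num)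
    linarith
  have c3 : (50 * (m + 1) * (n + 1) : ℝ) ≤ P ^ 285 * E := by
    calc (50 * (m + 1) * (n + 1) : ℝ) ≤ 50 * (P ^ 183 * E) * P ^ 2 := by gcongr
      _ = 50 * P ^ 185 * E := by ring
      _ ≤ P ^ (6 + 185) * E := by gcongr; exact le_pow_of_two_le hP (by norm_num)
      _ ≤ _ := up (by norm_num)
  have c4 : (1200 * (m + 1) * (n + 1) ^ 2 * (2 ^ d) ^ 2 * (K + 1) : ℝ) ≤ P ^ 285 * E := by
    calc (1200 * (m + 1) * (n + 1) ^ 2 * (2 ^ d) ^ 2 * (K + 1) : ℝ)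
        ≤ 1200 * (P ^ 183 * E) * (P ^ 2) ^ 2 * (P ^ 14) ^ 2 * P ^ 41 := by gcongr
      _ = 1200 * P ^ 256 * E := by ring
      _ ≤ P ^ (11 + 256) * E := by gcongr; exact le_pow_of_two_le hP (by norm_num)
      _ ≤ _ := up (by norm_num)
  have c5 : (400 * (N + 1) * (m + 1) * (K + 1) * (n + 1) : ℝ) ≤ P ^ 285 * E := by
    calc (400 * (N + 1) * (m + 1) * (K + 1) * (n + 1) : ℝ)
        ≤ 400 * P ^ 50 * (P ^ 183 * E) * P ^ 41 * P ^ 2 := by gcongr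
      _ = 400 * P ^ 276 * E := by ring
      _ ≤ P ^ (9 + 276) * E := by gcongr; exact le_pow_of_two_le hP (by norm_num)
  have c6 : (K * (n + 1) : ℝ) ≤ P ^ 285 * E := by
    calc (K * (n + 1) : ℝ) ≤ P ^ 40 * P ^ 2 := by gcongr
      _ = P ^ 42 := by ring
      _ ≤ P ^ 42 * E := le_mul_of_one_le_right (by positivity) hE
      _ ≤ _ := up (by norm_num)
  have e : 8 * P ^ 285 * E ≤ P ^ (3 + 285) * E := by
    gcongr; exact le_pow_of_two_le hP (by norm_num)
  norm_num at e
  linarith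

/-- Take logarithms and use `log (1 + α) ≤ log₂ (1 + α)`. This is where the form of the running
time, with exponents `α` and `log₂ (1 + α)`, comes from. -/
theorem one_add_pow_le {M α : ℝ} (hM : 1 ≤ M) (hα : 1 ≤ α) {j c : ℕ}
    (hj : (j : ℝ) ≤ c * (α * Real.log M)) :
    (1 + α) ^ j ≤ ((M ^ α) ^ Real.logb 2 (1 + α)) ^ c := by
  have hM0 : 0 < M := by linarith
  have hlogM : 0 ≤ Real.log M := Real.log_nonneg hM
  have hlogα : 0 ≤ Real.log (1 + α) := Real.log_nonneg (by linarith)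
  have hlog2 : 0 < Real.log 2 := Real.log_pos (by norm_num)
  have hlog2' : Real.log 2 ≤ 1 := by linarith [Real.log_two_lt_d9]
  have h1 : (1 + α) ^ j = Real.exp (j * Real.log (1 + α)) := by
    rw [Real.exp_nat_mul, Real.exp_log (by linarith)]
  have h2 : ((M ^ α) ^ Real.logb 2 (1 + α)) ^ c
      = Real.exp (c * (α * Real.log M * Real.logb 2 (1 + α))) := by
    rw [Real.exp_nat_mul, ← Real.rpow_mul hM0.le, Real.rpow_def_of_pos hM0]
    congr 2; ring
  rw [h1, h2, Real.exp_le_exp]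
  have h3 : Real.log (1 + α) ≤ Real.logb 2 (1 + α) := by
    rw [Real.logb, le_div_iff₀ hlog2]
    nlinarith
  calc j * Real.log (1 + α) ≤ c * (α * Real.log M) * Real.logb 2 (1 + α) := by gcongr
    _ = _ := by ring

/-- For the base `q = α / (1 + α)` one has `log q ≤ q - 1 = -1 / (1 + α)`. The power before the
least one still exceeds `1 / z`, which bounds it by `(1 + α) log z`. -/
theorem exists_least_pow {z α : ℝ} (hα : 1 ≤ α) (hz : 1 ≤ z) :
    ∃ d : ℕ, z * (α / (1 + α)) ^ d ≤ 1 ∧ (∀ i < d, 1 < z * (α / (1 + α)) ^ i) ∧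
      (d : ℝ) ≤ 1 + (1 + α) * Real.log z := by
  classical
  set q := α / (1 + α) with hq
  have hq0 : 0 < q := by positivity
  have hq1 : q < 1 := by rw [hq, div_lt_one (by linarith)]; linarith
  have hz0 : 0 < z := by linarith
  have hlogz := Real.log_nonneg hz
  have hex : ∃ d : ℕ, z * q ^ d ≤ 1 := by
    obtain ⟨d, hd⟩ := exists_pow_lt_of_lt_one (show 0 < 1 / z by positivity) hq1
    refine ⟨d, ?_⟩
    rw [lt_div_iff₀ hz0] at hd
    linarith
  have hmin : ∀ i < Nat.find hex, 1 < z * q ^ i := fun i hi => not_le.1 (Nat.find_min hex hi)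
  refine ⟨Nat.find hex, Nat.find_spec hex, hmin, ?_⟩
  rcases Nat.eq_zero_or_pos (Nat.find hex) with h | h
  · rw [h]
    have : 0 ≤ (1 + α) * Real.log z := by positivity
    push_cast; linarith
  · obtain ⟨e, he⟩ := Nat.exists_eq_succ_of_ne_zero h.ne'
    have h1 := hmin e (by omega)
    rw [he]
    have h2 : 0 < Real.log (z * q ^ e) := Real.log_pos h1
    rw [Real.log_mul hz0.ne' (by positivity), Real.log_pow] at h2
    have h3 : Real.log q ≤ q - 1 := Real.log_le_sub_one_of_pos hq0
    have h4 : q - 1 = -(1 / (1 + α)) := by rw [hq]; field_simp; ring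
    have h5 : (e : ℝ) * (1 / (1 + α)) ≤ Real.log z := by
      have : (e : ℝ) * Real.log q ≤ e * (-(1 / (1 + α))) := by gcongr; linarith
      linarith
    rw [mul_one_div, div_le_iff₀ (by linarith)] at h5
    push_cast; linarith

/-- The case `α = 1`, where the base is `1 / 2`. -/
theorem exists_least_half {z : ℝ} (hz : 1 ≤ z) :
    ∃ d : ℕ, z ≤ 2 ^ d ∧ (∀ i < d, (2 : ℝ) ^ i < z) ∧ (d : ℝ) ≤ 1 + 2 * Real.log z := by
  obtain ⟨d, h1, h2, h3⟩ := exists_least_pow (α := 1) le_rfl hz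
  have e (i : ℕ) : z * ((1 : ℝ) / (1 + 1)) ^ i = z / 2 ^ i := by
    rw [one_add_one_eq_two, one_div_pow, mul_one_div]
  refine ⟨d, ?_, fun i hi => ?_, by linarith⟩
  · rwa [e, div_le_one (by positivity)] at h1
  · have := h2 i hi
    rwa [e, one_lt_div (by positivity)] at this

theorem exists_parameters {n t : ℕ} {B α ε δ : ℝ} (hn : 2 ≤ n) (ht : 1 ≤ t) (hB : 1 ≤ B)
    (hα : 1 ≤ α) (hε : 0 < ε) (hε1 : ε < 1) (hδ : 0 < δ) (hδ1 : δ < 1) :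
    ∃ d k l : ℕ, 16 * t ^ 2 * B ^ 2 / ε * (α / (1 + α)) ^ d ≤ 1 ∧
      (∀ i < d, 1 < 16 * t ^ 2 * B ^ 2 / ε * (α / (1 + α)) ^ i) ∧
      t ≤ 2 ^ k ∧ (∀ i < k, 2 ^ i < t) ∧ (1 / 2 : ℝ) ^ l ≤ δ ∧
      (∀ i < l, δ < (1 / 2 : ℝ) ^ i) ∧ 1 ≤ d ∧
      (d : ℝ) ≤ 14 * (α * Real.log (n * t * B / ε)) ∧
      (k : ℝ) ≤ 4 * (α * Real.log (n * t * B / ε)) ∧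
      (l : ℝ) ≤ 2 * (1 + Real.log (n / δ)) := by
  have hn' : (2 : ℝ) ≤ n := by exact_mod_cast hn
  have ht' : (1 : ℝ) ≤ t := by exact_mod_cast ht
  set M := n * t * B / ε with hM
  have hMn : n * t * B ≤ M := by
    rw [hM, le_div_iff₀ hε]; exact mul_le_of_le_one_right (by positivity) hε1.le
  have hntB : (n : ℝ) ≤ n * t * B := by
    rw [mul_assoc]
    exact le_mul_of_one_le_right (by positivity) (one_le_mul_of_one_le_of_one_le ht' hB)
  have hM2 : 2 ≤ M := by linarith
  have htM : (t : ℝ) ≤ M := by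
    refine le_trans ?_ hMn
    calc (t : ℝ) = 1 * t * 1 := by ring
      _ ≤ n * t * B := by gcongr; linarith
  have hlog2 : 1 / 2 ≤ Real.log 2 := by linarith [Real.log_two_gt_d9]
  have hlogM : 1 / 2 ≤ Real.log M := hlog2.trans (Real.log_le_log (by norm_num) hM2)
  have hαM : Real.log M ≤ α * Real.log M := le_mul_of_one_le_left (by linarith) hα
  -- Strictness gives `1 ≤ d`, from which `2 ≤ v` will follow.
  have hz1 : 1 < 16 * t ^ 2 * B ^ 2 / ε := by
    rw [lt_div_iff₀ hε, one_mul]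
    have : (1 : ℝ) ≤ t ^ 2 * B ^ 2 :=
      one_le_mul_of_one_le_of_one_le (one_le_pow₀ ht') (one_le_pow₀ hB)
    nlinarith
  -- Hence `d ≤ 1 + (1 + α) · 6 log M ≤ 1 + 12α log M`; the constant `14` follows because `α log M ≥
  -- 1/2`.
  have hzM : 16 * t ^ 2 * B ^ 2 / ε ≤ M ^ 6 := by
    have h1 : t ^ 2 * B ^ 2 / ε ≤ M ^ 2 := by
      have h2 : M ^ 2 = t ^ 2 * B ^ 2 / ε * (n ^ 2 / ε) := by rw [hM]; field_simp
      rw [h2]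
      refine le_mul_of_one_le_right (by positivity) ?_
      rw [le_div_iff₀ hε]
      nlinarith
    calc 16 * t ^ 2 * B ^ 2 / ε = 16 * (t ^ 2 * B ^ 2 / ε) := by ring
      _ ≤ 16 * M ^ 2 := by gcongr
      _ ≤ M ^ (4 + 2) := le_pow_of_two_le hM2 (by norm_num)
  obtain ⟨d, hd1, hd2, hd3⟩ := exists_least_pow hα hz1.le
  obtain ⟨k, hk1, hk2, hk3⟩ := exists_least_half ht'
  obtain ⟨l, hl1, hl2, hl3⟩ := exists_least_half (show 1 ≤ 1 / δ by
    rw [le_div_iff₀ hδ]; linarith)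
  refine ⟨d, k, l, hd1, hd2, by exact_mod_cast hk1, fun i hi => by exact_mod_cast hk2 i hi, ?_,
    fun i hi => ?_, ?_, ?_, ?_, ?_⟩
  · rw [one_div_pow, one_div_le (by positivity) hδ]; exact hl1
  · rw [one_div_pow, lt_one_div hδ (by positivity)]; exact hl2 i hi
  · by_contra h
    have : d = 0 := by omega
    rw [this, pow_zero, mul_one] at hd1
    linarith
  · have h1 : Real.log (16 * t ^ 2 * B ^ 2 / ε) ≤ 6 * Real.log M := by
      refine (Real.log_le_log (by linarith) hzM).trans ?_
      rw [Real.log_pow]; norm_num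
    have h2 : (1 + α) * Real.log (16 * t ^ 2 * B ^ 2 / ε) ≤ (α + α) * (6 * Real.log M) := by
      gcongr
      · exact Real.log_nonneg hz1.le
    linarith
  · have : Real.log t ≤ Real.log M := Real.log_le_log (by linarith) htM
    linarith
  · have : Real.log (1 / δ) ≤ Real.log (n / δ) :=
      Real.log_le_log (by positivity) (by gcongr; linarith)
    linarith

theorem learner_cost_le {n t d k l m K N : ℕ} {B α ε δ v cap T γ μ : ℝ} (hn : 2 ≤ n) (ht : 1 ≤ t)
    (hB : 1 ≤ B) (hα : 1 ≤ α) (hε : 0 < ε) (hε1 : ε < 1) (hδ : 0 < δ) (hδ1 : δ < 1)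
    (hd : (d : ℝ) ≤ 14 * (α * Real.log (n * t * B / ε)))
    (hk : (k : ℝ) ≤ 4 * (α * Real.log (n * t * B / ε)))
    (hl : (l : ℝ) ≤ 2 * (1 + Real.log (n / δ))) (hv : v = (1 + α) ^ (d + k))
    (hcap : cap = 5 * t * v ^ 2) (hT : T = 16 * t * B ^ 2 * cap / ε)
    (hγ : γ = ε / (16 * cap ^ 2 * t ^ 2 * B ^ 2)) (hμ : μ = (n + l + 2) / γ ^ 2)
    (hm : m = ⌈μ⌉₊) (hK : K = ⌊cap⌋₊) (hN : N = ⌈T⌉₊) :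
    ((40 * (d + k + l) + 400 + 50 * (m + 1) * (n + 1)
        + 1200 * (m + 1) * (n + 1) ^ 2 * (2 ^ d) ^ 2 * (K + 1)
        + 400 * (N + 1) * (m + 1) * (K + 1) * (n + 1) + K * (n + 1) : ℕ) : ℝ) ≤
      (300 * ((n * t * B / ε) ^ α) ^ Real.logb 2 (1 + α) * (1 + Real.log (n / δ))) ^ (300 : ℝ) := by
  have hn' : (2 : ℝ) ≤ n := by exact_mod_cast hn
  have ht' : (1 : ℝ) ≤ t := by exact_mod_cast ht
  set M := n * t * B / ε with hM
  have hntB : 1 ≤ n * t * B := by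
    refine one_le_mul_of_one_le_of_one_le (one_le_mul_of_one_le_of_one_le ?_ ht') hB
    linarith
  have hMn : n * t * B ≤ M := by
    rw [hM, le_div_iff₀ hε]; exact mul_le_of_le_one_right (by positivity) hε1.le
  have hnM : (n : ℝ) ≤ M := by
    refine le_trans ?_ hMn
    rw [mul_assoc]
    exact le_mul_of_one_le_right (by positivity) (one_le_mul_of_one_le_of_one_le ht' hB)
  have htM : (t : ℝ) ≤ M := by
    refine le_trans ?_ hMn
    calc (t : ℝ) = 1 * t * 1 := by ring
      _ ≤ n * t * B := by gcongr; linarith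
  have hBM : B ≤ M := by
    refine le_trans ?_ hMn
    calc B = 1 * 1 * B := by ring
      _ ≤ n * t * B := by gcongr; linarith
  have hεM : 1 / ε ≤ M := by rw [hM]; gcongr
  have hM2 : 2 ≤ M := by linarith
  set P := (M ^ α) ^ Real.logb 2 (1 + α) with hP
  set E := 1 + Real.log (n / δ) with hE
  have hE1 : 1 ≤ E := by
    have : 0 ≤ Real.log (n / δ) := Real.log_nonneg (by rw [le_div_iff₀ hδ]; linarith)
    linarith
  -- Both exponents `α` and `log₂ (1 + α)` are at least one, so `n`, `t`, `B` and `1 / ε` are all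
  -- bounded by `P`.
  have hMP : M ≤ P := by
    have h1 : M ≤ M ^ α := Real.self_le_rpow_of_one_le (by linarith) hα
    refine h1.trans (Real.self_le_rpow_of_one_le (by linarith) ?_)
    rw [Real.le_logb_iff_rpow_le (by norm_num) (by linarith), Real.rpow_one]
    linarith
  have hP2 : 2 ≤ P := hM2.trans hMP
  have hP1 : 1 ≤ P := by linarith
  have hP0 : 0 < P := by linarith
  have hd1 : (1 + α) ^ d ≤ P ^ 14 := one_add_pow_le (by linarith) hα (by exact_mod_cast hd)
  have hk1 : (1 + α) ^ k ≤ P ^ 4 := one_add_pow_le (by linarith) hα (by exact_mod_cast hk)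
  have hd2 : (2 : ℝ) ^ d ≤ P ^ 14 := le_trans (by gcongr; linarith) hd1
  have hk2 : (2 : ℝ) ^ k ≤ P ^ 4 := le_trans (by gcongr; linarith) hk1
  have cast_le (i : ℕ) : (i : ℝ) ≤ 2 ^ i := by exact_mod_cast Nat.lt_two_pow_self.le
  have hv0 : 0 < v := by rw [hv]; positivity
  have hvP : v ≤ P ^ 18 := by
    rw [hv, pow_add, show (18 : ℕ) = 14 + 4 from rfl, pow_add P]; gcongr
  have hcap0 : 0 < cap := by rw [hcap]; positivity
  have hcapP : cap ≤ P ^ 40 := by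
    calc cap ≤ 5 * P * (P ^ 18) ^ 2 := by rw [hcap]; gcongr; exact htM.trans hMP
      _ = 5 * P ^ 37 := by ring
      _ ≤ P ^ (3 + 37) := le_pow_of_two_le hP2 (by norm_num)
  have hTP : T ≤ P ^ 48 := by
    calc T = 16 * t * B ^ 2 * cap * (1 / ε) := by rw [hT]; ring
      _ ≤ 16 * P * P ^ 2 * P ^ 40 * P := by
        gcongr
        · exact htM.trans hMP
        · exact hBM.trans hMP
        · exact hεM.trans hMP
      _ = 16 * P ^ 44 := by ring
      _ ≤ P ^ (4 + 44) := le_pow_of_two_le hP2 (by norm_num)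
  have hγP : 1 / γ ≤ P ^ 89 := by
    calc 1 / γ = 16 * cap ^ 2 * t ^ 2 * B ^ 2 * (1 / ε) := by rw [hγ, one_div_div]; ring
      _ ≤ 16 * (P ^ 40) ^ 2 * P ^ 2 * P ^ 2 * P := by
        gcongr
        · exact htM.trans hMP
        · exact hBM.trans hMP
        · exact hεM.trans hMP
      _ = 16 * P ^ 85 := by ring
      _ ≤ P ^ (4 + 85) := le_pow_of_two_le hP2 (by norm_num)
  have hγ0 : 0 < γ := by rw [hγ]; positivity
  have hμP : μ ≤ P ^ 181 * E := by
    have h1 : (n + l + 2 : ℝ) ≤ 4 * P * E := by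
      have e1 : P ≤ P * E := le_mul_of_one_le_right hP0.le hE1
      have e2 : 2 * E ≤ P * E := by gcongr
      linarith
    calc μ = (n + l + 2) * (1 / γ) ^ 2 := by rw [hμ]; ring
      _ ≤ 4 * P * E * (P ^ 89) ^ 2 := by gcongr
      _ = 4 * P ^ 179 * E := by ring
      _ ≤ P ^ (2 + 179) * E := by gcongr; exact le_pow_of_two_le hP2 (by norm_num)
  have hμ0 : 0 ≤ μ := by rw [hμ]; positivity
  have hT0 : 0 ≤ T := by rw [hT]; positivity
  have key := cost_le (n := n) (d := d) (k := k) (l := l) (m := m) (K := K) (N := N) hP2 hE1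
    (hnM.trans hMP) ((cast_le d).trans hd2) hd2 ((cast_le k).trans hk2) hl
    (by rw [hK]; exact (Nat.floor_le hcap0.le).trans hcapP)
    (by rw [hN]; linarith [Nat.ceil_lt_add_one hT0])
    (by rw [hm]; linarith [Nat.ceil_lt_add_one hμ0])
  push_cast
  refine key.trans ?_
  have h1 : P ^ 288 * E ≤ (P * E) ^ 288 := by
    rw [mul_pow]; gcongr; exact le_self_pow₀ hE1 (by norm_num)
  have h2 : P * E ≤ 300 * P * E := by
    have : 0 ≤ P * E := by positivity
    linarith
  have h3 : 1 ≤ 300 * P * E := (one_le_mul_of_one_le_of_one_le hP1 hE1).trans h2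
  calc P ^ 288 * E ≤ (P * E) ^ 288 := h1
    _ ≤ (300 * P * E) ^ 288 := by gcongr
    _ ≤ (300 * P * E) ^ 300 := pow_le_pow_right₀ h3 (by norm_num)
    _ = _ := by rw [← Real.rpow_natCast]; norm_num

/-- The logarithm of `ntB/ε` contains `-log ε ≥ 0` once, the sum on the right twice; all other terms
agree and are non-negative. -/
theorem degree_le_locality {n t d : ℕ} {B α ε : ℝ} (hn : 2 ≤ n) (ht : 1 ≤ t) (hB : 1 ≤ B)
    (hα : 1 ≤ α) (hε : 0 < ε) (hε1 : ε < 1)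
    (hd : (d : ℝ) ≤ 14 * (α * Real.log (n * t * B / ε))) :
    (d : ℝ) ≤ 300 * α * (Real.log (n / ε) + Real.log (t / ε) + Real.log B) := by
  have hn' : (2 : ℝ) ≤ n := by exact_mod_cast hn
  have ht' : (1 : ℝ) ≤ t := by exact_mod_cast ht
  have hlogε : Real.log ε ≤ 0 := Real.log_nonpos hε.le hε1.le
  have h1 : Real.log (n * t * B / ε) = Real.log n + Real.log t + Real.log B - Real.log ε := by
    rw [Real.log_div (by positivity) hε.ne', Real.log_mul (by positivity) (by positivity),
      Real.log_mul (by positivity) (by positivity)]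
  have h2 : Real.log (n / ε) = Real.log n - Real.log ε := Real.log_div (by positivity) hε.ne'
  have h3 : Real.log (t / ε) = Real.log t - Real.log ε := Real.log_div (by positivity) hε.ne'
  have h4 : 0 ≤ Real.log n := Real.log_nonneg (by linarith)
  have h5 : 0 ≤ Real.log t := Real.log_nonneg ht'
  have h6 : 0 ≤ Real.log B := Real.log_nonneg hB
  calc (d : ℝ) ≤ α * (14 * Real.log (n * t * B / ε)) := hd.trans_eq (by ring)
    _ ≤ α * (300 * (Real.log (n / ε) + Real.log (t / ε) + Real.log B)) := by
      refine mul_le_mul_of_nonneg_left ?_ (by linarith)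
      rw [h1, h2, h3]
      linarith
    _ = _ := by ring

end Bounds

end LocalMQ

/-! ### Assembly of the learning theorem. -/

theorem mainTheorem1 :
    ∃ (L : LocalMQ.Program) (C : ℝ), 1 ≤ C ∧
      ∀ (n t : ℕ) (B α ε δ : ℝ), 2 ≤ n → 1 ≤ t → 0 ≤ B → 1 ≤ α →
        0 < ε → ε < 1 → 0 < δ → δ < 1 →
        LocalMQ.LearnsInTime L (LocalMQ.inputState n t B α ε δ)
          (LocalMQ.locallySmooth n α) (LocalMQ.sparsePolynomials n t B)
          (C * α * (Real.log (n / ε) + Real.log (t / ε) + Real.log (max B 1)))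
          ((C * ((n * t * max B 1 / ε) ^ α) ^ Real.logb 2 (1 + α) *
            (1 + Real.log (n / δ))) ^ C)
          ε δ := by
  classical
  refine ⟨LocalMQ.learnProg, 300, by norm_num, ?_⟩
  intro n t B α ε δ hn ht hB hα hε hε1 hδ hδ1 D hD f hf
  obtain ⟨c, hct, hcB, rfl⟩ := hf
  have hB1 : 1 ≤ max B 1 := le_max_right _ _
  have ht' : (1 : ℝ) ≤ t := by exact_mod_cast ht
  obtain ⟨d, k, l, hd, hd', hk, hk', hl, hl', hd1, hdM, hkM, hlE⟩ :=
    LocalMQ.exists_parameters hn ht hB1 hα hε hε1 hδ hδ1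
  have hr := LocalMQ.degree_le_locality hn ht hB1 hα hε hε1 hdM
  -- The parameters are introduced as opaque variables with defining equations, the form in which
  -- the lemmas on the program, the cost and the loss all take them.
  obtain ⟨v, hv⟩ : ∃ v, v = (1 + α) ^ (d + k) := ⟨_, rfl⟩
  obtain ⟨cap, hcap⟩ : ∃ cap, cap = 5 * t * v ^ 2 := ⟨_, rfl⟩
  obtain ⟨T, hT⟩ : ∃ T, T = 16 * t * max B 1 ^ 2 * cap / ε := ⟨_, rfl⟩
  obtain ⟨γ, hγ⟩ : ∃ γ, γ = ε / (16 * cap ^ 2 * t ^ 2 * max B 1 ^ 2) := ⟨_, rfl⟩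
  obtain ⟨μ, hμ⟩ : ∃ μ, μ = (n + l + 2) / γ ^ 2 := ⟨_, rfl⟩
  obtain ⟨m, hm⟩ : ∃ m, m = ⌈μ⌉₊ := ⟨_, rfl⟩
  obtain ⟨σ, hσ⟩ : ∃ σ, σ = 1 / (2 * cap * m) := ⟨_, rfl⟩
  have hv2 : 2 ≤ v := by
    rw [hv]
    calc (2 : ℝ) ≤ 1 + α := by linarith
      _ ≤ (1 + α) ^ (d + k) := le_self_pow₀ (by linarith) (by omega)
  have hcap1 : 1 ≤ cap := by rw [hcap]; nlinarith
  have hγ0 : 0 < γ := by rw [hγ]; positivity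
  have hμ0 : 0 < μ := by rw [hμ]; positivity
  have hm0 : 0 < m := hm ▸ Nat.ceil_pos.2 hμ0
  have hT0 : 0 ≤ T := by rw [hT]; positivity
  have run (ω : ℕ → LocalMQ.Cube n) :=
    LocalMQ.wp_learnProg (c := c) (ω := ω) hd hd' hk hk' hl hl' hv hcap hcap1 hT hγ hμ hm rfl hσ hr
  constructor
  -- Halting, locality and time for every outcome; the length of the output list is bounded by the
  -- capacity.
  · intro ω
    obtain ⟨j, s', hexec, hj, hterms, -⟩ := run ω
    refine ⟨j, s', hexec, le_trans ?_ (LocalMQ.learner_cost_le hn ht hB1 hα hε hε1 hδ hδ1 hdM hkM hlE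
      hv hcap hT hγ hμ hm rfl rfl)⟩
    refine Nat.cast_le.2 (Nat.add_le_add hj (Nat.mul_le_mul_right _ ?_))
    rw [hterms]
    exact LocalMQ.length_candidates_le (Nat.le_floor (by simpa using hcap1)) n
  -- The event of success contains the event that the sample is representative.
  · refine (LocalMQ.measure_representative_ge D c hγ0.le hδ hl (m := m) ?_).trans
      (MeasureTheory.measure_mono fun ω hω => ?_)
    · have h1 : μ ≤ m := hm ▸ Nat.le_ceil μ
      calc (n + l + 2 : ℝ) = μ * γ ^ 2 := by rw [hμ]; field_simp
        _ ≤ m * γ ^ 2 := by gcongr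
    · obtain ⟨j, s', hexec, -, -, hout⟩ := run ω
      refine ⟨j, s', hexec, ?_⟩
      rw [LocalMQ.sqLoss]
      simp only [hout]
      refine LocalMQ.Representative.loss_le hω hm0 (by linarith) (fun x => ENNReal.toReal_nonneg)
        (LocalMQ.smoothAt_of_mem_locallySmooth hD) (LocalMQ.sum_toReal_pmf D) ht ?_ hB1
        (fun S => (hcB S).trans (le_max_left _ _)) hε hε1.le ?_ hk hv hv2 hcap hγ ?_ ?_ hσ _ rfl _
        (fun _ _ => rfl) _ fun _ => rfl
      · rw [← Set.ncard_coe_finset]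
        simpa using hct
      · rw [div_mul_eq_mul_div, div_le_one hε] at hd
        exact hd
      · rw [← hT]; exact Nat.le_ceil T
      · rw [← hT]; exact (Nat.ceil_lt_add_one hT0).le
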